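/- Let $\mathcal H$ be a class of finite simple graphs (closed under isomorphism) that is hereditary (closed under induced subgraphs) and closed under disjoint unions. An $\mathcal H$-deletion set of $G$ is a set $S\subseteq V(G)$ with $G-S\in\mathcal H$; the problem $\mathcal H$-deletion asks for one of minimum size. A $t$-boundaried graph is a finite graph together with a bijection from $\{1,\dots,t\}$ to a set $X$ of its vertices. Two of them are compatible if matching the labels is an isomorphism between the graphs induced by the boundaries; $\oplus$ glues compatible graphs by identifying equally labelled boundary vertices. $A,B$ are $(\mathcal H,t)$-equivalent if they are compatible and $A\oplus C\in\mathcal H\iff B\oplus C\in\mathcal H$ for every compatible $t$-boundaried $C$. Suppose $\mathcal H$-membership is finite state: for every $t$ this relation has finitely many classes. A minimal representative is a boundaried graph with underlying graph in $\mathcal H$ that has the fewest vertices in its class. An $(\mathcal H,\le k)$-representative family consists of minimal representatives with boundary sizes in $\{1,\dots,k\}$ and contains one from every class (for these boundary sizes) of graphs in $\mathcal H$; $r_{\mathcal H}(k)$ is the maximum number of vertices of such a minimal representative (and $0$ if there is none). Suppose that Disjoint $\mathcal H$-deletion can be solved in time $f(s,\ell)\cdot n^{O(1)}$: given a graph $G$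 on $n$ vertices, integers $s,\ell$ and an $\mathcal H$-deletion set $U$ of $G$ with $|U|\le\ell$, return a minimum-size $\mathcal H$-deletion set contained in $V(G)\setminus U$, or conclude that no such set of size at most $s$ exists. A tree $\mathcal H$-decomposition of $G$ is a triple $(T,\chi,L)$ with $T$ a rooted tree, $\chi:V(T)\to 2^{V(G)}$ and $L\subseteq V(G)$ such that (i) for every $v\in V(G)$ the nodes whose bag contains $v$ form a non-empty connected subtree, (ii) every edge of $G$ lies in some bag, (iii) every $v\in L$ lies in exactly one bag, and that is the bag of a leaf, (iv) $G[\chi(t)\cap L]\in\mathcal H$ for every node $t$. Its width is $\max(0,\max_t|\chi(t)\setminus L|-1)$. Then $\mathcal H$-deletion on $n$-vertex graphs, when a tree $\mathcal H$-decomposition of width $k-1$ (where $k\geq 1$) with $N$ nodes is given, can be solved as follows. (1) If some algorithm, given $k$, computes an $(\mathcal H,\le k)$-representative family in time $v(k)$, then $\mathcal H$-deletion can be solved in time $2^{O(k)}\cdot f(k,r_{\mathcal H}(k))\cdot v(k)^{O(1)}\cdot(n+N)^{O(1)}$. (2) If $r:\mathbb N\to\mathbb N$ is a function that can be computed in time polynomial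 in $k+r(k)$ and $r_{\mathcal H}(k)\le r(k)$ for all $k$, then $\mathcal H$-deletion can be solved in time $f(k,r_{\mathcal H}(k))\cdot 2^{O(r(k)^2+k)}\cdot(n+N)^{O(1)}$. In particular, the last factors are $n^{O(1)}$ if $N=n^{O(1)}$. The constants in the $O(\cdot)$ may depend on $\mathcal H$, on the function $r$ and on the assumed algorithms, but not on the input. Factors $n^{O(1)}$ and $(n+N)^{O(1)}$ are read as $(n+2)^{O(1)}$ and $(n+N+2)^{O(1)}$. Running times are numbers of elementary steps of WHILE programs on binary trees ("pure Lisp": each constant, projection, pairing, test and loop pass costs one step), with graphs given by adjacency matrices, sets by characteristic vectors and numbers in unary. -/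

import Mathlib

open scoped Classical in
/-- Auxiliary: the proposition-valued bit `1` or `0`. -/
noncomputable def propBit (P : Prop) : Bool := decide P

/-! ### Graph classes -/

/-- A class of finite simple graphs, closed under isomorphism. -/
structure GraphClass where
  Mem : ∀ {V : Type} [Finite V], SimpleGraph V → Prop
  mem_of_iso : ∀ {V W : Type} [Finite V] [Finite W] {G : SimpleGraph V} {G' : SimpleGraph W},
    (G ≃g G') → Mem G → Mem G'

namespace GraphClass

/-- Closed under induced subgraphs. -/
def Hereditary (H : GraphClass) : Prop :=
  ∀ (V : Type) [Finite V] (G : SimpleGraph V) (s : Set V), H.Mem G → H.Mem (G.induce s)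

/-- Closed under disjoint unions of two graphs. -/
def UnionClosed (H : GraphClass) : Prop :=
  ∀ (V W : Type) [Finite V] [Finite W] (G : SimpleGraph V) (G' : SimpleGraph W),
    H.Mem G → H.Mem G' → H.Mem (SimpleGraph.sum G G')

/-- `S` is an `H`-deletion set of `G`: the graph `G - S` belongs to `H`. -/
def IsDeletionSet (H : GraphClass) {n : ℕ} (G : SimpleGraph (Fin n)) (S : Finset (Fin n)) : Prop :=
  H.Mem (G.induce ((S : Set (Fin n))ᶜ))

/-- A correct answer to `H`-deletion: a minimum-size `H`-deletion set of `G`. -/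
def IsMinDeletionSet (H : GraphClass) {n : ℕ} (G : SimpleGraph (Fin n))
    (S : Finset (Fin n)) : Prop :=
  H.IsDeletionSet G S ∧ ∀ S' : Finset (Fin n), H.IsDeletionSet G S' → S.card ≤ S'.card

/-- A correct answer to Disjoint `H`-deletion on `(G, s, U)`: either (`some S`) a minimum-size set
among the `H`-deletion sets disjoint from `U`, or (`none`) the conclusion that there is no
`H`-deletion set of size at most `s` disjoint from `U`. -/
def IsDisjointAnswer (H : GraphClass) {n : ℕ} (G : SimpleGraph (Fin n)) (s : ℕ)
    (U : Finset (Fin n)) : Option (Finset (Fin n)) → Prop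
  | some S => (Disjoint S U ∧ H.IsDeletionSet G S) ∧
      ∀ S' : Finset (Fin n), Disjoint S' U → H.IsDeletionSet G S' → S.card ≤ S'.card
  | none => ∀ S' : Finset (Fin n), Disjoint S' U → H.IsDeletionSet G S' → s < S'.card

end GraphClass

/-! ### Boundaried graphs -/

/-- A `k`-boundaried graph: a finite graph with an injective labelling `bd` of its boundary, the
range of `bd`, by `k` labels. -/
structure BGraph (k : ℕ) where
  V : Type
  [finiteV : Finite V]
  graph : SimpleGraph V
  bd : Fin k ↪ V

attribute [instance] BGraph.finiteV

namespace BGraph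

/-- Matching the labels is an isomorphism between the graphs induced by the boundaries. -/
def Compatible {k : ℕ} (A B : BGraph k) : Prop :=
  ∀ i j : Fin k, A.graph.Adj (A.bd i) (A.bd j) ↔ B.graph.Adj (B.bd i) (B.bd j)

/-- Vertices of the glued graph: all vertices of `A` and the non-boundary vertices of `B`; the
boundary vertex `B.bd i` is identified with `A.bd i`. -/
abbrev GlueVertex {k : ℕ} (A B : BGraph k) : Type := A.V ⊕ {v : B.V // v ∉ Set.range B.bd}

/-- `GlueRep A B x b`: the vertex `x` of the glued graph is the image of the vertex `b` of `B`. -/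
def GlueRep {k : ℕ} (A B : BGraph k) : GlueVertex A B → B.V → Prop
  | Sum.inl a, b => ∃ i, a = A.bd i ∧ b = B.bd i
  | Sum.inr v, b => v.1 = b

theorem GlueRep.unique {k : ℕ} {A B : BGraph k} {x : GlueVertex A B} {b b' : B.V}
    (h : GlueRep A B x b) (h' : GlueRep A B x b') : b = b' := by
  cases x with
  | inl a =>
    obtain ⟨i, hi, rfl⟩ := h
    obtain ⟨j, hj, rfl⟩ := h'
    rw [A.bd.injective (hi.symm.trans hj)]
  | inr v => exact Eq.trans (Eq.symm h) h'

/-- The gluing `A ⊕ B`: the disjoint union, with equally labelled boundary vertices identified.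
Two vertices are adjacent iff they are the images of two adjacent vertices of `A` or of `B`. -/
def glue {k : ℕ} (A B : BGraph k) : SimpleGraph (GlueVertex A B) where
  Adj x y := (∃ a a', x = Sum.inl a ∧ y = Sum.inl a' ∧ A.graph.Adj a a') ∨
    ∃ b b', GlueRep A B x b ∧ GlueRep A B y b' ∧ B.graph.Adj b b'
  symm := ⟨by
    rintro x y (⟨a, a', hx, hy, h⟩ | ⟨b, b', hx, hy, h⟩)
    · exact Or.inl ⟨a', a, hy, hx, h.symm⟩
    · exact Or.inr ⟨b', b, hy, hx, h.symm⟩⟩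
  loopless := ⟨by
    rintro x (⟨a, a', hx, hy, h⟩ | ⟨b, b', hx, hy, h⟩)
    · rw [hx] at hy
      exact h.ne (Sum.inl_injective hy)
    · exact h.ne (hx.unique hy)⟩

end BGraph

namespace GraphClass

/-- `(H, k)`-equivalence of `k`-boundaried graphs. -/
def Equivalent (H : GraphClass) {k : ℕ} (A B : BGraph k) : Prop :=
  A.Compatible B ∧
    ∀ C : BGraph k, A.Compatible C → (H.Mem (A.glue C) ↔ H.Mem (B.glue C))

/-- `(H, k)`-equivalence as an equivalence relation. -/
def equivSetoid (H : GraphClass) (k : ℕ) : Setoid (BGraph k) where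
  r := H.Equivalent
  iseqv :=
    { refl := fun _ => ⟨fun _ _ => Iff.rfl, fun _ _ => Iff.rfl⟩
      symm := fun {_ _} h => ⟨fun i j => (h.1 i j).symm, fun C hC =>
        (h.2 C (fun i j => (h.1 i j).trans (hC i j))).symm⟩
      trans := fun {_ _ _} h h' => ⟨fun i j => (h.1 i j).trans (h'.1 i j), fun D hD =>
        (h.2 D hD).trans (h'.2 D (fun i j => (h.1 i j).symm.trans (hD i j)))⟩ }

/-- `H`-membership is finite state. -/
def FiniteState (H : GraphClass) : Prop :=
  ∀ k : ℕ, Finite (Quotient (H.equivSetoid k))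

/-- Minimal representative: the graph is in `H`, and no equivalent one has fewer vertices. -/
def IsMinRep (H : GraphClass) {k : ℕ} (A : BGraph k) : Prop :=
  H.Mem A.graph ∧ ∀ B : BGraph k, H.Equivalent A B → Nat.card A.V ≤ Nat.card B.V

/-- `r_H(k)`: the maximum number of vertices of a minimal representative with a boundary of size
`t ∈ {1, …, k}` (the set below is finite when `H`-membership is finite state; the maximum is `0`
if there are no such representatives). -/
noncomputable def repSize (H : GraphClass) (k : ℕ) : ℕ :=
  sSup {m : ℕ | ∃ t : ℕ, 1 ≤ t ∧ t ≤ k ∧ ∃ A : BGraph t, H.IsMinRep A ∧ Nat.card A.V = m}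

end GraphClass

/-- A `t`-boundaried graph on the vertex set `{0, …, n - 1}`, as handled by algorithms. -/
structure FinBGraph (t : ℕ) where
  n : ℕ
  graph : SimpleGraph (Fin n)
  bd : Fin t ↪ Fin n

/-- The underlying boundaried graph. -/
def FinBGraph.toBGraph {t : ℕ} (R : FinBGraph t) : BGraph t where
  V := Fin R.n
  graph := R.graph
  bd := R.bd

/-- `F` is an `(H, ≤ k)`-representative family: it consists of minimal representatives with
boundary size in `{1, …, k}`, and contains one from every equivalence class of such boundaried
graphs whose underlying graphs belong to `H`. -/
def GraphClass.IsRepFamily (H : GraphClass) (k : ℕ) (F : List (Σ t : ℕ, FinBGraph t)) : Prop :=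
  (∀ R ∈ F, 1 ≤ R.1 ∧ R.1 ≤ k ∧ H.IsMinRep R.2.toBGraph) ∧
    ∀ t : ℕ, 1 ≤ t → t ≤ k → ∀ A : BGraph t, H.Mem A.graph →
      ∃ R : FinBGraph t, ⟨t, R⟩ ∈ F ∧ H.Equivalent R.toBGraph A

/-! ### Tree `H`-decompositions -/

/-- The data `(T, χ, L)` of a decomposition of a graph on `Fin n`: a graph `T` on `Fin N` with a
root, a bag for every node, and a set of base vertices. -/
structure DecompData (n N : ℕ) where
  tree : SimpleGraph (Fin N)
  root : Fin N
  bag : Fin N → Finset (Fin n)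
  base : Finset (Fin n)

namespace DecompData

/-- A leaf of the rooted tree: a node without children, a child of `t` being a neighbour of `t`
that is farther from the root. -/
def IsLeaf {n N : ℕ} (D : DecompData n N) (t : Fin N) : Prop :=
  ∀ u : Fin N, D.tree.Adj t u → ¬ D.tree.dist D.root t < D.tree.dist D.root u

/-- `(T, χ, L)` is a tree `H`-decomposition of `G`. -/
structure IsTreeDecomp {n N : ℕ} (D : DecompData n N) (H : GraphClass)
    (G : SimpleGraph (Fin n)) : Prop where
  isTree : D.tree.IsTree
  /-- the nodes whose bags contain `v` form a non-empty connected subtree -/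
  connected : ∀ v : Fin n, (D.tree.induce {t | v ∈ D.bag t}).Connected
  edge : ∀ u v : Fin n, G.Adj u v → ∃ t, u ∈ D.bag t ∧ v ∈ D.bag t
  /-- every base vertex is in exactly one bag, that of a leaf -/
  base_leaf : ∀ v ∈ D.base, ∃ t, D.IsLeaf t ∧ ∀ u, v ∈ D.bag u ↔ u = t
  base_mem : ∀ t, H.Mem (G.induce ((D.bag t ∩ D.base : Finset (Fin n)) : Set (Fin n)))

/-- The width `max (0, max_t |χ(t) \ L| - 1)` (subtraction of natural numbers truncates at `0`). -/
def width {n N : ℕ} (D : DecompData n N) : ℕ :=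
  Finset.univ.sup fun t => (D.bag t \ D.base).card - 1

end DecompData

/-! ### The model of computation

WHILE programs on binary trees ("pure Lisp"): values are built from `nil` by pairing, and every
elementary operation (constant, projection, pairing, test, one pass through a loop) costs one
step. A program has constant size; it is polynomially equivalent to a Turing machine. -/

/-- Values: binary trees. -/
inductive Val : Type
  | nil : Val
  | pair : Val → Val → Val

/-- Programs. Each transforms a value; in `seq p q` the program `p` is run first, `ite c p q`
branches on whether the value of `c` is different from `nil`, and `loop c p` replaces the current
value by its image under `p` as long as the value of `c` is different from `nil`. -/
inductive Prog : Type
  | id : Prog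
  | nil : Prog
  | pair : Prog → Prog → Prog
  | fst : Prog
  | snd : Prog
  | seq : Prog → Prog → Prog
  | ite : Prog → Prog → Prog → Prog
  | loop : Prog → Prog → Prog

/-- `p.Runs x y t`: on input `x` the program `p` halts with output `y` after exactly `t` steps. -/
inductive Prog.Runs : Prog → Val → Val → ℕ → Prop
  | id (x : Val) : Runs Prog.id x x 1
  | nil (x : Val) : Runs Prog.nil x Val.nil 1
  | pair {p q : Prog} {x a b : Val} {s t : ℕ} :
      Runs p x a s → Runs q x b t → Runs (Prog.pair p q) x (Val.pair a b) (s + t + 1)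
  | fst_pair (a b : Val) : Runs Prog.fst (Val.pair a b) a 1
  | fst_nil : Runs Prog.fst Val.nil Val.nil 1
  | snd_pair (a b : Val) : Runs Prog.snd (Val.pair a b) b 1
  | snd_nil : Runs Prog.snd Val.nil Val.nil 1
  | seq {p q : Prog} {x y z : Val} {s t : ℕ} :
      Runs p x y s → Runs q y z t → Runs (Prog.seq p q) x z (s + t + 1)
  | ite_pos {c p q : Prog} {x a b y : Val} {s t : ℕ} :
      Runs c x (Val.pair a b) s → Runs p x y t → Runs (Prog.ite c p q) x y (s + t + 1)
  | ite_neg {c p q : Prog} {x y : Val} {s t : ℕ} :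
      Runs c x Val.nil s → Runs q x y t → Runs (Prog.ite c p q) x y (s + t + 1)
  | loop_stop {c p : Prog} {x : Val} {s : ℕ} :
      Runs c x Val.nil s → Runs (Prog.loop c p) x x (s + 1)
  | loop_step {c p : Prog} {x a b y z : Val} {s t u : ℕ} :
      Runs c x (Val.pair a b) s → Runs p x y t → Runs (Prog.loop c p) y z u →
        Runs (Prog.loop c p) x z (s + t + u + 1)

/-- On input `x` the program `p` halts with output `y` within `T` steps. -/
def Prog.RunsWithin (p : Prog) (x y : Val) (T : ℕ) : Prop :=
  ∃ t : ℕ, t ≤ T ∧ p.Runs x y t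

/-! ### Encodings -/

namespace Val

def ofBool : Bool → Val
  | false => nil
  | true => pair nil nil

def ofList : List Val → Val
  | [] => nil
  | a :: l => pair a (ofList l)

/-- Numbers are encoded in unary. -/
def ofNat : ℕ → Val
  | 0 => nil
  | n + 1 => pair nil (ofNat n)

/-- A set of vertices, by its characteristic vector. -/
noncomputable def ofSet {n : ℕ} (S : Finset (Fin n)) : Val :=
  ofList (List.ofFn fun i => ofBool (propBit (i ∈ S)))

/-- A graph, by its adjacency matrix. -/
noncomputable def ofGraph {n : ℕ} (G : SimpleGraph (Fin n)) : Val :=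
  ofList (List.ofFn fun i => ofList (List.ofFn fun j => ofBool (propBit (G.Adj i j))))

noncomputable def ofOptionSet {n : ℕ} : Option (Finset (Fin n)) → Val
  | none => nil
  | some S => pair (ofSet S) nil

/-- A boundaried graph, by its adjacency matrix and the list of its boundary vertices. -/
noncomputable def ofFinBGraph {t : ℕ} (R : FinBGraph t) : Val :=
  pair (ofGraph R.graph) (ofList (List.ofFn fun i => ofNat (R.bd i : ℕ)))

noncomputable def ofFamily (F : List (Σ t : ℕ, FinBGraph t)) : Val :=
  ofList (F.map fun R => ofFinBGraph R.2)

noncomputable def ofDecomp {n N : ℕ} (D : DecompData n N) : Val :=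
  ofList [ofGraph D.tree, ofNat (D.root : ℕ), ofList (List.ofFn fun t => ofSet (D.bag t)),
    ofSet D.base]

/-- The input of Disjoint `H`-deletion. -/
noncomputable def ofDisjointInput {n : ℕ} (G : SimpleGraph (Fin n)) (s l : ℕ)
    (U : Finset (Fin n)) : Val :=
  ofList [ofGraph G, ofNat s, ofNat l, ofSet U]

end Val

/-! ### Running times -/

/-- Disjoint `H`-deletion admits an algorithm with running time `f(s, ℓ) · n^{O(1)}`; the factor
`n^{O(1)}` is written `(n + 2) ^ c` to be meaningful for `n = 0` and `n = 1`. The instances are the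
`(G, s, ℓ, U)` where `U` is an `H`-deletion set of `G` of size at most `ℓ`. -/
def GraphClass.DisjointDeletionInTime (H : GraphClass) (f : ℕ → ℕ → ℕ) : Prop :=
  ∃ (p : Prog) (c : ℕ), ∀ (n : ℕ) (G : SimpleGraph (Fin n)) (s l : ℕ) (U : Finset (Fin n)),
    U.card ≤ l → H.IsDeletionSet G U →
      ∃ ans : Option (Finset (Fin n)), H.IsDisjointAnswer G s U ans ∧
        p.RunsWithin (Val.ofDisjointInput G s l U) (Val.ofOptionSet ans) (f s l * (n + 2) ^ c)

/-- There is an algorithm that, given `k`, computes an `(H, ≤ k)`-representative family in time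
`v k`. -/
def GraphClass.RepFamilyInTime (H : GraphClass) (v : ℕ → ℕ) : Prop :=
  ∃ p : Prog, ∀ k : ℕ, ∃ F : List (Σ t : ℕ, FinBGraph t), H.IsRepFamily k F ∧
    p.RunsWithin (Val.ofNat k) (Val.ofFamily F) (v k)

/-- The function `r` can be computed in time polynomial in `k + r k`. -/
def PolyTimeConstructible (r : ℕ → ℕ) : Prop :=
  ∃ (p : Prog) (c : ℕ), ∀ k : ℕ,
    p.RunsWithin (Val.ofNat k) (Val.ofNat (r k)) ((k + r k + 2) ^ c)

/-- There is an algorithm that, given a graph `G` on `n` vertices and a tree `H`-decomposition of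
`G` of width `k - 1` with `N` nodes, computes a minimum `H`-deletion set of `G` in time
`T k n N`. -/
def GraphClass.DeletionInTime (H : GraphClass) (T : ℕ → ℕ → ℕ → ℕ) : Prop :=
  ∃ p : Prog, ∀ (n N : ℕ) (G : SimpleGraph (Fin n)) (D : DecompData n N) (k : ℕ),
    D.IsTreeDecomp H G → D.width + 1 = k →
      ∃ S : Finset (Fin n), H.IsMinDeletionSet G S ∧
        p.RunsWithin (Val.pair (Val.ofGraph G) (Val.ofDecomp D)) (Val.ofSet S) (T k n N)

/-! Let `X` be the part of a bag outside the base, so `|X| ≤ k`, and let `I` be a set of vertices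
all of whose neighbours lie in `I ∪ X`. A deletion set `W` influences what may be done on `I ∪ X`
only through its trace `W ∩ X` and through the graph `G - I - W` with boundary `X \ W`. This graph
is in `H` by heredity, hence equivalent to some member `R` of a representative family `F`. Whether a
set `Z ⊆ I ∪ X` with trace `W ∩ X` completes `W` outside `I ∪ X` depends on `R` alone
(`IsComplete.exists_rep`). It is therefore enough to keep, for every `S ⊆ X` and every `R ∈ F`, one
smallest set that has trace `S` and solves `R`: at most `2 ^ k * |F|` sets. The invariant `Suffices`
expresses this as an exchange property. It survives the merging of two adjacent nodes
(`Suffices.unions`) and the reduction to short lists (`Suffices.trim`). The tree is consumed by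
letting a node with a single living neighbour be absorbed by that neighbour, until one node is left.

Initially `I` is the base part of a bag, and `G[I]` is in `H`. An optimal solution has at most `k`
vertices in `I`: otherwise they could be traded for `X`, which cuts `I` off as a union of components
that is in `H` already. For given `S` and `R`, glue `G[(I ∪ X) \ S]` to `R`. The vertices of `R`
form a deletion set of the result, of size at most `r_H(k)`, and the sought completion avoids them.
So Disjoint `H`-deletion with parameters `k` and `r_H(k)` finds a smallest completion
(`DisjointSolver.suffices_answers`).

The same algorithm decides membership in `H` in polynomial time (`DisjointSolver.comp_mem`):
vertices are added one by one, and as long as the graph before was in `H`, the newest vertex is a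
deletion set of size `1`, so only the parameters `0` and `1` occur. This presupposes that the
one-vertex graph is in `H`; if it is not, all vertices have to be deleted.

For the second claim, all boundaried graphs with at most `r(k)` vertices are listed. By finite state
they include minimal representatives of all relevant classes, and both equivalence and minimality
can be tested against the listed graphs alone (`FiniteState.equivalent_iff`,
`FiniteState.isMinRep_iff`). This gives a representative family in time `2 ^ O(r(k) ^ 2 + k)`, to
which the first claim applies.

Running times are handled by the predicate `Comp`, a uniform form of polynomial-time computability.
Its time bounds are linear in a first parameter, which carries `f`, and polynomial in a second one,
which carries `n + N + 2 ^ k + v(k)`. -/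

/-! ### A calculus of programs with time bounds -/

namespace Prog

variable {p q r c : Prog} {x y z a b : Val} {s t u T : ℕ}

theorem RunsWithin.mono (h : p.RunsWithin x y s) (hst : s ≤ t) : p.RunsWithin x y t :=
  let ⟨u, hu, hr⟩ := h
  ⟨u, hu.trans hst, hr⟩

theorem runsWithin_id (x : Val) : Prog.id.RunsWithin x x 1 := ⟨1, le_rfl, .id x⟩

theorem runsWithin_nil (x : Val) : Prog.nil.RunsWithin x .nil 1 := ⟨1, le_rfl, .nil x⟩

theorem runsWithin_fst (a b : Val) : Prog.fst.RunsWithin (.pair a b) a 1 := ⟨1, le_rfl, .fst_pair a b⟩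

theorem runsWithin_snd (a b : Val) : Prog.snd.RunsWithin (.pair a b) b 1 := ⟨1, le_rfl, .snd_pair a b⟩

theorem RunsWithin.pair (hp : p.RunsWithin x a s) (hq : q.RunsWithin x b t) :
    (Prog.pair p q).RunsWithin x (.pair a b) (s + t + 1) := by
  obtain ⟨s', hs, hp⟩ := hp
  obtain ⟨t', ht, hq⟩ := hq
  exact ⟨s' + t' + 1, by omega, .pair hp hq⟩

theorem RunsWithin.seq (hp : p.RunsWithin x y s) (hq : q.RunsWithin y z t) :
    (Prog.seq p q).RunsWithin x z (s + t + 1) := by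
  obtain ⟨s', hs, hp⟩ := hp
  obtain ⟨t', ht, hq⟩ := hq
  exact ⟨s' + t' + 1, by omega, .seq hp hq⟩

theorem RunsWithin.ite_pos (hc : c.RunsWithin x (.pair a b) s) (hp : p.RunsWithin x y t) :
    (Prog.ite c p q).RunsWithin x y (s + t + 1) := by
  obtain ⟨s', hs, hc⟩ := hc
  obtain ⟨t', ht, hp⟩ := hp
  exact ⟨s' + t' + 1, by omega, .ite_pos hc hp⟩

theorem RunsWithin.ite_neg (hc : c.RunsWithin x .nil s) (hq : q.RunsWithin x y t) :
    (Prog.ite c p q).RunsWithin x y (s + t + 1) := by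
  obtain ⟨s', hs, hc⟩ := hc
  obtain ⟨t', ht, hq⟩ := hq
  exact ⟨s' + t' + 1, by omega, .ite_neg hc hq⟩

theorem RunsWithin.loop_stop (hc : c.RunsWithin x .nil s) :
    (Prog.loop c p).RunsWithin x x (s + 1) := by
  obtain ⟨s', hs, hc⟩ := hc
  exact ⟨s' + 1, by omega, Runs.loop_stop hc⟩

theorem RunsWithin.loop_step (hc : c.RunsWithin x (.pair a b) s) (hp : p.RunsWithin x y t)
    (hl : (Prog.loop c p).RunsWithin y z u) :
    (Prog.loop c p).RunsWithin x z (s + t + u + 1) := by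
  obtain ⟨s', hs, hc⟩ := hc
  obtain ⟨t', ht, hp⟩ := hp
  obtain ⟨u', hu, hl⟩ := hl
  exact ⟨s' + t' + u' + 1, by omega, .loop_step hc hp hl⟩

theorem RunsWithin.one_le (h : p.RunsWithin x y T) : 1 ≤ T := by
  obtain ⟨t, ht, h⟩ := h
  have : 1 ≤ t := by cases h <;> omega
  omega

end Prog

/-! ### Cost scales -/

/-- The time bound of exponent `c` at the scale `b`. -/
def cost (b : ℕ × ℕ) (c : ℕ) : ℕ := (b.1 + 1) * (b.2 + 2) ^ c

theorem cost_mono (b : ℕ × ℕ) {c c' : ℕ} (h : c ≤ c') : cost b c ≤ cost b c' :=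
  Nat.mul_le_mul_left _ (Nat.pow_le_pow_right (by omega) h)

theorem two_pow_mul_cost (b : ℕ × ℕ) (c d : ℕ) : 2 ^ d * cost b c ≤ cost b (c + d) := by
  have : 2 ^ d ≤ (b.2 + 2) ^ d := Nat.pow_le_pow_left (by omega) d
  calc 2 ^ d * cost b c ≤ (b.2 + 2) ^ d * cost b c := Nat.mul_le_mul_right _ this
    _ = cost b (c + d) := by unfold cost; rw [pow_add]; ring

theorem one_le_cost (b : ℕ × ℕ) (c : ℕ) : 1 ≤ cost b c :=
  Nat.mul_pos (by omega) (Nat.pow_pos (by omega))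

/-- The number of passes of a loop is always bounded in terms of `b.2` only, so that the factor `b.1
+ 1` is never squared. -/
theorem mul_cost_le {b : ℕ × ℕ} {n c : ℕ} (h : n ≤ (b.2 + 2) ^ c) (c' : ℕ) :
    n * cost b c' ≤ cost b (c + c') := by
  calc n * cost b c' ≤ (b.2 + 2) ^ c * cost b c' := Nat.mul_le_mul_right _ h
    _ = cost b (c + c') := by unfold cost; rw [pow_add]; ring

/-- Each of the three summands is at most `cost b (c + c')`, and the `+ 2` in the exponent pays for
a factor `4`. The sum stays linear in `b.1 + 1`, which is why `f` enters the final bound only to the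
first power. -/
theorem cost_add_le (b : ℕ × ℕ) (c c' : ℕ) :
    cost b c + cost b c' + 1 ≤ cost b (c + c' + 2) := by
  have h1 := cost_mono b (Nat.le_add_right c c')
  have h2 := cost_mono b (Nat.le_add_left c' c)
  have h3 := one_le_cost b (c + c')
  have h4 := two_pow_mul_cost b (c + c') 2
  omega

/-- Numbers bounded by a fixed power of the second component of the scale. -/
def PolyBdd {ι : Type} (B : ι → ℕ × ℕ) (n : ι → ℕ) : Prop :=
  ∃ c : ℕ, ∀ i, n i ≤ ((B i).2 + 2) ^ c

namespace PolyBdd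

variable {ι κ : Type} {B : ι → ℕ × ℕ} {m n : ι → ℕ}

theorem mono (hn : PolyBdd B n) (h : ∀ i, m i ≤ n i) : PolyBdd B m :=
  let ⟨c, hc⟩ := hn
  ⟨c, fun i => (h i).trans (hc i)⟩

theorem const (k : ℕ) : PolyBdd B fun _ => k :=
  ⟨k, fun _ => (Nat.lt_two_pow_self.le).trans (Nat.pow_le_pow_left (by omega) k)⟩

theorem scale : PolyBdd B fun i => (B i).2 := ⟨1, fun i => by simp⟩

theorem mul (hm : PolyBdd B m) (hn : PolyBdd B n) : PolyBdd B fun i => m i * n i := by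
  obtain ⟨c, hc⟩ := hm
  obtain ⟨d, hd⟩ := hn
  exact ⟨c + d, fun i => by rw [pow_add]; exact Nat.mul_le_mul (hc i) (hd i)⟩

theorem add (hm : PolyBdd B m) (hn : PolyBdd B n) : PolyBdd B fun i => m i + n i := by
  obtain ⟨c, hc⟩ := hm
  obtain ⟨d, hd⟩ := hn
  refine ⟨c + d + 1, fun i => ?_⟩
  have h2 : 2 ≤ (B i).2 + 2 := by omega
  have h1 : ((B i).2 + 2) ^ c ≤ ((B i).2 + 2) ^ (c + d) :=
    Nat.pow_le_pow_right (by omega) (by omega)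
  have h3 : ((B i).2 + 2) ^ d ≤ ((B i).2 + 2) ^ (c + d) :=
    Nat.pow_le_pow_right (by omega) (by omega)
  have h4 : ((B i).2 + 2) ^ (c + d) * 2 ≤ ((B i).2 + 2) ^ (c + d + 1) := by
    rw [pow_succ]; exact Nat.mul_le_mul_left _ h2
  have := hc i
  have := hd i
  simp only
  omega

theorem pow (hm : PolyBdd B m) (k : ℕ) : PolyBdd B fun i => m i ^ k := by
  obtain ⟨c, hc⟩ := hm
  exact ⟨c * k, fun i => by rw [pow_mul]; exact Nat.pow_le_pow_left (hc i) k⟩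

theorem comap (hm : PolyBdd B m) (g : κ → ι) : PolyBdd (fun k => B (g k)) fun k => m (g k) :=
  let ⟨c, hc⟩ := hm
  ⟨c, fun k => hc (g k)⟩

theorem up {α : ι → Type} (hm : PolyBdd B m) :
    PolyBdd (fun p : Σ i, α i => B p.1) fun p => m p.1 := hm.comap Sigma.fst

theorem fin {n : ι → ℕ} (hn : PolyBdd B n) :
    PolyBdd (fun p : Σ i, Fin (n i) => B p.1) fun p => (p.2 : ℕ) :=
  hn.up.mono fun p => p.2.2.le

end PolyBdd

/-! ### Computable families of values -/

theorem propBit_eq_true {P : Prop} : propBit P = true ↔ P := by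
  exact @decide_eq_true_iff P (Classical.propDecidable P)

theorem propBit_eq_false {P : Prop} : propBit P = false ↔ ¬P := by
  exact @decide_eq_false_iff_not P (Classical.propDecidable P)

theorem propBit_pos {P : Prop} (h : P) : propBit P = true := propBit_eq_true.2 h

theorem propBit_neg {P : Prop} (h : ¬P) : propBit P = false := propBit_eq_false.2 h

/-- One program computes `a i` from `e i`, for all `i`, in time bounded by a fixed exponent at the
scale `B i`. -/
def Comp {ι : Type} (B : ι → ℕ × ℕ) (e a : ι → Val) : Prop :=
  ∃ (p : Prog) (c : ℕ), ∀ i, p.RunsWithin (e i) (a i) (cost (B i) c)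

/-- The truth value of `P i` is computable from `e i`. -/
abbrev CompProp {ι : Type} (B : ι → ℕ × ℕ) (e : ι → Val) (P : ι → Prop) : Prop :=
  Comp B e fun i => Val.ofBool (propBit (P i))

namespace Comp

open Val (ofList ofBool ofNat)

variable {ι κ : Type} {B : ι → ℕ × ℕ} {e a b d : ι → Val} {P Q : ι → Prop}

/-- A constant `c` is at most `2 ^ c`, and the base `b.2 + 2 ≥ 2` of the scale absorbs this. -/
theorem of_runs {p : Prog} {c : ℕ} (h : ∀ i, p.RunsWithin (e i) (a i) c) : Comp B e a := by
  refine ⟨p, c, fun i => (h i).mono ?_⟩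
  calc c ≤ 2 ^ c := Nat.lt_two_pow_self.le
    _ ≤ 2 ^ c * cost (B i) 0 := Nat.le_mul_of_pos_right _ (one_le_cost _ _)
    _ ≤ cost (B i) c := by simpa using two_pow_mul_cost (B i) 0 c

theorem refl : Comp B e e := of_runs fun i => Prog.runsWithin_id (e i)

theorem nil : Comp B e fun _ => .nil := of_runs fun i => Prog.runsWithin_nil (e i)

theorem pair (ha : Comp B e a) (hb : Comp B e b) : Comp B e fun i => .pair (a i) (b i) := by
  obtain ⟨p, c, hp⟩ := ha
  obtain ⟨q, d, hq⟩ := hb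
  exact ⟨.pair p q, _, fun i => ((hp i).pair (hq i)).mono (cost_add_le _ _ _)⟩

theorem trans (ha : Comp B e a) (hb : Comp B a b) : Comp B e b := by
  obtain ⟨p, c, hp⟩ := ha
  obtain ⟨q, d, hq⟩ := hb
  exact ⟨.seq p q, _, fun i => ((hp i).seq (hq i)).mono (cost_add_le _ _ _)⟩

theorem fst (h : Comp B e fun i => .pair (a i) (b i)) : Comp B e a :=
  h.trans (of_runs fun _ => Prog.runsWithin_fst _ _)

theorem snd (h : Comp B e fun i => .pair (a i) (b i)) : Comp B e b :=
  h.trans (of_runs fun _ => Prog.runsWithin_snd _ _)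

theorem comap (h : Comp B e a) (g : κ → ι) :
    Comp (fun k => B (g k)) (fun k => e (g k)) fun k => a (g k) :=
  let ⟨p, c, hp⟩ := h
  ⟨p, c, fun k => hp (g k)⟩

theorem congr (h : Comp B e a) (hab : ∀ i, a i = b i) : Comp B e b := by
  rwa [← funext hab]

/-- A variable bound by a loop or a quantifier is modelled by enlarging the index type and pairing
its value to the environment. `up` is the resulting weakening, and `var` reads the newest variable.
-/
theorem up {α : ι → Type} {x : (Σ i, α i) → Val} (h : Comp B e a) :
    Comp (fun p : Σ i, α i => B p.1) (fun p => .pair (e p.1) (x p)) fun p => a p.1 :=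
  (fst (b := x) refl).trans (h.comap Sigma.fst)

theorem var {α : ι → Type} {x : (Σ i, α i) → Val} :
    Comp (fun p : Σ i, α i => B p.1) (fun p => .pair (e p.1) (x p)) x :=
  snd refl

theorem sub (h : Comp B e a) (P : ι → Prop) :
    Comp (fun i : {i // P i} => B i.1) (fun i => e i.1) fun i => a i.1 :=
  h.comap Subtype.val

/-- Each branch has to be computable only on the indices for which it is taken. This makes it
possible to call an algorithm whose behaviour is specified only on valid instances. -/
theorem bool_ite {v : ι → Bool} (hc : Comp B e fun i => ofBool (v i))
    (ha : Comp (fun i : {i // v i = true} => B i.1) (fun i => e i.1) fun i => a i.1)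
    (hb : Comp (fun i : {i // v i = false} => B i.1) (fun i => e i.1) fun i => a i.1) :
    Comp B e a := by
  obtain ⟨p, c, hp⟩ := hc
  obtain ⟨q, d, hq⟩ := ha
  obtain ⟨r, f, hr⟩ := hb
  refine ⟨.ite p q r, c + (d + f) + 2, fun i => ?_⟩
  have hi := hp i
  cases hv : v i with
  | true =>
    simp only [hv] at hi
    exact ((hi.ite_pos (hq ⟨i, hv⟩)).mono (cost_add_le _ _ _)).mono (cost_mono _ (by omega))
  | false =>
    simp only [hv] at hi
    exact ((hi.ite_neg (hr ⟨i, hv⟩)).mono (cost_add_le _ _ _)).mono (cost_mono _ (by omega))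

theorem ite (hc : CompProp B e P)
    (ha : Comp (fun i : {i // P i} => B i.1) (fun i => e i.1) fun i => a i.1)
    (hb : Comp (fun i : {i // ¬P i} => B i.1) (fun i => e i.1) fun i => a i.1) : Comp B e a :=
  bool_ite hc (ha.comap fun i : {i // propBit (P i) = true} => ⟨i.1, propBit_eq_true.1 i.2⟩)
    (hb.comap fun i : {i // propBit (P i) = false} => ⟨i.1, propBit_eq_false.1 i.2⟩)

theorem true_ : CompProp B e fun _ => True :=
  (nil.pair nil).congr fun _ => by rw [propBit_pos trivial]; rfl

theorem false_ : CompProp B e fun _ => False :=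
  nil.congr fun _ => by rw [propBit_neg id]; rfl

theorem prop_congr (h : CompProp B e P) (hPQ : ∀ i, P i ↔ Q i) : CompProp B e Q :=
  h.congr fun i => by rw [propext (hPQ i)]

theorem of_forall (h : ∀ i, P i) : CompProp B e P :=
  true_.prop_congr fun i => iff_of_true trivial (h i)

theorem of_forall_not (h : ∀ i, ¬P i) : CompProp B e P :=
  false_.prop_congr fun i => iff_of_false id (h i)

theorem and' (hP : CompProp B e P)
    (hQ : CompProp (fun i : {i // P i} => B i.1) (fun i => e i.1) fun i => Q i.1) :
    CompProp B e fun i => P i ∧ Q i :=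
  ite hP (hQ.prop_congr fun i => ⟨fun h => ⟨i.2, h⟩, fun h => h.2⟩)
    (of_forall_not fun i h => i.2 h.1)

theorem and (hP : CompProp B e P) (hQ : CompProp B e Q) : CompProp B e fun i => P i ∧ Q i :=
  and' hP (hQ.sub P)

theorem or (hP : CompProp B e P) (hQ : CompProp B e Q) : CompProp B e fun i => P i ∨ Q i :=
  ite hP (of_forall fun i => Or.inl i.2)
    ((hQ.sub _).prop_congr fun i => ⟨Or.inr, fun h => h.resolve_left i.2⟩)

theorem not (hP : CompProp B e P) : CompProp B e fun i => ¬P i :=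
  ite hP (of_forall_not fun i h => h i.2) (of_forall fun i => i.2)

theorem iff (hP : CompProp B e P) (hQ : CompProp B e Q) : CompProp B e fun i => (P i ↔ Q i) :=
  ((hP.and hQ).or (hP.not.and hQ.not)).prop_congr fun i => by tauto

theorem imp (hP : CompProp B e P) (hQ : CompProp B e Q) : CompProp B e fun i => (P i → Q i) :=
  (hP.not.or hQ).prop_congr fun i => by tauto

theorem ne_nil (h : Comp B e a) : CompProp B e fun i => a i ≠ .nil := by
  obtain ⟨p, c, hp⟩ := h
  refine ⟨.ite p (.pair .nil .nil) .nil, c + 0 + 4, fun i => ?_⟩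
  have hi := hp i
  have h1 : 3 ≤ cost (B i) (0 + 2) := by
    have := two_pow_mul_cost (B i) 0 2
    have := one_le_cost (B i) 0
    omega
  have h2 : cost (B i) c + 3 + 1 ≤ cost (B i) (c + 0 + 4) :=
    (Nat.add_le_add_right (Nat.add_le_add_left h1 _) 1).trans (cost_add_le _ _ _)
  cases hv : a i with
  | nil =>
    rw [hv] at hi
    simp only [propBit_neg (not_not_intro hv)]
    exact (hi.ite_neg (Prog.runsWithin_nil _)).mono (by omega)
  | pair x y =>
    rw [hv] at hi
    have : a i ≠ .nil := by simp [hv]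
    simp only [propBit_pos this]
    exact (hi.ite_pos ((Prog.runsWithin_nil _).pair (Prog.runsWithin_nil _))).mono h2

end Comp

/-! ### Iteration over a list -/

namespace Val

theorem ofNat_eq (n : ℕ) : ofNat n = ofList (List.ofFn fun _ : Fin n => nil) := by
  induction n with
  | zero => rfl
  | succ n ih => rw [List.ofFn_succ]; exact congrArg _ ih

end Val

namespace Comp

open Val (ofList ofBool ofNat)

variable {ι κ : Type} {B : ι → ℕ × ℕ} {e a b d : ι → Val} {P Q : ι → Prop}

/-- Iterate `q` along a list; the values are `pair list (pair environment state)`. -/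
def foldProg (q : Prog) : Prog :=
  .loop .fst (.pair (.seq .fst .snd) (.pair (.seq .snd .fst)
    (.seq (.pair (.seq .snd .fst) (.pair (.seq .fst .fst) (.seq .snd .snd))) q)))

/-- Induction on the number `m` of passes still to come. The bookkeeping of a pass (test,
projections, pairings) costs `22` steps besides the body, and the final failing test costs `2`. -/
theorem loop_aux {q : Prog} {K n : ℕ} {e : Val} {x : Fin n → Val} {st : ℕ → Val}
    (hq : ∀ j : Fin n, q.RunsWithin (.pair e (.pair (x j) (st j))) (st (j + 1)) K)
    (m : ℕ) (hm : m ≤ n) :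
    (foldProg q).RunsWithin
      (.pair (ofList ((List.ofFn x).drop (n - m))) (.pair e (st (n - m))))
      (.pair .nil (.pair e (st n))) (m * (K + 22) + 2) := by
  induction m with
  | zero =>
    have h : (List.ofFn x).drop (n - 0) = [] := by simp
    rw [h, Nat.sub_zero]
    exact (Prog.RunsWithin.loop_stop (Prog.runsWithin_fst _ _)).mono (by omega)
  | succ m ih =>
    have hlt : n - (m + 1) < n := by omega
    have h : (List.ofFn x).drop (n - (m + 1)) = x ⟨n - (m + 1), hlt⟩ :: (List.ofFn x).drop (n - m) := by
      rw [List.drop_eq_getElem_cons (by simpa using hlt)]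
      congr 1
      · simp
      · congr 1; omega
    rw [h]
    have hst := hq ⟨n - (m + 1), hlt⟩
    have he : n - (m + 1) + 1 = n - m := by omega
    simp only [he] at hst
    have key := Prog.RunsWithin.loop_step (Prog.runsWithin_fst _ _)
      (((Prog.runsWithin_fst (Val.pair (x ⟨n - (m + 1), hlt⟩) (ofList ((List.ofFn x).drop (n - m))))
        (Val.pair e (st (n - (m + 1))))).seq (Prog.runsWithin_snd _ _)).pair
      (((Prog.runsWithin_snd _ _).seq (Prog.runsWithin_fst _ _)).pair
      (((((Prog.runsWithin_snd _ _).seq (Prog.runsWithin_fst _ _)).pair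
        (((Prog.runsWithin_fst _ _).seq (Prog.runsWithin_fst _ _)).pair
        ((Prog.runsWithin_snd _ _).seq (Prog.runsWithin_snd _ _))))).seq hst)))
      (ih (by omega))
    exact key.mono (by ring_nf; omega)

/-- The premise `hs` charges every pass at the scale `B` with one exponent, whatever the current
state is. The cost can therefore not compound along the loop, and a polynomial number of passes only
raises the exponent. -/
theorem fold {n : ι → ℕ} {x : ∀ i, Fin (n i) → Val} {st : ι → ℕ → Val} (hn : PolyBdd B n)
    (hx : Comp B e fun i => ofList (List.ofFn (x i))) (h0 : Comp B e fun i => st i 0)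
    (hs : Comp (fun p : Σ i, Fin (n i) => B p.1)
      (fun p => .pair (e p.1) (.pair (x p.1 p.2) (st p.1 p.2))) fun p => st p.1 (p.2 + 1)) :
    Comp B e fun i => st i (n i) := by
  obtain ⟨q, c, hq⟩ := hs
  obtain ⟨d, hd⟩ := hn
  have hloop : Comp B (fun i => .pair (ofList (List.ofFn (x i))) (.pair (e i) (st i 0)))
      fun i => .pair .nil (.pair (e i) (st i (n i))) := by
    refine ⟨foldProg q, d + (c + 5) + 2, fun i => ?_⟩
    have := loop_aux (q := q) (K := cost (B i) c) (e := e i) (x := x i) (st := st i) (fun j => hq ⟨i, j⟩) (n i) le_rfl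
    simp only [Nat.sub_self, List.drop_zero] at this
    refine Prog.RunsWithin.mono this ?_
    have h1 : cost (B i) c + 22 ≤ cost (B i) (c + 5) := by
      have := two_pow_mul_cost (B i) c 5
      have := one_le_cost (B i) c
      omega
    have h2 := (Nat.mul_le_mul_left (n i) h1).trans (mul_cost_le (hd i) (c + 5))
    have h3 := two_pow_mul_cost (B i) (d + (c + 5)) 2
    have h4 := one_le_cost (B i) (d + (c + 5))
    omega
  exact ((hx.pair (refl.pair h0)).trans hloop).snd.snd

theorem fold_of_eq {n : ι → ℕ} {x : ∀ i, Fin (n i) → Val} (st : ι → ℕ → Val) (hn : PolyBdd B n)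
    (hx : Comp B e fun i => ofList (List.ofFn (x i))) (h0 : Comp B e fun i => st i 0)
    (hs : Comp (fun p : Σ i, Fin (n i) => B p.1)
      (fun p => .pair (e p.1) (.pair (x p.1 p.2) (st p.1 p.2))) fun p => st p.1 (p.2 + 1))
    (ha : ∀ i, st i (n i) = a i) : Comp B e a :=
  (fold hn hx h0 hs).congr ha

/-- Iteration; the body may use neither the number of the pass nor a list element. -/
theorem iterate {n : ι → ℕ} {st : ι → ℕ → Val} (hn : PolyBdd B n)
    (hx : Comp B e fun i => ofNat (n i)) (h0 : Comp B e fun i => st i 0)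
    (hs : Comp (fun p : Σ i, Fin (n i) => B p.1)
      (fun p => .pair (e p.1) (st p.1 p.2)) fun p => st p.1 (p.2 + 1)) :
    Comp B e fun i => st i (n i) := by
  refine fold (x := fun _ _ => .nil) hn (hx.congr fun i => Val.ofNat_eq _) h0 ?_
  exact Comp.trans (refl.fst.pair refl.snd.snd) hs

end Comp

/-! ### Lists and numbers -/

namespace Val

theorem ofNat_eq_replicate (n : ℕ) : ofNat n = ofList (List.replicate n nil) := by
  rw [ofNat_eq, List.ofFn_const]

theorem ofList_eq_nil {l : List Val} : ofList l = nil ↔ l = [] := by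
  cases l <;> simp [ofList]

end Val

/-- The number `n i` is computable from `e i` and polynomially bounded. -/
structure CompNum {ι : Type} (B : ι → ℕ × ℕ) (e : ι → Val) (n : ι → ℕ) : Prop where
  comp : Comp B e fun i => Val.ofNat (n i)
  bdd : PolyBdd B n

namespace Comp

open Val (ofList ofBool ofNat)

variable {ι κ : Type} {B : ι → ℕ × ℕ} {e a b d : ι → Val} {P Q : ι → Prop}
  {α β : ι → Type} {L : ∀ i, List (α i)} {enc : ∀ i, α i → Val} {enc' : ∀ i, β i → Val}

theorem cons {l : ι → List Val} (ha : Comp B e a) (hl : Comp B e fun i => ofList (l i)) :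
    Comp B e fun i => ofList (a i :: l i) := ha.pair hl

theorem fold_list {l : ι → List Val} (st : ι → ℕ → Val) (hn : PolyBdd B fun i => (l i).length)
    (hl : Comp B e fun i => ofList (l i)) (h0 : Comp B e fun i => st i 0)
    (hs : Comp (fun p : Σ i, Fin (l i).length => B p.1)
      (fun p => .pair (e p.1) (.pair ((l p.1).get p.2) (st p.1 p.2))) fun p => st p.1 (p.2 + 1))
    (ha : ∀ i, st i (l i).length = a i) : Comp B e a :=
  fold_of_eq (x := fun i => (l i).get) st hn (hl.congr fun i => by rw [List.ofFn_get]) h0 hs ha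

theorem reverse {l : ι → List Val} (hn : PolyBdd B fun i => (l i).length)
    (hl : Comp B e fun i => ofList (l i)) : Comp B e fun i => ofList (l i).reverse := by
  refine fold_list (fun i j => ofList ((l i).take j).reverse) hn hl (nil.congr fun _ => rfl) ?_
    fun i => by rw [List.take_length]
  refine (snd refl).congr fun p => ?_
  rw [List.take_succ_eq_append_getElem p.2.2, List.reverse_append]
  rfl

theorem append {l l' : ι → List Val} (hn : PolyBdd B fun i => (l i).length)
    (hl : Comp B e fun i => ofList (l i)) (hl' : Comp B e fun i => ofList (l' i)) :
    Comp B e fun i => ofList (l i ++ l' i) := by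
  refine fold_list (fun i j => ofList (((l i).reverse.take j).reverse ++ l' i))
    (hn.mono fun i => by simp) (hl.reverse hn) (hl'.congr fun _ => rfl) ?_
    fun i => by rw [List.take_length, List.reverse_reverse]
  refine (snd refl).congr fun p => ?_
  rw [List.take_succ_eq_append_getElem p.2.2, List.reverse_append]
  rfl

theorem flatten {l : ι → List (List Val)} {m : ι → ℕ} (hn : PolyBdd B fun i => (l i).length)
    (hm : PolyBdd B m) (hlm : ∀ i, ∀ x ∈ l i, x.length ≤ m i)
    (hl : Comp B e fun i => ofList ((l i).map ofList)) :
    Comp B e fun i => ofList (l i).flatten := by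
  refine fold_list (l := fun i => ((l i).map ofList).reverse)
    (fun i j => ofList (((l i).reverse.take j).reverse.flatten))
    (hn.mono fun i => by simp) (hl.reverse (hn.mono fun i => by simp)) (nil.congr fun _ => rfl) ?_
    fun i => by simp [List.take_of_length_le]
  have hlt : ∀ p : Σ i, Fin ((l i).map ofList).reverse.length, p.2.1 < (l p.1).reverse.length :=
    fun p => by simpa using p.2.2
  have key := append (B := fun p : Σ i, Fin ((l i).map ofList).reverse.length => B p.1)
    (e := fun p => .pair (e p.1) (.pair (((l p.1).map ofList).reverse.get p.2)
      (ofList (((l p.1).reverse.take p.2).reverse.flatten))))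
    (l := fun p => (l p.1).reverse[p.2.1]'(hlt p))
    (l' := fun p => ((l p.1).reverse.take p.2).reverse.flatten)
    (hm.up.mono fun p => hlm p.1 _ (List.mem_reverse.1 (List.getElem_mem _)))
    ((snd refl).fst.congr fun p => by simp) (snd refl).snd
  refine key.congr fun p => ?_
  rw [List.take_succ_eq_append_getElem (hlt p), List.reverse_append, List.flatten_append]
  simp

/-- `map`, with a body that may depend on the position. -/
theorem ofFn {n : ι → ℕ} {x g : ∀ i, Fin (n i) → Val} (hn : PolyBdd B n)
    (hx : Comp B e fun i => ofList (List.ofFn (x i)))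
    (hg : Comp (fun p : Σ i, Fin (n i) => B p.1) (fun p => .pair (e p.1) (x p.1 p.2))
      fun p => g p.1 p.2) :
    Comp B e fun i => ofList (List.ofFn (g i)) := by
  have h : Comp B e fun i => ofList (List.ofFn (g i)).reverse := by
    refine fold_of_eq (fun i j => ofList ((List.ofFn (g i)).take j).reverse) hn hx
      (nil.congr fun _ => rfl) ?_ fun i => by rw [List.take_of_length_le (by simp)]
    refine (((refl.fst.pair refl.snd.fst).trans hg).pair refl.snd.snd).congr fun p => ?_
    rw [List.take_succ_eq_append_getElem (by simp), List.reverse_append]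
    simp [ofList]
  exact (h.reverse (hn.mono fun i => by simp)).congr fun i => by simp

theorem ofFn_get_map {α β : Type} (l : List α) (f : α → β) :
    List.ofFn (fun j : Fin l.length => f (l.get j)) = l.map f := by
  conv_rhs => rw [← List.ofFn_get l, List.map_ofFn]
  rfl

theorem map {g : ∀ i, α i → Val} (hn : PolyBdd B fun i => (L i).length)
    (hL : Comp B e fun i => ofList ((L i).map (enc i)))
    (hg : Comp (fun p : Σ i, {x : α i // x ∈ L i} => B p.1)
      (fun p => .pair (e p.1) (enc p.1 p.2.1)) fun p => g p.1 p.2.1) :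
    Comp B e fun i => ofList ((L i).map (g i)) := by
  have h := ofFn (B := B) (e := e) (n := fun i => (L i).length)
    (x := fun i j => enc i ((L i).get j)) (g := fun i j => g i ((L i).get j)) hn
    (hL.congr fun i => by rw [ofFn_get_map])
    (hg.comap fun p : Σ i, Fin (L i).length => ⟨p.1, (L p.1).get p.2, List.get_mem _ _⟩)
  exact h.congr fun i => by rw [ofFn_get_map]

theorem flatMap {F : ∀ i, α i → List (β i)} {m : ι → ℕ} (hn : PolyBdd B fun i => (L i).length)
    (hm : PolyBdd B m) (hF : ∀ i, ∀ x ∈ L i, (F i x).length ≤ m i)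
    (hL : Comp B e fun i => ofList ((L i).map (enc i)))
    (hg : Comp (fun p : Σ i, {x : α i // x ∈ L i} => B p.1)
      (fun p => .pair (e p.1) (enc p.1 p.2.1)) fun p => ofList ((F p.1 p.2.1).map (enc' p.1))) :
    Comp B e fun i => ofList (((L i).flatMap (F i)).map (enc' i)) := by
  have h := map (g := fun i x => ofList ((F i x).map (enc' i))) hn hL hg
  have h2 := flatten (l := fun i => (L i).map fun x => (F i x).map (enc' i)) (m := m)
    (hn.mono fun i => by simp) hm ?_ (h.congr fun i => by simp [Function.comp_def])
  · exact h2.congr fun i => by rw [List.map_flatMap, List.flatMap_def]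
  · intro i x hx
    obtain ⟨y, hy, rfl⟩ := List.mem_map.1 hx
    simpa using hF i y hy

theorem filter {P : ∀ i, α i → Prop} (hn : PolyBdd B fun i => (L i).length)
    (hL : Comp B e fun i => ofList ((L i).map (enc i)))
    (hP : CompProp (fun p : Σ i, {x : α i // x ∈ L i} => B p.1)
      (fun p => .pair (e p.1) (enc p.1 p.2.1)) fun p => P p.1 p.2.1) :
    Comp B e fun i => ofList (((L i).filter fun x => propBit (P i x)).map (enc i)) := by
  have key := flatMap (enc' := enc) (F := fun i x => [x].filter fun x => propBit (P i x))
    (m := fun _ => 1) hn (.const 1) (fun i x _ => List.length_filter_le _ _) hL ?_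
  · refine key.congr fun i => ?_
    congr 2
    induction L i with
    | nil => rfl
    | cons x l ih => rw [List.flatMap_cons, ih]; cases h : propBit (P i x) <;> simp [h]
  · refine ite hP (((snd refl).pair nil).congr fun p => ?_) (nil.congr fun p => ?_)
    · have := propBit_pos p.2
      simp only [List.filter_singleton, this]
      rfl
    · have := propBit_neg p.2
      simp only [List.filter_singleton, this]
      rfl

theorem exists_mem {P : ∀ i, α i → Prop} (hn : PolyBdd B fun i => (L i).length)
    (hL : Comp B e fun i => ofList ((L i).map (enc i)))
    (hP : CompProp (fun p : Σ i, {x : α i // x ∈ L i} => B p.1)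
      (fun p => .pair (e p.1) (enc p.1 p.2.1)) fun p => P p.1 p.2.1) :
    CompProp B e fun i => ∃ x ∈ L i, P i x := by
  refine (filter hn hL hP).ne_nil.prop_congr fun i => ?_
  rw [Ne, Val.ofList_eq_nil, List.map_eq_nil_iff, List.filter_eq_nil_iff]
  simp [propBit_eq_true]

theorem forall_mem {P : ∀ i, α i → Prop} (hn : PolyBdd B fun i => (L i).length)
    (hL : Comp B e fun i => ofList ((L i).map (enc i)))
    (hP : CompProp (fun p : Σ i, {x : α i // x ∈ L i} => B p.1)
      (fun p => .pair (e p.1) (enc p.1 p.2.1)) fun p => P p.1 p.2.1) :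
    CompProp B e fun i => ∀ x ∈ L i, P i x :=
  (exists_mem (P := fun i x => ¬P i x) hn hL hP.not).not.prop_congr fun i => by simp

theorem list_head (hL : Comp B e fun i => ofList ((L i).map (enc i))) {d : ∀ i, α i}
    (hd : Comp B e fun i => enc i (d i)) : Comp B e fun i => enc i ((L i).headD (d i)) := by
  refine ite hL.ne_nil ((hL.sub _).congr fun i => ?_ : Comp _ _ fun i => .pair
    (enc i.1 ((L i.1).headD (d i.1))) (ofList ((L i.1).tail.map (enc i.1)))).fst
    ((hd.sub _).congr fun i => ?_)
  · have := i.2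
    cases h : L i.1 with
    | nil => rw [h] at this; exact absurd rfl this
    | cons x l => rfl
  · have := i.2
    rw [not_not, Val.ofList_eq_nil, List.map_eq_nil_iff] at this
    rw [this]
    rfl

theorem take_one (hL : Comp B e fun i => ofList ((L i).map (enc i))) :
    Comp B e fun i => ofList (((L i).take 1).map (enc i)) := by
  refine ite hL.ne_nil (((hL.sub _).congr fun i => ?_ : Comp _ _ fun i => .pair
    (((L i.1).map (enc i.1)).headD .nil) (ofList ((L i.1).tail.map (enc i.1)))).fst.pair nil |>.congr
      fun i => ?_) (nil.congr fun i => ?_)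
  · have := i.2
    cases h : L i.1 with
    | nil => rw [h] at this; exact absurd rfl this
    | cons x l => rfl
  · have := i.2
    cases h : L i.1 with
    | nil => rw [h] at this; exact absurd rfl this
    | cons x l => rfl
  · have := i.2
    rw [not_not, Val.ofList_eq_nil, List.map_eq_nil_iff] at this
    rw [this]
    rfl

theorem drop {l : ι → List Val} {n : ι → ℕ} (hl : Comp B e fun i => ofList (l i))
    (hn : CompNum B e n) : Comp B e fun i => ofList ((l i).drop (n i)) := by
  refine iterate (st := fun i j => ofList ((l i).drop j)) hn.bdd hn.comp (hl.congr fun _ => rfl) ?_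
  refine (refl.snd.trans (?_ : Comp _ _ fun p => ofList (((l p.1).drop p.2).tail))).congr
    fun p => by rw [List.tail_drop]
  -- `snd` computes the tail of the empty list as well, because it sends `nil` to `nil`.
  obtain ⟨q, hq⟩ : ∃ q : Prog, ∀ l : List Val, q.RunsWithin (ofList l) (ofList l.tail) 1 :=
    ⟨.snd, fun l => match l with
      | [] => ⟨1, le_rfl, .snd_nil⟩
      | _ :: _ => ⟨1, le_rfl, .snd_pair _ _⟩⟩
  exact of_runs fun p => hq _

theorem lookup {n : ι → ℕ} {g : ∀ i, Fin (n i) → Val} {j : ∀ i, Fin (n i)}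
    (hg : Comp B e fun i => ofList (List.ofFn (g i))) (hj : CompNum B e fun i => (j i : ℕ)) :
    Comp B e fun i => g i (j i) := by
  refine fst (b := fun i => ofList ((List.ofFn (g i)).drop (j i + 1))) ((hg.drop hj).congr fun i => ?_)
  rw [List.drop_eq_getElem_cons (by simp)]
  simp [ofList]

end Comp

namespace Comp

open Val (ofList ofBool ofNat)

variable {ι : Type} {B : ι → ℕ × ℕ} {e a : ι → Val}

/-- Weakening by a bounded variable. -/
theorem upF {n : ι → ℕ} (h : Comp B e a) : Comp (fun p : Σ i, Fin (n i) => B p.1)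
    (fun p => .pair (e p.1) (ofNat p.2)) fun p => a p.1 := h.up

/-- Weakening by an element of a list. -/
theorem upL {α : ι → Type} {L : ∀ i, List (α i)} (enc : ∀ i, α i → Val) (h : Comp B e a) :
    Comp (fun p : Σ i, {x : α i // x ∈ L i} => B p.1)
    (fun p => .pair (e p.1) (enc p.1 p.2.1)) fun p => a p.1 := h.up

end Comp

namespace CompNum

open Val (ofList ofBool ofNat)

variable {ι κ : Type} {B : ι → ℕ × ℕ} {e a b d : ι → Val} {m n : ι → ℕ}
  {α β : ι → Type} {L : ∀ i, List (α i)} {enc : ∀ i, α i → Val}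

theorem congr (h : CompNum B e m) (hmn : ∀ i, m i = n i) : CompNum B e n := by
  rwa [← funext hmn]

theorem comap (h : CompNum B e m) (g : κ → ι) :
    CompNum (fun k => B (g k)) (fun k => e (g k)) fun k => m (g k) :=
  ⟨h.comp.comap g, h.bdd.comap g⟩

theorem up {x : (Σ i, α i) → Val} (h : CompNum B e m) :
    CompNum (fun p : Σ i, α i => B p.1) (fun p => .pair (e p.1) (x p)) fun p => m p.1 :=
  ⟨h.comp.up, h.bdd.up⟩

/-- Weakening by a bounded variable. -/
theorem upF (h : CompNum B e m) : CompNum (fun p : Σ i, Fin (n i) => B p.1)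
    (fun p => .pair (e p.1) (ofNat p.2)) fun p => m p.1 := h.up

/-- Weakening by an element of a list. -/
theorem upL (enc : ∀ i, α i → Val) (h : CompNum B e m) :
    CompNum (fun p : Σ i, {x : α i // x ∈ L i} => B p.1)
    (fun p => .pair (e p.1) (enc p.1 p.2.1)) fun p => m p.1 := h.up

theorem sub (h : CompNum B e m) (P : ι → Prop) :
    CompNum (fun i : {i // P i} => B i.1) (fun i => e i.1) fun i => m i.1 :=
  h.comap Subtype.val

theorem trans (ha : Comp B e a) (h : CompNum B a n) : CompNum B e n :=
  ⟨ha.trans h.comp, h.bdd⟩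

theorem var (hn : CompNum B e n) :
    CompNum (fun p : Σ i, Fin (n i) => B p.1) (fun p => .pair (e p.1) (ofNat p.2)) fun p => p.2 :=
  ⟨.var, hn.bdd.fin⟩

theorem const (k : ℕ) : CompNum B e fun _ => k := by
  refine ⟨?_, .const k⟩
  induction k with
  | zero => exact Comp.nil
  | succ k ih => exact Comp.nil.pair ih

theorem length (hL : Comp B e fun i => ofList ((L i).map (enc i)))
    (hn : PolyBdd B fun i => (L i).length) : CompNum B e fun i => (L i).length := by
  refine ⟨(Comp.map (g := fun _ _ => .nil) hn hL Comp.nil).congr fun i => ?_, hn⟩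
  rw [Val.ofNat_eq_replicate, List.map_const']

theorem tsub (hm : CompNum B e m) (hn : CompNum B e n) : CompNum B e fun i => m i - n i := by
  refine ⟨?_, hm.bdd.mono fun i => Nat.sub_le _ _⟩
  have := Comp.drop (l := fun i => List.replicate (m i) .nil)
    (hm.comp.congr fun i => Val.ofNat_eq_replicate _) hn
  exact this.congr fun i => by rw [Val.ofNat_eq_replicate, List.drop_replicate]

theorem add (hm : CompNum B e m) (hn : CompNum B e n) : CompNum B e fun i => m i + n i := by
  refine ⟨?_, hm.bdd.add hn.bdd⟩
  have := Comp.append (l := fun i => List.replicate (m i) .nil) (l' := fun i => List.replicate (n i) .nil)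
    (hm.bdd.mono fun i => by simp)
    (hm.comp.congr fun i => Val.ofNat_eq_replicate _) (hn.comp.congr fun i => Val.ofNat_eq_replicate _)
  exact this.congr fun i => by rw [Val.ofNat_eq_replicate, List.replicate_append_replicate]

theorem ne_zero (hm : CompNum B e m) : CompProp B e fun i => m i ≠ 0 :=
  hm.comp.ne_nil.prop_congr fun i => by
    rw [Ne, Val.ofNat_eq_replicate, Val.ofList_eq_nil, List.replicate_eq_nil_iff]

/-- Unary numbers are compared through truncated subtraction, that is, by dropping an initial
segment of a list. -/
theorem lt (hm : CompNum B e m) (hn : CompNum B e n) : CompProp B e fun i => m i < n i :=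
  (hn.tsub hm).ne_zero.prop_congr fun i => by omega

theorem le (hm : CompNum B e m) (hn : CompNum B e n) : CompProp B e fun i => m i ≤ n i :=
  (hn.lt hm).not.prop_congr fun i => by omega

theorem eq (hm : CompNum B e m) (hn : CompNum B e n) : CompProp B e fun i => m i = n i :=
  ((hm.le hn).and (hn.le hm)).prop_congr fun i => by omega

theorem fin_eq {N : ι → ℕ} {u v : ∀ i, Fin (N i)} (hu : CompNum B e fun i => (u i : ℕ))
    (hv : CompNum B e fun i => (v i : ℕ)) : CompProp B e fun i => u i = v i :=
  (hu.eq hv).prop_congr fun _ => Fin.ext_iff.symm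

theorem finRange (hn : CompNum B e n) :
    Comp B e fun i => ofList ((List.finRange (n i)).map fun j : Fin (n i) => ofNat (j : ℕ)) := by
  have h : Comp B e fun i => .pair (ofNat (n i)) (ofList ((List.range (n i)).map ofNat).reverse) := by
    refine Comp.iterate (st := fun _ j => .pair (ofNat j) (ofList ((List.range j).map ofNat).reverse))
      hn.bdd hn.comp (Comp.nil.pair Comp.nil) ?_
    refine ((Comp.nil.pair Comp.refl.snd.fst).pair (Comp.refl.snd.fst.pair Comp.refl.snd.snd)).congr
      fun p => ?_
    rw [List.range_succ, List.map_append, List.reverse_append]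
    rfl
  refine (h.snd.reverse (hn.bdd.mono fun i => by simp)).congr fun i => ?_
  rw [List.reverse_reverse, ← List.map_coe_finRange_eq_range, List.map_map]
  rfl

theorem tabulate {g : ∀ i, Fin (n i) → Val} (hn : CompNum B e n)
    (hg : Comp (fun p : Σ i, Fin (n i) => B p.1) (fun p => .pair (e p.1) (ofNat p.2))
      fun p => g p.1 p.2) :
    Comp B e fun i => ofList (List.ofFn (g i)) :=
  Comp.ofFn (x := fun i j => ofNat j) hn.bdd (hn.finRange.congr fun i => by rw [List.ofFn_eq_map]) hg

theorem exists_fin {P : ∀ i, Fin (n i) → Prop} (hn : CompNum B e n)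
    (hP : CompProp (fun p : Σ i, Fin (n i) => B p.1) (fun p => .pair (e p.1) (ofNat p.2))
      fun p => P p.1 p.2) : CompProp B e fun i => ∃ j, P i j :=
  (Comp.exists_mem (P := P) (hn.bdd.mono fun i => by simp) hn.finRange
    (hP.comap fun p : Σ i, {x : Fin (n i) // x ∈ List.finRange (n i)} => ⟨p.1, p.2.1⟩)).prop_congr
    fun i => by simp

theorem forall_fin {P : ∀ i, Fin (n i) → Prop} (hn : CompNum B e n)
    (hP : CompProp (fun p : Σ i, Fin (n i) => B p.1) (fun p => .pair (e p.1) (ofNat p.2))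
      fun p => P p.1 p.2) : CompProp B e fun i => ∀ j, P i j :=
  (exists_fin (P := fun i j => ¬P i j) hn hP.not).not.prop_congr fun i => by simp

end CompNum

/-! ### Membership in hereditary union-closed classes -/

namespace GraphClass

variable {H : GraphClass} {V W : Type} [Finite V] [Finite W]

theorem Hereditary.of_embedding (hered : H.Hereditary) {G : SimpleGraph V} {G' : SimpleGraph W}
    (f : G ↪g G') (h : H.Mem G') : H.Mem G := by
  refine H.mem_of_iso (?_ : G'.induce (Set.range f) ≃g G) (hered W G' (Set.range f) h)
  exact (RelIso.mk (Equiv.ofInjective f f.injective) (by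
    intro a b
    exact f.map_adj_iff)).symm

theorem UnionClosed.of_split (union : H.UnionClosed) {G : SimpleGraph V} (s : Set V)
    (hs : H.Mem (G.induce s)) (hsc : H.Mem (G.induce sᶜ))
    (h : ∀ u ∈ s, ∀ v ∉ s, ¬G.Adj u v) : H.Mem G := by
  classical
  refine H.mem_of_iso (RelIso.mk (Equiv.Set.sumCompl s) ?_) (union _ _ _ _ hs hsc)
  rintro (⟨a, ha⟩ | ⟨a, ha⟩) (⟨b, hb⟩ | ⟨b, hb⟩)
  · simp
  · simpa using h a ha b hb
  · simpa using fun hab => h b hb a ha hab.symm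
  · simp

theorem mem_bot (hered : H.Hereditary) (union : H.UnionClosed)
    (one : H.Mem (⊥ : SimpleGraph Unit)) (V : Type) [Finite V] :
    H.Mem (⊥ : SimpleGraph V) := by
  induction h : Nat.card V using Nat.strong_induction_on generalizing V with
  | _ n ih =>
    rcases isEmpty_or_nonempty V with hV | ⟨⟨v⟩⟩
    · exact hered.of_embedding (G' := (⊥ : SimpleGraph Unit))
        ⟨⟨isEmptyElim, fun a => isEmptyElim a⟩, fun {a} => isEmptyElim a⟩ one
    · refine union.of_split {v} ?_ ?_ (by simp)
      · exact hered.of_embedding (G' := (⊥ : SimpleGraph Unit))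
          ⟨⟨fun _ => (), fun a b _ => Subtype.ext (a.2.trans b.2.symm)⟩, by simp⟩ one
      · have hlt : Nat.card ({v}ᶜ : Set V) < n := by
          have h1 := Set.ncard_add_ncard_compl ({v} : Set V)
          rw [Set.ncard_singleton] at h1
          rw [Nat.card_coe_set_eq]
          omega
        have := ih _ hlt ({v}ᶜ : Set V) rfl
        have he : (⊥ : SimpleGraph V).induce ({v}ᶜ : Set V) = ⊥ := by ext; simp
        rw [he]
        exact this

/-- Isolated vertices do not matter. -/
theorem mem_iff_of_isolated (hered : H.Hereditary) (union : H.UnionClosed)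
    (one : H.Mem (⊥ : SimpleGraph Unit)) {G : SimpleGraph V} {G' : SimpleGraph W} (f : G ↪g G')
    (hf : ∀ u v, G'.Adj u v → u ∈ Set.range f) : H.Mem G ↔ H.Mem G' := by
  refine ⟨fun h => union.of_split (Set.range f) ?_ ?_ ?_, hered.of_embedding f⟩
  · exact H.mem_of_iso (RelIso.mk (Equiv.ofInjective f f.injective) f.map_adj_iff) h
  · have he : G'.induce (Set.range f)ᶜ = ⊥ := by
      ext a b
      simpa using fun h => a.2 (hf _ _ h)
    rw [he]
    exact mem_bot hered union one _
  · exact fun u _ v hv h => hv (hf _ _ h.symm)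

end GraphClass

/-! ### Deleting vertices by isolating them -/

namespace SimpleGraph

/-- The graph without the edges that leave `s`: vertices outside `s` become isolated. -/
def mask {V : Type} (G : SimpleGraph V) (s : Set V) : SimpleGraph V where
  Adj u v := G.Adj u v ∧ u ∈ s ∧ v ∈ s
  symm := ⟨fun _ _ h => ⟨h.1.symm, h.2.2, h.2.1⟩⟩
  loopless := ⟨fun _ h => h.1.ne rfl⟩

theorem mask_adj {V : Type} {G : SimpleGraph V} {s : Set V} {u v : V} :
    (G.mask s).Adj u v ↔ G.Adj u v ∧ u ∈ s ∧ v ∈ s := Iff.rfl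

end SimpleGraph

/-- Deleted vertices may stay as isolated ones, so the programs can keep the vertex set `Fin n` and
never have to renumber. -/
theorem GraphClass.mem_mask_iff {H : GraphClass} (hered : H.Hereditary) (union : H.UnionClosed)
    (one : H.Mem (⊥ : SimpleGraph Unit)) {V : Type} [Finite V] (G : SimpleGraph V) (s : Set V) :
    H.Mem (G.mask s) ↔ H.Mem (G.induce s) :=
  (mem_iff_of_isolated hered union one (G := G.induce s) (G' := G.mask s)
    ⟨Function.Embedding.subtype (· ∈ s), fun {a b} =>
      ⟨fun h => h.1, fun h => ⟨h, a.2, b.2⟩⟩⟩ fun u _ h => ⟨⟨u, h.2.1⟩, rfl⟩).symm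

theorem GraphClass.mem_mask_anti {H : GraphClass} (hered : H.Hereditary) (union : H.UnionClosed)
    (one : H.Mem (⊥ : SimpleGraph Unit)) {V : Type} [Finite V] (G : SimpleGraph V) {s t : Set V}
    (hst : s ⊆ t) (h : H.Mem (G.mask t)) : H.Mem (G.mask s) := by
  rw [mem_mask_iff hered union one] at h ⊢
  exact hered.of_embedding (G.induceHomOfLE hst) h

/-! ### Computing with sets and graphs -/

namespace Comp

open Val (ofList ofBool ofNat ofSet ofGraph)

variable {ι κ : Type} {B : ι → ℕ × ℕ} {e a b d : ι → Val} {P Q : ι → Prop} {n : ι → ℕ}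

theorem mem_set {S : ∀ i, Finset (Fin (n i))} {v : ∀ i, Fin (n i)}
    (hS : Comp B e fun i => ofSet (S i)) (hv : CompNum B e fun i => (v i : ℕ)) :
    CompProp B e fun i => v i ∈ S i :=
  lookup (g := fun i j => ofBool (propBit (j ∈ S i))) hS hv

theorem set_of {S : ∀ i, Finset (Fin (n i))} (P : ∀ i, Fin (n i) → Prop) (hn : CompNum B e n)
    (hP : CompProp (fun p : Σ i, Fin (n i) => B p.1) (fun p => .pair (e p.1) (ofNat p.2))
      fun p => P p.1 p.2) (hS : ∀ i v, v ∈ S i ↔ P i v) : Comp B e fun i => ofSet (S i) :=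
  (CompNum.tabulate (g := fun i j => ofBool (propBit (P i j))) hn hP).congr fun i => by
    unfold Val.ofSet
    simp only [hS]

theorem card_set {S : ∀ i, Finset (Fin (n i))} (hn : CompNum B e n)
    (hS : Comp B e fun i => ofSet (S i)) : CompNum B e fun i => (S i).card := by
  have h := filter (P := fun i v => v ∈ S i) (hn.bdd.mono fun i => by simp) hn.finRange
    (mem_set (v := fun p : Σ i, {x : Fin (n i) // x ∈ List.finRange (n i)} => p.2.1) hS.up
      ⟨.var, hn.bdd.up.mono fun p => p.2.1.2.le⟩)
  refine (CompNum.length h (hn.bdd.mono fun i => ?_)).congr fun i => ?_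
  · exact (List.length_filter_le _ _).trans (by simp)
  · rw [← List.toFinset_card_of_nodup ((List.nodup_finRange _).filter _)]
    congr 1
    ext v
    simp [propBit_eq_true]

theorem graph_of {G : ∀ i, SimpleGraph (Fin (n i))} (P : ∀ i, Fin (n i) → Fin (n i) → Prop)
    (hn : CompNum B e n)
    (hP : CompProp (fun p : Σ p : (Σ i, Fin (n i)), Fin (n p.1) => B p.1.1)
      (fun p => .pair (.pair (e p.1.1) (ofNat p.1.2)) (ofNat p.2)) fun p => P p.1.1 p.1.2 p.2)
    (hG : ∀ i u v, (G i).Adj u v ↔ P i u v) : Comp B e fun i => ofGraph (G i) := by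
  refine (CompNum.tabulate (g := fun i u => ofList (List.ofFn fun v => ofBool (propBit (P i u v)))) hn
    (CompNum.tabulate (n := fun p : Σ i, Fin (n i) => n p.1)
      (g := fun p v => ofBool (propBit (P p.1 p.2 v))) hn.up hP)).congr fun i => ?_
  unfold Val.ofGraph
  simp only [hG]

theorem adj {G : ∀ i, SimpleGraph (Fin (n i))} {u v : ∀ i, Fin (n i)}
    (hG : Comp B e fun i => ofGraph (G i)) (hu : CompNum B e fun i => (u i : ℕ))
    (hv : CompNum B e fun i => (v i : ℕ)) : CompProp B e fun i => (G i).Adj (u i) (v i) :=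
  lookup (g := fun i v => ofBool (propBit ((G i).Adj (u i) v)))
    (lookup (g := fun i u => ofList (List.ofFn fun v => ofBool (propBit ((G i).Adj u v)))) hG hu) hv

theorem order {G : ∀ i, SimpleGraph (Fin (n i))} (hG : Comp B e fun i => ofGraph (G i))
    (hn : PolyBdd B n) : CompNum B e n :=
  (CompNum.length (L := fun i => List.ofFn fun u =>
    ofList (List.ofFn fun v => ofBool (propBit ((G i).Adj u v)))) (enc := fun _ x => x)
    (hG.congr fun i => by rw [List.map_id']; rfl) (hn.mono fun i => by simp)).congr fun i => by simp

end Comp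

/-! ### Using an algorithm for disjoint deletion -/

/-- An algorithm for Disjoint `H`-deletion, with the answers that it gives. -/
structure GraphClass.DisjointSolver (H : GraphClass) (f : ℕ → ℕ → ℕ) where
  prog : Prog
  exponent : ℕ
  ans : ∀ {n : ℕ}, SimpleGraph (Fin n) → ℕ → ℕ → Finset (Fin n) → Option (Finset (Fin n))
  correct : ∀ {n : ℕ} (G : SimpleGraph (Fin n)) (s l : ℕ) (U : Finset (Fin n)), U.card ≤ l →
    H.IsDeletionSet G U → H.IsDisjointAnswer G s U (ans G s l U)
  runs : ∀ {n : ℕ} (G : SimpleGraph (Fin n)) (s l : ℕ) (U : Finset (Fin n)), U.card ≤ l →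
    H.IsDeletionSet G U → prog.RunsWithin (Val.ofDisjointInput G s l U)
      (Val.ofOptionSet (ans G s l U)) (f s l * (n + 2) ^ exponent)

/-- Choosing the answers once turns them into a function of the instance, so that later definitions
can refer to them. The value `none` on invalid instances is a mere default. -/
theorem GraphClass.DisjointDeletionInTime.solver {H : GraphClass} {f : ℕ → ℕ → ℕ}
    (h : H.DisjointDeletionInTime f) : Nonempty (H.DisjointSolver f) := by
  classical
  obtain ⟨p, c, h⟩ := h
  choose ans h1 h2 using h
  exact ⟨⟨p, c, fun {n} G s l U => if hU : U.card ≤ l ∧ H.IsDeletionSet G U then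
    ans n G s l U hU.1 hU.2 else none,
    fun {n} G s l U hl hU => by rw [dif_pos ⟨hl, hU⟩]; exact h1 n G s l U hl hU,
    fun {n} G s l U hl hU => by rw [dif_pos ⟨hl, hU⟩]; exact h2 n G s l U hl hU⟩⟩

namespace GraphClass.DisjointSolver

open Val (ofList ofBool ofNat ofSet ofGraph ofOptionSet)

variable {H : GraphClass} {f : ℕ → ℕ → ℕ} {ι κ : Type} {B : ι → ℕ × ℕ} {e : ι → Val} {n : ι → ℕ}

/-- The bound `hf` is met in two ways: `f (s i) (l i)` is the first component of the scale, or the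
parameters are constants and `f` contributes a constant. -/
theorem comp_ans (A : H.DisjointSolver f) {G : ∀ i, SimpleGraph (Fin (n i))} {s l : ι → ℕ} {U : ∀ i, Finset (Fin (n i))}
    (hG : Comp B e fun i => ofGraph (G i)) (hn : PolyBdd B n) (hs : CompNum B e s)
    (hl : CompNum B e l) (hU : Comp B e fun i => ofSet (U i)) (hUl : ∀ i, (U i).card ≤ l i)
    (hdel : ∀ i, H.IsDeletionSet (G i) (U i))
    (hf : ∃ c : ℕ, ∀ i, f (s i) (l i) ≤ cost (B i) c) :
    Comp B e fun i => ofOptionSet (A.ans (G i) (s i) (l i) (U i)) := by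
  refine Comp.trans (a := fun i => Val.ofDisjointInput (G i) (s i) (l i) (U i))
    (hG.pair (hs.comp.pair (hl.comp.pair (hU.pair Comp.nil)))) ?_
  obtain ⟨c, hc⟩ := hf
  obtain ⟨d, hd⟩ := (hn.add (.const 2)).pow A.exponent
  refine ⟨A.prog, d + c, fun i => (A.runs _ _ _ _ (hUl i) (hdel i)).mono ?_⟩
  exact (Nat.mul_le_mul (hc i) (hd i)).trans (by rw [mul_comm]; exact mul_cost_le le_rfl c)

/-- The answer of the algorithm is the empty set. -/
theorem ans_eq_empty (A : H.DisjointSolver f) {m : ℕ} {G : SimpleGraph (Fin m)} {l : ℕ} {U : Finset (Fin m)}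
    (hl : U.card ≤ l) (hU : H.IsDeletionSet G U) :
    A.ans G 0 l U = some ∅ ↔ H.Mem G := by
  have hmem : H.IsDeletionSet G ∅ ↔ H.Mem G := by
    unfold IsDeletionSet
    have iso : G.induce (((∅ : Finset (Fin m)) : Set (Fin m))ᶜ) ≃g G :=
      ⟨⟨Subtype.val, fun x => ⟨x, by simp⟩, fun _ => rfl, fun _ => rfl⟩, Iff.rfl⟩
    exact ⟨H.mem_of_iso iso, H.mem_of_iso iso.symm⟩
  have h := A.correct G 0 l U hl hU
  constructor
  · intro he
    rw [he] at h
    exact hmem.1 h.1.2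
  · intro hG
    cases he : A.ans G 0 l U with
    | none =>
      rw [he] at h
      exact absurd (h ∅ (by simp) (hmem.2 hG)) (by simp)
    | some S =>
      rw [he] at h
      have := h.2 ∅ (by simp) (hmem.2 hG)
      rw [Finset.card_empty, Nat.le_zero, Finset.card_eq_zero] at this
      rw [this]

theorem comp_isSome {S : ∀ i, Option (Finset (Fin (n i)))}
    (hS : Comp B e fun i => ofOptionSet (S i)) : CompProp B e fun i => (S i).isSome = true :=
  hS.ne_nil.prop_congr fun i => by cases S i <;> simp [ofOptionSet]

theorem comp_getD {S : ∀ i, Option (Finset (Fin (n i)))} (hS : Comp B e fun i => ofOptionSet (S i))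
    (h : ∀ i, (S i).isSome = true) : Comp B e fun i => ofSet ((S i).getD ∅) :=
  Comp.fst (b := fun _ => .nil) (hS.congr fun i => by
    cases hi : S i with
    | none => have := h i; rw [hi] at this; simp at this
    | some x => rfl)

/-- Iterative compression. If the subgraph on the first `j` vertices is in `H`, then the next vertex
alone is a deletion set of the subgraph on the first `j + 1`, so the algorithm may be asked for a
deletion set of size `0`. If it is not in `H`, no larger subgraph is, by heredity. -/
theorem comp_mem (A : H.DisjointSolver f) (hered : H.Hereditary) (union : H.UnionClosed)
    (one : H.Mem (⊥ : SimpleGraph Unit)) {G : ∀ i, SimpleGraph (Fin (n i))}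
    (hG : Comp B e fun i => ofGraph (G i)) (hn : PolyBdd B n) :
    CompProp B e fun i => H.Mem (G i) := by
  have hord := hG.order hn
  -- The state of the loop consists of the number `j` of vertices admitted so far and the truth
  -- value of membership for the graph on them.
  have key : Comp B e fun i => (fun i j => Val.pair (ofNat j)
      (ofBool (propBit (H.Mem ((G i).mask {v | (v : ℕ) < j}))))) i (n i) := by
    refine Comp.iterate (st := fun i j => Val.pair (ofNat j)
      (ofBool (propBit (H.Mem ((G i).mask {v | (v : ℕ) < j}))))) hn hord.comp
      (Comp.nil.pair (Comp.of_forall fun i => ?_)) ?_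
    · have : (G i).mask {v | (v : ℕ) < 0} = ⊥ := by ext; simp [SimpleGraph.mask_adj]
      rw [this]
      exact mem_bot hered union one _
    have hj : CompNum (fun p : Σ i, Fin (n i) => B p.1) (fun p => .pair (e p.1) (.pair (ofNat p.2)
        (ofBool (propBit (H.Mem ((G p.1).mask {v | (v : ℕ) < p.2})))))) fun p => (p.2 : ℕ) :=
      ⟨Comp.refl.snd.fst, hn.fin⟩
    refine (hj.add (.const 1)).comp.pair (Comp.ite Comp.refl.snd.snd ?_ ?_)
    · set κ := {p : Σ i, Fin (n i) // H.Mem ((G p.1).mask {v | (v : ℕ) < p.2})}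
      have hj' := hj.sub fun p : Σ i, Fin (n i) => H.Mem ((G p.1).mask {v | (v : ℕ) < p.2})
      have hGκ : Comp (fun p : κ => B p.1.1) _ fun p => ofGraph (G p.1.1) :=
        (hG.up (x := fun p : Σ i, Fin (n i) => .pair (ofNat p.2)
          (ofBool (propBit (H.Mem ((G p.1).mask {v | (v : ℕ) < p.2})))))).sub _
      have hκ : CompNum (fun p : κ => B p.1.1) _ fun p => n p.1.1 :=
        (hord.up (x := fun p : Σ i, Fin (n i) => .pair (ofNat p.2)
          (ofBool (propBit (H.Mem ((G p.1).mask {v | (v : ℕ) < p.2})))))).sub _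
      have hmask : Comp (fun p : κ => B p.1.1) _
          fun p => ofGraph ((G p.1.1).mask {v | (v : ℕ) < p.1.2 + 1}) :=
        Comp.graph_of (n := fun p : κ => n p.1.1)
          (fun p u v => (G p.1.1).Adj u v ∧ (u : ℕ) < p.1.2 + 1 ∧ (v : ℕ) < p.1.2 + 1) hκ (by
            refine Comp.and ?_ (Comp.and ?_ ?_)
            · exact Comp.adj hGκ.upF.upF hκ.var.upF hκ.upF.var
            · exact hκ.var.upF.lt (hj'.upF.upF.add (.const 1))
            · exact hκ.upF.var.lt (hj'.upF.upF.add (.const 1)))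
          fun _ _ _ => Iff.rfl
      have hU : Comp (fun p : κ => B p.1.1) _ fun p => ofSet ({p.1.2} : Finset (Fin (n p.1.1))) :=
        Comp.set_of (n := fun p : κ => n p.1.1) (fun p v => (v : ℕ) = p.1.2) hκ
          (hκ.var.eq hj'.up) fun p v => by simp [Fin.ext_iff]
      have hdel : ∀ p : κ, H.IsDeletionSet ((G p.1.1).mask {v | (v : ℕ) < p.1.2 + 1}) {p.1.2} := by
        intro p
        unfold IsDeletionSet
        rw [← mem_mask_iff hered union one]
        convert p.2 using 1
        ext u v
        simp only [SimpleGraph.mask_adj, Set.mem_ofPred_eq, Set.mem_compl_iff, Finset.coe_singleton,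
          Set.mem_singleton_iff, Fin.ext_iff]
        constructor
        · rintro ⟨⟨h, h1, h2⟩, h3, h4⟩
          exact ⟨h, by omega, by omega⟩
        · rintro ⟨h, h1, h2⟩
          exact ⟨⟨h, by omega, by omega⟩, by omega, by omega⟩
      -- The number `f 0 1` does not depend on the input and is at most `2 ^ f 0 1`, so it
      -- disappears in the exponent.
      have hans := A.comp_ans (s := fun _ => 0) (l := fun _ => 1) hmask (hn.up.comap _) (.const 0)
        (.const 1) hU (by simp) hdel
        ⟨f 0 1, fun i => (Nat.lt_two_pow_self.le).trans ((Nat.le_mul_of_pos_right _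
          (one_le_cost (B i.1.1) 0)).trans ((two_pow_mul_cost _ 0 _).trans (by rw [zero_add])))⟩
      refine Comp.prop_congr (P := fun p : κ => (A.ans ((G p.1.1).mask {v | (v : ℕ) < p.1.2 + 1}) 0 1
        {p.1.2}).isSome = true ∧ ((A.ans ((G p.1.1).mask {v | (v : ℕ) < p.1.2 + 1}) 0 1
        {p.1.2}).getD ∅).card = 0) (Comp.and' (comp_isSome hans) ?_) fun p => ?_
      · exact CompNum.eq (Comp.card_set (hκ.sub _) (comp_getD (hans.sub _) fun i => i.2)) (.const 0)
      rw [← A.ans_eq_empty (l := 1) (by simp) (hdel p)]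
      cases A.ans ((G p.1.1).mask {v | (v : ℕ) < p.1.2 + 1}) 0 1 {p.1.2} <;> simp
    · refine Comp.of_forall_not fun p h => p.2 (mem_mask_anti hered union one _ ?_ h)
      intro v hv
      simp only [Set.mem_ofPred_eq] at hv ⊢
      omega
  refine key.snd.prop_congr fun i => ?_
  have : (G i).mask {v | (v : ℕ) < n i} = G i := by ext u v; simp [SimpleGraph.mask_adj]
  rw [this]

end GraphClass.DisjointSolver

/-! ### Gluing -/

namespace BGraph

variable {t : ℕ}

open scoped Classical in
/-- The image in `B ⊕ A` of a vertex of `A ⊕ B`. -/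
noncomputable def glueSwap (A B : BGraph t) : GlueVertex A B → GlueVertex B A
  | .inl a => if h : ∃ i, A.bd i = a then .inl (B.bd h.choose) else .inr ⟨a, h⟩
  | .inr b => .inl b.1

/-- Together with `glueRep_glueSwap`, this says that `glueSwap` interchanges the two ways in which a
vertex of a gluing comes from a summand. Bijectivity and commutativity both follow from this pair.
-/
theorem glueSwap_eq_inl {A B : BGraph t} {x : GlueVertex A B} {b : B.V} :
    glueSwap A B x = .inl b ↔ GlueRep A B x b := by
  rcases x with a | v
  · simp only [glueSwap, GlueRep]
    split_ifs with h
    · rw [Sum.inl.injEq]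
      constructor
      · rintro rfl
        exact ⟨h.choose, h.choose_spec.symm, rfl⟩
      · rintro ⟨i, rfl, rfl⟩
        exact congrArg _ (A.bd.injective h.choose_spec)
    · simp only [false_iff]
      rintro ⟨i, rfl, -⟩
      exact h ⟨i, rfl⟩
  · simp [glueSwap, GlueRep]

theorem glueRep_glueSwap {A B : BGraph t} {x : GlueVertex A B} {a : A.V} :
    GlueRep B A (glueSwap A B x) a ↔ x = .inl a := by
  rcases x with a' | v
  · simp only [glueSwap]
    split_ifs with h
    · simp only [GlueRep, Sum.inl.injEq]
      constructor
      · rintro ⟨i, hi, rfl⟩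
        rw [← B.bd.injective hi]
        exact h.choose_spec.symm
      · rintro rfl
        exact ⟨h.choose, rfl, h.choose_spec.symm⟩
    · simp [GlueRep]
  · simp only [glueSwap, GlueRep, reduceCtorEq, iff_false]
    rintro ⟨i, hi, -⟩
    exact v.2 ⟨i, hi.symm⟩

theorem glueSwap_bijective (A B : BGraph t) : Function.Bijective (glueSwap A B) := by
  constructor
  · rintro (a | v) y h
    · have := (glueRep_glueSwap (A := A) (B := B) (x := .inl a) (a := a)).2 rfl
      rw [h] at this
      exact (glueRep_glueSwap.1 this).symm
    · have := (glueSwap_eq_inl (A := A) (B := B) (x := .inr v) (b := v.1)).2 rfl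
      rw [h, glueSwap_eq_inl] at this
      rcases y with a | w
      · obtain ⟨i, -, hi⟩ := this
        exact absurd ⟨i, hi.symm⟩ v.2
      · exact congrArg _ (Subtype.ext (Eq.symm this))
  · rintro (b | v)
    · by_cases h : ∃ i, B.bd i = b
      · obtain ⟨i, rfl⟩ := h
        exact ⟨.inl (A.bd i), glueSwap_eq_inl.2 ⟨i, rfl, rfl⟩⟩
      · exact ⟨.inr ⟨b, h⟩, rfl⟩
    · exact ⟨.inl v.1, dif_neg v.2⟩

/-- Gluing is commutative. -/
noncomputable def glueComm (A B : BGraph t) : A.glue B ≃g B.glue A :=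
  RelIso.mk (Equiv.ofBijective _ (glueSwap_bijective A B)) (by
    intro x y
    simp only [glue, Equiv.ofBijective_apply, glueSwap_eq_inl, glueRep_glueSwap]
    exact or_comm)

/-- An induced subgraph, with a boundary. -/
def ofInduce {V : Type} [Finite V] (G : SimpleGraph V) (S : Set V) (x : Fin t ↪ V)
    (hx : ∀ i, x i ∈ S) : BGraph t where
  V := S
  graph := G.induce S
  bd := ⟨fun i => ⟨x i, hx i⟩, fun _ _ h => x.injective (congrArg Subtype.val h)⟩

end BGraph

namespace GraphClass

variable {H : GraphClass} {t : ℕ}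

theorem mem_glue_comm (A B : BGraph t) : H.Mem (A.glue B) ↔ H.Mem (B.glue A) :=
  ⟨H.mem_of_iso (A.glueComm B), H.mem_of_iso (B.glueComm A)⟩

/-- The natural map from the gluing to `P ∪ Q` is injective because `hx` forces common vertices of
`P` and `Q` to be labelled. It reflects edges because `hPQ` excludes edges that lie neither within
`P` nor within `Q`. -/
theorem mem_glue_ofInduce {V : Type} [Finite V] {G : SimpleGraph V} {P Q : Set V}
    {x : Fin t ↪ V} {hP : ∀ i, x i ∈ P} {hQ : ∀ i, x i ∈ Q}
    (hx : ∀ v, v ∈ P → v ∈ Q → v ∈ Set.range x)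
    (hPQ : ∀ u v, u ∈ P → u ∉ Q → v ∈ Q → v ∉ P → ¬G.Adj u v) :
    H.Mem ((BGraph.ofInduce G P x hP).glue (BGraph.ofInduce G Q x hQ)) ↔
      H.Mem (G.induce (P ∪ Q)) := by
  have hne : ∀ v : {v : Q // v ∉ Set.range (BGraph.ofInduce G Q x hQ).bd}, v.1.1 ∉ P := by
    rintro ⟨⟨v, hv⟩, hvr⟩ hvP
    obtain ⟨i, rfl⟩ := hx v hvP hv
    exact hvr ⟨i, rfl⟩
  have key : (BGraph.ofInduce G P x hP).glue (BGraph.ofInduce G Q x hQ) ≃g G.induce (P ∪ Q) := by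
    refine RelIso.mk (Equiv.ofBijective (Sum.elim (fun a : P => ⟨a.1, Or.inl a.2⟩)
      fun v => ⟨v.1.1, Or.inr v.1.2⟩) ⟨?_, ?_⟩) ?_
    · rintro (a | a) (b | b) h
      · have h' : a.1 = b.1 := congrArg (fun z : (P ∪ Q : Set V) => z.1) h
        exact congrArg _ (Subtype.ext h')
      · have h' : a.1 = b.1.1 := congrArg Subtype.val h
        exact absurd (h' ▸ a.2) (hne b)
      · have h' : a.1.1 = b.1 := congrArg Subtype.val h
        exact absurd (h' ▸ b.2) (hne a)
      · have h' : a.1.1 = b.1.1 := congrArg (fun z : (P ∪ Q : Set V) => z.1) h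
        exact congrArg _ (Subtype.ext (Subtype.ext h'))
    · rintro ⟨v, hv⟩
      by_cases hvP : v ∈ P
      · exact ⟨.inl ⟨v, hvP⟩, rfl⟩
      · refine ⟨.inr ⟨⟨v, hv.resolve_left hvP⟩, ?_⟩, rfl⟩
        rintro ⟨i, hi⟩
        have h' : x i = v := congrArg Subtype.val hi
        exact hvP (h' ▸ hP i)
    · have repl : ∀ (a : P) (b : Q), BGraph.GlueRep (BGraph.ofInduce G P x hP)
          (BGraph.ofInduce G Q x hQ) (.inl a) b → a.1 = b.1 := by
        rintro a b ⟨i, rfl, rfl⟩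
        rfl
      have repr : ∀ (a : P) (ha : a.1 ∈ Q), BGraph.GlueRep (BGraph.ofInduce G P x hP)
          (BGraph.ofInduce G Q x hQ) (.inl a) ⟨a.1, ha⟩ := by
        rintro ⟨a, haP⟩ ha
        obtain ⟨i, rfl⟩ := hx a haP ha
        exact ⟨i, rfl, rfl⟩
      rintro (a | a) (b | b)
      · constructor
        · exact fun h => Or.inl ⟨a, b, rfl, rfl, h⟩
        · rintro (⟨a', b', h1, h2, h⟩ | ⟨a', b', h1, h2, h⟩)
          · cases h1; cases h2; exact h
          · have h' : G.Adj a'.1 b'.1 := h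
            rw [← repl a a' h1, ← repl b b' h2] at h'
            exact h'
      · constructor
        · intro h
          have ha : a.1 ∈ Q := by
            by_contra ha
            exact hPQ _ _ a.2 ha b.1.2 (hne b) h
          exact Or.inr ⟨⟨a.1, ha⟩, b.1, repr a ha, rfl, h⟩
        · rintro (⟨a', b', h1, h2, h⟩ | ⟨a', b', h1, h2, h⟩)
          · cases h2
          · have h' : G.Adj a'.1 b'.1 := h
            rw [← repl a a' h1, ← show b.1 = b' from h2] at h'
            exact h'
      · constructor
        · intro h
          have hb : b.1 ∈ Q := by
            by_contra hb
            exact hPQ _ _ b.2 hb a.1.2 (hne a) h.symm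
          exact Or.inr ⟨a.1, ⟨b.1, hb⟩, rfl, repr b hb, h⟩
        · rintro (⟨a', b', h1, h2, h⟩ | ⟨a', b', h1, h2, h⟩)
          · cases h1
          · have h' : G.Adj a'.1 b'.1 := h
            rw [← repl b b' h2, ← show a.1 = a' from h1] at h'
            exact h'
      · constructor
        · exact fun h => Or.inr ⟨a.1, b.1, rfl, rfl, h⟩
        · rintro (⟨a', b', h1, h2, h⟩ | ⟨a', b', h1, h2, h⟩)
          · cases h1
          · rw [← show a.1 = a' from h1, ← show b.1 = b' from h2] at h
            exact h
  exact ⟨H.mem_of_iso key, H.mem_of_iso key.symm⟩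

end GraphClass

/-! ### Gluing on vertex sets of the form `Fin m`, up to isolated vertices -/

/-- `u` is the `i`-th element of `Y`. -/
def IsNth {n : ℕ} (Y : Finset (Fin n)) (u : Fin n) (i : ℕ) : Prop :=
  u ∈ Y ∧ (Y.filter (· < u)).card = i

/-- The boundary is labelled in increasing order, so that a program can find the label of a vertex
by counting. -/
theorem exists_isNth_iff {n t : ℕ} {Y : Finset (Fin n)} (h : Y.card = t) :
    ∃ x : Fin t ↪ Fin n, (∀ v, v ∈ Y ↔ v ∈ Set.range x) ∧
      ∀ (u : Fin n) (i : Fin t), IsNth Y u i ↔ x i = u := by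
  have hr : ∀ v, v ∈ Y ↔ v ∈ Set.range (Y.orderEmbOfFin h) := fun v => by
    rw [Finset.range_orderEmbOfFin]; rfl
  have hc : ∀ i : Fin t, (Y.filter (· < Y.orderEmbOfFin h i)).card = i := by
    intro i
    have : Y.filter (· < Y.orderEmbOfFin h i) = (Finset.Iio i).map (Y.orderEmbOfFin h).toEmbedding := by
      ext v
      simp only [Finset.mem_filter, hr, Finset.mem_map, Finset.mem_Iio]
      constructor
      · rintro ⟨⟨j, rfl⟩, hj⟩
        exact ⟨j, by simpa using hj, rfl⟩
      · rintro ⟨j, hj, rfl⟩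
        exact ⟨⟨j, rfl⟩, by simpa using hj⟩
    rw [this, Finset.card_map, Fin.card_Iio]
  refine ⟨(Y.orderEmbOfFin h).toEmbedding, hr, fun u i => ⟨?_, ?_⟩⟩
  · rintro ⟨hu, hi⟩
    obtain ⟨j, rfl⟩ := (hr u).1 hu
    rw [hc] at hi
    rw [Fin.ext hi]
    rfl
  · rintro rfl
    exact ⟨(hr _).2 ⟨i, rfl⟩, hc i⟩

/-- The graph `G[S]` glued with `R` along `Y`, with some isolated vertices: those outside `S` and
the boundary vertices of `R`, each of which is represented by a vertex of `Y`. -/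
def glueGraph {n t : ℕ} (G : SimpleGraph (Fin n)) (S Y : Finset (Fin n)) (R : FinBGraph t) :
    SimpleGraph (Fin (n + R.n)) where
  Adj u v :=
    -- Edges of `R` between two boundary vertices are left out: under compatibility they are already
    -- present in `G`.
    (∃ a b, u = Fin.castAdd R.n a ∧ v = Fin.castAdd R.n b ∧ a ∈ S ∧ b ∈ S ∧ G.Adj a b) ∨
    (∃ w w', u = Fin.natAdd n w ∧ v = Fin.natAdd n w' ∧ (∀ i, R.bd i ≠ w) ∧ (∀ i, R.bd i ≠ w') ∧
      R.graph.Adj w w') ∨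
    (∃ a w, u = Fin.castAdd R.n a ∧ v = Fin.natAdd n w ∧ (∀ i, R.bd i ≠ w) ∧
      ∃ i : Fin t, IsNth Y a i ∧ R.graph.Adj (R.bd i) w) ∨
    (∃ a w, v = Fin.castAdd R.n a ∧ u = Fin.natAdd n w ∧ (∀ i, R.bd i ≠ w) ∧
      ∃ i : Fin t, IsNth Y a i ∧ R.graph.Adj (R.bd i) w)
  symm := ⟨by
    rintro u v (⟨a, b, h1, h2, h3, h4, h5⟩ | ⟨a, b, h1, h2, h3, h4, h5⟩ | h | h)
    · exact Or.inl ⟨b, a, h2, h1, h4, h3, h5.symm⟩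
    · exact Or.inr (Or.inl ⟨b, a, h2, h1, h4, h3, h5.symm⟩)
    · exact Or.inr (Or.inr (Or.inr h))
    · exact Or.inr (Or.inr (Or.inl h))⟩
  loopless := ⟨by
    rintro u (⟨a, b, h1, h2, -, -, h⟩ | ⟨a, b, h1, h2, -, -, h⟩ | ⟨a, b, h1, h2, -⟩ | ⟨a, b, h1, h2, -⟩)
    · exact h.ne (Fin.castAdd_injective _ _ (h1.symm.trans h2))
    · exact h.ne (Fin.natAdd_injective _ _ (h1.symm.trans h2))
    · exact absurd (congrArg Fin.val (h1.symm.trans h2)) (by simp; omega)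
    · exact absurd (congrArg Fin.val (h1.symm.trans h2)) (by simp; omega)⟩

section glueGraph

variable {n t : ℕ} {G : SimpleGraph (Fin n)} {S Y : Finset (Fin n)} {R : FinBGraph t}

theorem castAdd_ne_natAdd {n m : ℕ} (a : Fin n) (w : Fin m) : Fin.castAdd m a ≠ Fin.natAdd n w :=
  fun h => absurd (congrArg Fin.val h) (by simp; omega)

theorem glueGraph_adj_castAdd {a b : Fin n} :
    (glueGraph G S Y R).Adj (Fin.castAdd R.n a) (Fin.castAdd R.n b) ↔ a ∈ S ∧ b ∈ S ∧ G.Adj a b := by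
  simp [glueGraph, castAdd_ne_natAdd]

theorem glueGraph_adj_natAdd {w w' : Fin R.n} :
    (glueGraph G S Y R).Adj (Fin.natAdd n w) (Fin.natAdd n w') ↔
      (∀ i, R.bd i ≠ w) ∧ (∀ i, R.bd i ≠ w') ∧ R.graph.Adj w w' := by
  simp [glueGraph, (castAdd_ne_natAdd _ _).symm]

theorem glueGraph_adj_castAdd_natAdd {a : Fin n} {w : Fin R.n} :
    (glueGraph G S Y R).Adj (Fin.castAdd R.n a) (Fin.natAdd n w) ↔
      (∀ i, R.bd i ≠ w) ∧ ∃ i : Fin t, IsNth Y a i ∧ R.graph.Adj (R.bd i) w := by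
  simp [glueGraph, castAdd_ne_natAdd, (castAdd_ne_natAdd _ _).symm]

/-- The abstract gluing embeds into `glueGraph` by `φ`, and vertices outside the image of `φ` have
no neighbours. -/
theorem GraphClass.mem_glueGraph {H : GraphClass} (hered : H.Hereditary) (union : H.UnionClosed)
    (one : H.Mem (⊥ : SimpleGraph Unit)) {x : Fin t ↪ Fin n} (hxS : ∀ i, x i ∈ (S : Set (Fin n)))
    (hx : ∀ (u : Fin n) (i : Fin t), IsNth Y u i ↔ x i = u)
    (hc : R.toBGraph.Compatible (BGraph.ofInduce G S x hxS)) :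
    H.Mem (R.toBGraph.glue (BGraph.ofInduce G S x hxS)) ↔ H.Mem (glueGraph G S Y R) := by
  rw [mem_glue_comm]
  have hbd : ∀ w : {w : Fin R.n // w ∉ Set.range R.bd}, ∀ i, R.bd i ≠ w.1 :=
    fun w i h => w.2 ⟨i, h⟩
  let φ : (BGraph.ofInduce G S x hxS).GlueVertex R.toBGraph → Fin (n + R.n) :=
    Sum.elim (fun a : (S : Set (Fin n)) => Fin.castAdd R.n a.1)
      fun w : {w : Fin R.n // w ∉ Set.range R.bd} => Fin.natAdd n w.1
  have hφ : Function.Injective φ := by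
    rintro (a | a) (b | b) h
    · exact congrArg _ (Subtype.ext (Fin.castAdd_injective _ _ h))
    · exact absurd h (castAdd_ne_natAdd _ _)
    · exact absurd h.symm (castAdd_ne_natAdd _ _)
    · exact congrArg _ (Subtype.ext (Fin.natAdd_injective _ _ h))
  have hadj : ∀ u v, (glueGraph G S Y R).Adj (φ u) (φ v) ↔
      ((BGraph.ofInduce G S x hxS).glue R.toBGraph).Adj u v := by
    rintro (a | a) (b | b)
    · refine glueGraph_adj_castAdd.trans ⟨fun h => Or.inl ⟨a, b, rfl, rfl, h.2.2⟩, ?_⟩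
      rintro (⟨a', b', h1, h2, h⟩ | ⟨a', b', ⟨i, h1, rfl⟩, ⟨j, h2, rfl⟩, h⟩)
      · cases h1; cases h2; exact ⟨a.2, b.2, h⟩
      · have := (hc i j).1 h
        rw [← h1, ← h2] at this
        exact ⟨a.2, b.2, this⟩
    · refine glueGraph_adj_castAdd_natAdd.trans ⟨?_, ?_⟩
      · rintro ⟨-, i, hi, h⟩
        exact Or.inr ⟨R.bd i, b.1, ⟨i, Subtype.ext ((hx _ _).1 hi).symm, rfl⟩, rfl, h⟩
      · rintro (⟨a', b', h1, h2, h⟩ | ⟨a', b', ⟨i, h1, rfl⟩, h2, h⟩)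
        · cases h2
        · refine ⟨hbd b, i, (hx _ _).2 (congrArg Subtype.val h1).symm, ?_⟩
          rw [show b.1 = b' from h2]
          exact h
    · rw [SimpleGraph.adj_comm, SimpleGraph.adj_comm (BGraph.glue _ _)]
      refine glueGraph_adj_castAdd_natAdd.trans ⟨?_, ?_⟩
      · rintro ⟨-, i, hi, h⟩
        exact Or.inr ⟨R.bd i, a.1, ⟨i, Subtype.ext ((hx _ _).1 hi).symm, rfl⟩, rfl, h⟩
      · rintro (⟨a', b', h1, h2, h⟩ | ⟨a', b', ⟨i, h1, rfl⟩, h2, h⟩)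
        · cases h2
        · refine ⟨hbd a, i, (hx _ _).2 (congrArg Subtype.val h1).symm, ?_⟩
          rw [show a.1 = b' from h2]
          exact h
    · refine glueGraph_adj_natAdd.trans ⟨fun h => Or.inr ⟨a.1, b.1, rfl, rfl, h.2.2⟩, ?_⟩
      rintro (⟨a', b', h1, h2, h⟩ | ⟨a', b', h1, h2, h⟩)
      · cases h1
      · refine ⟨hbd a, hbd b, ?_⟩
        rw [show a.1 = a' from h1, show b.1 = b' from h2]
        exact h
  refine mem_iff_of_isolated hered union one ⟨⟨φ, hφ⟩, fun {u v} => hadj u v⟩ ?_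
  have hN : ∀ (w : Fin R.n), (∀ i, R.bd i ≠ w) → Fin.natAdd n w ∈ Set.range φ := fun w hw =>
    ⟨.inr ⟨w, fun ⟨i, hi⟩ => hw i hi⟩, rfl⟩
  have hC : ∀ a : Fin n, a ∈ S → Fin.castAdd R.n a ∈ Set.range φ := fun a ha => ⟨.inl ⟨a, ha⟩, rfl⟩
  rintro u v (⟨a, b, rfl, -, ha, -⟩ | ⟨a, b, rfl, -, ha, -⟩ | ⟨a, b, rfl, -, hw, i, hi, -⟩ |
    ⟨a, b, -, rfl, hw, -⟩)
  · exact hC a ha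
  · exact hN a ha
  · exact hC a ((hx _ _).1 hi ▸ hxS i)
  · exact hN b hw

end glueGraph

/-! ### Lists of partial solutions -/

/-- All results of applying a part of the operations `op a`, for `a ∈ l`, to `b`. -/
def subApply {α β : Type} (op : α → β → β) (l : List α) (b : β) : List β :=
  l.foldl (fun acc a => acc ++ acc.map (op a)) [b]

/-- With `insert` as the operation this enumerates all subsets of a set, and with the addition of an
edge all graphs on a vertex set. -/
theorem mem_subApply {α β : Type} {op : α → β → β} {l : List α} {b : β} (p : α → Bool) :
    (l.filter p).foldl (fun x a => op a x) b ∈ subApply op l b := by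
  suffices h : ∀ (acc : List β) (x : β), x ∈ acc → (l.filter p).foldl (fun x a => op a x) x ∈
      l.foldl (fun acc a => acc ++ acc.map (op a)) acc from h _ _ (List.mem_singleton_self b)
  induction l with
  | nil => exact fun _ _ h => h
  | cons a l ih =>
    intro acc x hx
    rw [List.foldl_cons]
    cases h : p a with
    | false =>
      rw [List.filter_cons_of_neg (by simp [h])]
      exact ih _ _ (List.mem_append_left _ hx)
    | true =>
      rw [List.filter_cons_of_pos h, List.foldl_cons]
      exact ih _ _ (List.mem_append_right _ (List.mem_map_of_mem hx))

theorem length_subApply {α β : Type} (op : α → β → β) (l : List α) (b : β) :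
    (subApply op l b).length = 2 ^ l.length := by
  suffices h : ∀ acc : List β, (l.foldl (fun acc a => acc ++ acc.map (op a)) acc).length =
      acc.length * 2 ^ l.length by simpa [subApply] using h [b]
  induction l with
  | nil => simp
  | cons a l ih =>
    intro acc
    rw [List.foldl_cons, ih, List.length_append, List.length_map, List.length_cons, pow_succ]
    ring

/-- The elements of a set, in a list. -/
noncomputable def members {n : ℕ} (X : Finset (Fin n)) : List (Fin n) :=
  (List.finRange n).filter fun v => propBit (v ∈ X)

theorem mem_members {n : ℕ} {X : Finset (Fin n)} {v : Fin n} : v ∈ members X ↔ v ∈ X := by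
  simp [members, propBit_eq_true]

theorem length_members {n : ℕ} (X : Finset (Fin n)) : (members X).length = X.card := by
  rw [members, ← List.toFinset_card_of_nodup ((List.nodup_finRange _).filter _)]
  congr 1
  ext v
  simp [propBit_eq_true]

/-- The subsets of a set, in a list. -/
noncomputable def subsets {n : ℕ} (X : Finset (Fin n)) : List (Finset (Fin n)) :=
  subApply insert (members X) ∅

theorem length_subsets {n : ℕ} (X : Finset (Fin n)) : (subsets X).length = 2 ^ X.card := by
  rw [subsets, length_subApply, length_members]

theorem mem_subsets {n : ℕ} {X S : Finset (Fin n)} (h : S ⊆ X) : S ∈ subsets X := by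
  have key : ∀ (l : List (Fin n)) (s : Finset (Fin n)),
      l.foldl (fun x a => insert a x) s = s ∪ l.toFinset := by
    intro l
    induction l with
    | nil => simp
    | cons a l ih => intro s; rw [List.foldl_cons, ih]; ext; simp
  have := mem_subApply (op := insert) (l := members X) (b := (∅ : Finset (Fin n)))
    fun v => propBit (v ∈ S)
  rw [key] at this
  have he : ∅ ∪ ((members X).filter fun v => propBit (v ∈ S)).toFinset = S := by
    ext v
    simpa [mem_members, propBit_eq_true] using fun hv => h hv
  rwa [he] at this

theorem subset_of_mem_subsets {n : ℕ} {X S : Finset (Fin n)} (h : S ∈ subsets X) : S ⊆ X := by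
  suffices key : ∀ (l : List (Fin n)) (acc : List (Finset (Fin n))), (∀ v ∈ l, v ∈ X) →
      (∀ S ∈ acc, S ⊆ X) → ∀ S ∈ l.foldl (fun acc a => acc ++ acc.map (insert a)) acc, S ⊆ X from
    key (members X) [∅] (fun v => mem_members.1) (by simp) S h
  intro l
  induction l with
  | nil => exact fun acc _ h => h
  | cons a l ih =>
    intro acc hl hacc
    rw [List.foldl_cons]
    refine ih _ (fun v hv => hl v (List.mem_cons_of_mem _ hv)) fun S hS => ?_
    rcases List.mem_append.1 hS with hS | hS
    · exact hacc S hS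
    · obtain ⟨S', hS', rfl⟩ := List.mem_map.1 hS
      exact Finset.insert_subset (hl a List.mem_cons_self) (hacc S' hS')

/-- The first set of minimum size in a list, as a list with at most one element. -/
noncomputable def smallest {n : ℕ} (l : List (Finset (Fin n))) : List (Finset (Fin n)) :=
  (l.filter fun Z => propBit (∀ Z' ∈ l, Z.card ≤ Z'.card)).take 1

theorem length_smallest_le {n : ℕ} (l : List (Finset (Fin n))) : (smallest l).length ≤ 1 :=
  List.length_take_le _ _

theorem mem_of_mem_smallest {n : ℕ} {l : List (Finset (Fin n))} {Z : Finset (Fin n)}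
    (h : Z ∈ smallest l) : Z ∈ l ∧ ∀ Z' ∈ l, Z.card ≤ Z'.card := by
  have := List.mem_filter.1 (List.mem_of_mem_take h)
  exact ⟨this.1, propBit_eq_true.1 this.2⟩

theorem exists_mem_smallest {n : ℕ} {l : List (Finset (Fin n))} {Z : Finset (Fin n)} (h : Z ∈ l) :
    ∃ Z', Z' ∈ smallest l := by
  obtain ⟨Z', h1, h2⟩ := l.toFinset.exists_min_image Finset.card ⟨Z, List.mem_toFinset.2 h⟩
  have hm : Z' ∈ l.filter fun Z => propBit (∀ Z' ∈ l, Z.card ≤ Z'.card) :=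
    List.mem_filter.2 ⟨List.mem_toFinset.1 h1, propBit_pos fun Z'' h => h2 _ (List.mem_toFinset.2 h)⟩
  unfold smallest
  cases hl : l.filter fun Z => propBit (∀ Z' ∈ l, Z.card ≤ Z'.card) with
  | nil => rw [hl] at hm; simp at hm
  | cons a l => exact ⟨a, by simp⟩

/-! ### Exchanging partial solutions across a small boundary -/

namespace GraphClass

variable {H : GraphClass} {k l n N : ℕ}

/-- A list of boundaried graphs with at most `l` vertices, containing a graph from every class of
graphs in `H` with at most `k` boundary vertices. -/
structure IsComplete (H : GraphClass) (k l : ℕ) (F : List (Σ t : ℕ, FinBGraph t)) : Prop where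
  size_le : ∀ R ∈ F, R.2.n ≤ l
  exists_equivalent : ∀ t ≤ k, ∀ A : BGraph t, H.Mem A.graph →
    ∃ R : FinBGraph t, ⟨t, R⟩ ∈ F ∧ H.Equivalent R.toBGraph A

theorem mem_induce_congr {V : Type} [Finite V] {G : SimpleGraph V} {s t : Set V} (h : s = t) :
    H.Mem (G.induce s) ↔ H.Mem (G.induce t) := by subst h; rfl

/-- Take for `R` a representative of the graph induced by the vertices outside `I` and `W`, with
boundary `X \ W`; it is in `H` as a subgraph of `G - W`. No edge joins `I` to the outside except
through `X`, so gluing this graph with `G[(I ∪ X) \ Z]` yields `G` without `W \ (I ∪ X) ∪ Z`. The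
decisive point is that `R` depends on `W` but not on `Z`: one test compares all candidates `Z`. -/
theorem IsComplete.exists_rep (hered : H.Hereditary) (union : H.UnionClosed)
    (one : H.Mem (⊥ : SimpleGraph Unit)) {F : List (Σ t : ℕ, FinBGraph t)} (hF : H.IsComplete k l F)
    {G : SimpleGraph (Fin n)} {I X W : Finset (Fin n)}
    (hN : ∀ u ∈ I, ∀ v, G.Adj u v → v ∈ I ∪ X) (hX : X.card ≤ k) (hIX : Disjoint I X)
    (hW : H.IsDeletionSet G W) :
    ∃ R ∈ F, R.1 = (X \ (W ∩ X)).card ∧ ∀ Z ⊆ I ∪ X, Z ∩ X = W ∩ X →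
      (H.Mem (glueGraph G ((I ∪ X) \ Z) (X \ (W ∩ X)) R.2) ↔
        H.IsDeletionSet G (W \ (I ∪ X) ∪ Z)) := by
  obtain ⟨x, hx1, hx2⟩ := exists_isNth_iff (rfl : (X \ (W ∩ X)).card = _)
  have hxm : ∀ i, x i ∈ X ∧ x i ∉ W := fun i => by
    have := (hx1 (x i)).2 ⟨i, rfl⟩
    simp only [Finset.mem_sdiff, Finset.mem_inter, not_and] at this
    exact ⟨this.1, fun h => this.2 h this.1⟩
  have hxC : ∀ i, x i ∈ {v | v ∉ I ∧ v ∉ W} := fun i =>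
    ⟨fun h => Finset.disjoint_left.1 hIX h (hxm i).1, (hxm i).2⟩
  have hC : H.Mem (BGraph.ofInduce G {v | v ∉ I ∧ v ∉ W} x hxC).graph := by
    have hsub : {v | v ∉ I ∧ v ∉ W} ⊆ ((W : Set (Fin n))ᶜ) := fun v hv => by simpa using hv.2
    exact hered.of_embedding (G.induceHomOfLE hsub) hW
  obtain ⟨R, hRF, hR⟩ := hF.exists_equivalent _
    ((Finset.card_le_card Finset.sdiff_subset).trans hX) _ hC
  refine ⟨⟨_, R⟩, hRF, rfl, fun Z hZ hZX => ?_⟩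
  have hZX' : ∀ v ∈ X, (v ∈ Z ↔ v ∈ W) := fun v hv => by
    have := Finset.ext_iff.1 hZX v
    simp only [Finset.mem_inter] at this
    tauto
  have hxD : ∀ i, x i ∈ (((I ∪ X) \ Z : Finset (Fin n)) : Set (Fin n)) := fun i => by
    have h1 := (hxm i).1
    have h2 := mt (hZX' _ h1).1 (hxm i).2
    simp [h1, h2]
  have hcD : R.toBGraph.Compatible (BGraph.ofInduce G _ x hxD) := fun i j => hR.1 i j
  -- From `glueGraph` to the gluing with `R`, then to the gluing with the actual outside by
  -- equivalence, then to an induced subgraph of `G`.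
  rw [← mem_glueGraph hered union one hxD hx2 hcD, hR.2 _ hcD, mem_glue_ofInduce]
  · have : {v | v ∉ I ∧ v ∉ W} ∪ (((I ∪ X) \ Z : Finset (Fin n)) : Set (Fin n)) =
        ((W \ (I ∪ X) ∪ Z : Finset (Fin n)) : Set (Fin n))ᶜ := by
      ext v
      have h1 := hZX' v
      have h2 : v ∈ Z → v ∈ I ∨ v ∈ X := fun h => by simpa using hZ h
      have h3 : v ∈ I → v ∉ X := fun h => Finset.disjoint_left.1 hIX h
      simp only [Set.mem_union, Set.mem_ofPred_eq, Finset.coe_sdiff, Finset.coe_union, Set.mem_sdiff,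
        Set.mem_compl_iff, SetLike.mem_coe]
      tauto
    exact mem_induce_congr this
  · intro v hv1 hv2
    simp only [Finset.coe_sdiff, Finset.coe_union, Set.mem_sdiff, Set.mem_union, Finset.mem_coe] at hv2
    refine (hx1 v).1 ?_
    simp only [Finset.mem_sdiff, Finset.mem_inter]
    exact ⟨hv2.1.resolve_left hv1.1, fun h => hv1.2 h.1⟩
  · intro u v hu1 hu2 hv1 hv2 h
    simp only [Finset.coe_sdiff, Finset.coe_union, Set.mem_sdiff, Set.mem_union, Finset.mem_coe,
      Set.mem_ofPred_eq] at hu1 hu2 hv1 hv2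
    have hvI : v ∈ I := by
      by_contra hvI
      have hvX := hv1.1.resolve_left hvI
      exact hv2 ⟨hvI, mt (hZX' v hvX).2 hv1.2⟩
    have huX := (Finset.mem_union.1 (hN v hvI u h.symm)).resolve_left hu1.1
    exact hu2 ⟨Or.inr huX, mt (hZX' u huX).1 hu1.2⟩

/-- The list `Zs` of subsets of `I ∪ X` suffices to complete solutions outside `I ∪ X`: every
deletion set that has at most `k` vertices in `I ∩ L t`, for all `t`, can be changed on `I ∪ X` to an
element of `Zs`, without changing it on `X` or making it larger on `I`. -/
def Suffices (H : GraphClass) (G : SimpleGraph (Fin n)) (k : ℕ) (L : Fin N → Finset (Fin n))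
    (I X : Finset (Fin n)) (Zs : List (Finset (Fin n))) : Prop :=
  ∀ W : Finset (Fin n), H.IsDeletionSet G W → (∀ t, (W ∩ I ∩ L t).card ≤ k) →
    ∃ Z ∈ Zs, Z ⊆ I ∪ X ∧ Z ∩ X = W ∩ X ∧ (Z ∩ I).card ≤ (W ∩ I).card ∧
      H.IsDeletionSet G (W \ (I ∪ X) ∪ Z)

/-- The sets of the list that solve the instance with outside `R` and solution `S` on `X`. -/
noncomputable def solving (H : GraphClass) (G : SimpleGraph (Fin n)) (I X : Finset (Fin n))
    (Zs : List (Finset (Fin n))) (S : Finset (Fin n)) (R : Σ t : ℕ, FinBGraph t) :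
    List (Finset (Fin n)) :=
  Zs.filter fun Z => propBit (Z ⊆ I ∪ X ∧ Z ∩ X = S ∧ R.1 = (X \ S).card ∧
    H.Mem (glueGraph G ((I ∪ X) \ Z) (X \ S) R.2))

/-- A short sublist that still suffices. -/
noncomputable def trim (H : GraphClass) (G : SimpleGraph (Fin n)) (F : List (Σ t : ℕ, FinBGraph t))
    (I X : Finset (Fin n)) (Zs : List (Finset (Fin n))) : List (Finset (Fin n)) :=
  (subsets X).flatMap fun S => F.flatMap fun R => smallest (H.solving G I X Zs S R)

theorem length_flatMap_le {α β : Type} {l : List α} {f : α → List β} {m : ℕ}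
    (h : ∀ x ∈ l, (f x).length ≤ m) : (l.flatMap f).length ≤ l.length * m := by
  rw [List.length_flatMap]
  simpa using List.sum_le_card_nsmul (l.map fun x => (f x).length) m (by simpa using h)

theorem length_trim_le {G : SimpleGraph (Fin n)} {F : List (Σ t : ℕ, FinBGraph t)}
    {I X : Finset (Fin n)} {Zs : List (Finset (Fin n))} :
    (H.trim G F I X Zs).length ≤ 2 ^ X.card * F.length := by
  rw [← length_subsets]
  refine length_flatMap_le fun S _ => ?_
  simpa using length_flatMap_le (l := F) fun R _ => length_smallest_le (H.solving G I X Zs S R)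

theorem card_eq_of_subset_union {I X Z : Finset (Fin n)} (hIX : Disjoint I X) (hZ : Z ⊆ I ∪ X) :
    Z.card = (Z ∩ I).card + (Z ∩ X).card := by
  rw [← Finset.card_union_of_disjoint (Finset.disjoint_of_subset_left Finset.inter_subset_right
    (Finset.disjoint_of_subset_right Finset.inter_subset_right hIX)), ← Finset.inter_union_distrib_left,
    Finset.inter_eq_left.2 hZ]

/-- Let `R` represent the outside of `W`. The set `Z` supplied by the old list solves the pair `(W ∩
X, R)`, hence a smallest solving set `Z'` was kept. By `exists_rep` with the same `R`, it completes
`W` as well. Since `Z` and `Z'` agree on `X`, the comparison of sizes is one on `I`. -/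
theorem Suffices.trim (hered : H.Hereditary) (union : H.UnionClosed)
    (one : H.Mem (⊥ : SimpleGraph Unit)) {F : List (Σ t : ℕ, FinBGraph t)} (hF : H.IsComplete k l F)
    {G : SimpleGraph (Fin n)} {L : Fin N → Finset (Fin n)} {I X : Finset (Fin n)}
    {Zs : List (Finset (Fin n))}
    (hN : ∀ u ∈ I, ∀ v, G.Adj u v → v ∈ I ∪ X) (hX : X.card ≤ k) (hIX : Disjoint I X)
    (h : H.Suffices G k L I X Zs) : H.Suffices G k L I X (H.trim G F I X Zs) := by
  intro W hW hL
  obtain ⟨Z, hZs, hZ, hZX, hZI, hZW⟩ := h W hW hL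
  obtain ⟨R, hR, hRt, hRW⟩ := hF.exists_rep hered union one hN hX hIX hW
  have hmem : Z ∈ H.solving G I X Zs (W ∩ X) R :=
    List.mem_filter.2 ⟨hZs, propBit_pos ⟨hZ, hZX, hRt, (hRW Z hZ hZX).2 hZW⟩⟩
  obtain ⟨Z', hZ'⟩ := exists_mem_smallest hmem
  obtain ⟨h1, h2⟩ := mem_of_mem_smallest hZ'
  have h3 := h2 Z hmem
  obtain ⟨h4, h5, -, h6⟩ := propBit_eq_true.1 (List.mem_filter.1 h1).2
  refine ⟨Z', ?_, h4, h5, ?_, (hRW Z' h4 h5).1 h6⟩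
  · exact List.mem_flatMap.2 ⟨W ∩ X, mem_subsets Finset.inter_subset_right,
      List.mem_flatMap.2 ⟨R, hR, hZ'⟩⟩
  · rw [card_eq_of_subset_union hIX hZ, card_eq_of_subset_union hIX h4, h5, hZX] at h3
    omega

/-- All unions of an element of one list with an element of another one. -/
def unions (As Bs : List (Finset (Fin n))) : List (Finset (Fin n)) :=
  As.flatMap fun A => Bs.map fun B => A ∪ B

/-- Exchange twice: replace `W` on `I' ∪ X'` by some `B`, then the resulting deletion set on `I ∪ X`
by some `A`. The first exchange leaves `W ∩ I` unchanged, so the bounds required for the second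
persist, and both keep the traces on `X` and `X'`. The vertices of `X' \ X` become private and are
counted as in `W`. -/
theorem Suffices.unions {G : SimpleGraph (Fin n)} {L : Fin N → Finset (Fin n)}
    {I I' X X' : Finset (Fin n)} {As Bs : List (Finset (Fin n))}
    (hII : Disjoint I I') (hIX : Disjoint I X) (hIX' : Disjoint I X') (hI'X : Disjoint I' X)
    (hI'X' : Disjoint I' X')
    (hA : H.Suffices G k L I X As) (hB : H.Suffices G k L I' X' Bs) :
    H.Suffices G k L (I ∪ I' ∪ X' \ X) X (unions As Bs) := by
  intro W hW hL
  have mono : ∀ {J : Finset (Fin n)}, J ⊆ I ∪ I' ∪ X' \ X → ∀ t, (W ∩ J ∩ L t).card ≤ k :=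
    fun hJ t => (Finset.card_le_card (Finset.inter_subset_inter_right
      (Finset.inter_subset_inter_left hJ))).trans (hL t)
  rw [Finset.disjoint_left] at hII hIX hIX' hI'X hI'X'
  obtain ⟨B, hBs, hB1, hB2, hB3, hB4⟩ := hB W hW (mono (by grind))
  have hWI : (W \ (I' ∪ X') ∪ B) ∩ I = W ∩ I := by
    ext v
    have := @hB1 v
    have := @hII v
    have := @hIX' v
    simp only [Finset.mem_union, Finset.mem_inter, Finset.mem_sdiff] at *
    tauto
  obtain ⟨A, hAs, hA1, hA2, hA3, hA4⟩ := hA _ hB4 (by rw [hWI]; exact mono (by grind))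
  rw [hWI] at hA3
  have hB2' : ∀ v, v ∈ X' → (v ∈ B ↔ v ∈ W) := fun v hv => by
    have := Finset.ext_iff.1 hB2 v
    simp only [Finset.mem_inter] at this
    tauto
  have hA2' : ∀ v, v ∈ X → (v ∈ A ↔ v ∈ W) := fun v hv => by
    have h1 := Finset.ext_iff.1 hA2 v
    have h2 := hB2' v
    have h3 := @hB1 v
    have h4 := @hI'X v
    simp only [Finset.mem_inter, Finset.mem_union, Finset.mem_sdiff] at h1 h3
    tauto
  refine ⟨A ∪ B, List.mem_flatMap.2 ⟨A, hAs, List.mem_map.2 ⟨B, hBs, rfl⟩⟩, ?_, ?_, ?_, ?_⟩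
  · grind
  · ext v
    have h1 := hA2' v
    have h2 := hB2' v
    grind
  · have h1 : (A ∪ B) ∩ (I ∪ I' ∪ X' \ X) ⊆ A ∩ I ∪ B ∩ I' ∪ W ∩ (X' \ X) := by
      intro v
      have h1 := hA2' v
      have h2 := hB2' v
      grind
    have h2 : W ∩ (I ∪ I' ∪ X' \ X) = W ∩ I ∪ W ∩ I' ∪ W ∩ (X' \ X) := by
      rw [Finset.inter_union_distrib_left, Finset.inter_union_distrib_left]
    have h3 := (Finset.card_le_card h1).trans ((Finset.card_union_le _ _).trans
      (Nat.add_le_add_right (Finset.card_union_le _ _) _))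
    rw [h2, Finset.card_union_of_disjoint, Finset.card_union_of_disjoint]
    · omega
    · rw [Finset.disjoint_left]; grind
    · rw [Finset.disjoint_left]; grind
  · convert hA4 using 1
    ext v
    have h1 := hA2' v
    have h2 := hB2' v
    grind

/-! ### Disjoint deletion at a single bag -/

/-- The vertices of `glueGraph G S Y R` that represent vertices of `R`. -/
def outsideSet {t : ℕ} (Y : Finset (Fin n)) (R : FinBGraph t) : Finset (Fin (n + R.n)) :=
  Y.map (Fin.castAddEmb R.n) ∪ ((Finset.univ.map R.bd)ᶜ).map (Fin.natAddEmb n)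

theorem castAdd_mem_outsideSet {t : ℕ} {Y : Finset (Fin n)} {R : FinBGraph t} {a : Fin n} :
    Fin.castAdd R.n a ∈ outsideSet Y R ↔ a ∈ Y := by
  simp only [outsideSet, Finset.mem_union, Finset.mem_map]
  constructor
  · rintro (⟨b, hb, h⟩ | ⟨w, -, h⟩)
    · rwa [← Fin.castAdd_injective _ _ h]
    · exact absurd h.symm (castAdd_ne_natAdd _ _)
  · exact fun h => Or.inl ⟨a, h, rfl⟩

theorem natAdd_mem_outsideSet {t : ℕ} {Y : Finset (Fin n)} {R : FinBGraph t} {w : Fin R.n} :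
    Fin.natAdd n w ∈ outsideSet Y R ↔ ∀ i, R.bd i ≠ w := by
  simp only [outsideSet, Finset.mem_union, Finset.mem_map]
  constructor
  · rintro (⟨b, hb, h⟩ | ⟨w', hw, h⟩)
    · exact absurd h (castAdd_ne_natAdd _ _)
    · rw [← Fin.natAdd_injective _ _ h]
      simpa using hw
  · exact fun h => Or.inr ⟨w, by simpa using h, rfl⟩

/-- A boundary vertex of `R` is counted through the vertex of `Y` with which it is identified. The
forbidden set thus obeys the same size bound as the representatives. -/
theorem card_outsideSet {t : ℕ} {Y : Finset (Fin n)} {R : FinBGraph t} (h : t = Y.card) :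
    (outsideSet Y R).card = R.n := by
  have ht : t ≤ R.n := by simpa using Fintype.card_le_of_embedding R.bd
  rw [outsideSet, Finset.card_union_of_disjoint]
  · simp only [Finset.card_map, Finset.card_compl, Fintype.card_fin, Finset.card_univ]
    omega
  · rw [Finset.disjoint_left]
    intro v h1 h2
    obtain ⟨a, -, rfl⟩ := Finset.mem_map.1 h1
    obtain ⟨w, -, h⟩ := Finset.mem_map.1 h2
    exact castAdd_ne_natAdd _ _ h.symm

/-- Without the vertices of `R`, only `G[S \ Y]` and isolated vertices remain. This makes
`outsideSet Y R` a legitimate set `U` for Disjoint `H`-deletion. -/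
theorem isDeletionSet_outsideSet (hered : H.Hereditary) (union : H.UnionClosed)
    (one : H.Mem (⊥ : SimpleGraph Unit)) {t : ℕ} {G : SimpleGraph (Fin n)} {I S Y : Finset (Fin n)}
    {R : FinBGraph t} (hI : H.Mem (G.induce (I : Set (Fin n)))) (hIS : S \ Y = I) :
    H.IsDeletionSet (glueGraph G S Y R) (outsideSet Y R) := by
  unfold IsDeletionSet
  rw [← mem_mask_iff hered union one]
  subst hIS
  have hmem : ∀ a : ((S \ Y : Finset (Fin n)) : Set (Fin n)), a.1 ∈ S ∧ a.1 ∉ Y :=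
    fun a => by simpa using a.2
  refine (mem_iff_of_isolated hered union one ⟨⟨fun a => Fin.castAdd R.n a.1, fun a b h =>
    Subtype.ext (Fin.castAdd_injective _ _ h)⟩, fun {a b} => ?_⟩ ?_).1 hI
  · refine Iff.trans (b := (glueGraph G S Y R).Adj (Fin.castAdd R.n a.1) (Fin.castAdd R.n b.1) ∧ _) Iff.rfl ?_
    rw [glueGraph_adj_castAdd]
    have ha := hmem a
    have hb := hmem b
    simp [castAdd_mem_outsideSet, ha, hb]
  · rintro u v ⟨⟨a, b, rfl, -, ha, -⟩ | ⟨a, b, rfl, -, ha, -⟩ | ⟨a, b, rfl, rfl, hw, i, hi, -⟩ |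
      ⟨a, b, -, rfl, hw, -⟩, hu, hv⟩
    · have : a ∉ Y := fun h => hu (castAdd_mem_outsideSet.2 h)
      exact ⟨⟨a, by simp [ha, this]⟩, rfl⟩
    · exact absurd (natAdd_mem_outsideSet.2 ha) hu
    · exact absurd (natAdd_mem_outsideSet.2 hw) hv
    · exact absurd (natAdd_mem_outsideSet.2 hw) hu

/-- The part in the first summand of a set of vertices of a glued graph. -/
def leftPart {m : ℕ} (Z : Finset (Fin (n + m))) : Finset (Fin n) :=
  Finset.univ.filter fun v => Fin.castAdd m v ∈ Z

theorem mem_leftPart {m : ℕ} {Z : Finset (Fin (n + m))} {v : Fin n} :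
    v ∈ leftPart Z ↔ Fin.castAdd m v ∈ Z := by simp [leftPart]

theorem card_leftPart_le {m : ℕ} (Z : Finset (Fin (n + m))) : (leftPart Z).card ≤ Z.card := by
  rw [← Finset.card_map (Fin.castAddEmb m)]
  refine Finset.card_le_card fun v hv => ?_
  obtain ⟨a, ha, rfl⟩ := Finset.mem_map.1 hv
  exact mem_leftPart.1 ha

/-- Besides vertices of the first summand outside `Y`, a set that avoids `outsideSet` can contain
only the copies of boundary vertices of `R`, which are isolated. Deleting it has therefore the same
effect as shrinking `S`. -/
theorem isDeletionSet_glueGraph (hered : H.Hereditary) (union : H.UnionClosed)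
    (one : H.Mem (⊥ : SimpleGraph Unit)) {t : ℕ} {G : SimpleGraph (Fin n)} {S Y : Finset (Fin n)}
    {R : FinBGraph t} {Z : Finset (Fin (n + R.n))} (hZ : Disjoint Z (outsideSet Y R)) :
    H.IsDeletionSet (glueGraph G S Y R) Z ↔ H.Mem (glueGraph G (S \ leftPart Z) Y R) := by
  unfold IsDeletionSet
  rw [← mem_mask_iff hered union one]
  have hY : ∀ a ∈ Y, Fin.castAdd R.n a ∉ Z := fun a ha h =>
    Finset.disjoint_left.1 hZ h (castAdd_mem_outsideSet.2 ha)
  have hR : ∀ w, (∀ i, R.bd i ≠ w) → Fin.natAdd n w ∉ Z := fun w hw h =>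
    Finset.disjoint_left.1 hZ h (natAdd_mem_outsideSet.2 hw)
  have : (glueGraph G S Y R).mask ((Z : Set (Fin (n + R.n)))ᶜ) = glueGraph G (S \ leftPart Z) Y R := by
    ext u v
    have cn : ∀ (a : Fin n) (w : Fin R.n), ((glueGraph G S Y R).mask ((Z : Set (Fin (n + R.n)))ᶜ)).Adj
        (Fin.castAdd R.n a) (Fin.natAdd n w) ↔ (glueGraph G (S \ leftPart Z) Y R).Adj
        (Fin.castAdd R.n a) (Fin.natAdd n w) := by
      intro a w
      simp only [SimpleGraph.mask_adj, glueGraph_adj_castAdd_natAdd, Set.mem_compl_iff, Finset.mem_coe]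
      constructor
      · exact fun h => h.1
      · intro h
        obtain ⟨i, hi, -⟩ := h.2
        exact ⟨h, hY a hi.1, hR w h.1⟩
    induction u using Fin.addCases with
    | left a =>
      induction v using Fin.addCases with
      | left b =>
        simp only [SimpleGraph.mask_adj, glueGraph_adj_castAdd, Set.mem_compl_iff, Finset.mem_coe,
          Finset.mem_sdiff, mem_leftPart]
        tauto
      | right w => exact cn a w
    | right w =>
      induction v using Fin.addCases with
      | left a =>
        rw [SimpleGraph.adj_comm, cn a w, SimpleGraph.adj_comm]
      | right w' =>
        simp only [SimpleGraph.mask_adj, glueGraph_adj_natAdd, Set.mem_compl_iff, Finset.mem_coe]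
        constructor
        · exact fun h => h.1
        · exact fun h => ⟨h, hR w h.1, hR w' h.2.1⟩
  rw [this]

variable {f : ℕ → ℕ → ℕ}

/-- The set obtained from the answer of an algorithm for disjoint deletion for the graph `G[I ∪ X]`
with outside `R` and solution `S` on `X`, in a list with at most one element. -/
noncomputable def DisjointSolver.answer (A : H.DisjointSolver f) (k l : ℕ) (G : SimpleGraph (Fin n))
    (I X S : Finset (Fin n)) (R : Σ t : ℕ, FinBGraph t) : List (Finset (Fin n)) :=
  open scoped Classical in
  if R.1 = (X \ S).card ∧ (A.ans (glueGraph G ((I ∪ X) \ S) (X \ S) R.2) k l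
      (outsideSet (X \ S) R.2)).isSome = true then
    [S ∪ I ∩ leftPart ((A.ans (glueGraph G ((I ∪ X) \ S) (X \ S) R.2) k l
      (outsideSet (X \ S) R.2)).getD ∅)]
  else []

/-- The list computed by an algorithm for disjoint deletion. -/
noncomputable def DisjointSolver.answers (A : H.DisjointSolver f) (k l : ℕ) (G : SimpleGraph (Fin n))
    (F : List (Σ t : ℕ, FinBGraph t)) (I X : Finset (Fin n)) : List (Finset (Fin n)) :=
  (subsets X).flatMap fun S => F.flatMap fun R => A.answer k l G I X S R

theorem DisjointSolver.length_answer_le (A : H.DisjointSolver f) {k l : ℕ} {G : SimpleGraph (Fin n)}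
    {I X S : Finset (Fin n)} {R : Σ t : ℕ, FinBGraph t} : (A.answer k l G I X S R).length ≤ 1 := by
  unfold answer
  split_ifs <;> simp

theorem DisjointSolver.length_answers_le (A : H.DisjointSolver f) {k l : ℕ} {G : SimpleGraph (Fin n)}
    {F : List (Σ t : ℕ, FinBGraph t)} {I X : Finset (Fin n)} :
    (A.answers k l G F I X).length ≤ 2 ^ X.card * F.length := by
  rw [← length_subsets]
  refine length_flatMap_le fun S _ => ?_
  simpa using length_flatMap_le (l := F) fun R _ => A.length_answer_le (R := R)

theorem sdiff_sdiff_eq_of_disjoint {I X S : Finset (Fin n)} (hIX : Disjoint I X) (hS : S ⊆ X) :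
    ((I ∪ X) \ S) \ (X \ S) = I := by
  ext v
  have h1 := @hS v
  have h2 : v ∈ I → v ∉ X := fun h => Finset.disjoint_left.1 hIX h
  simp only [Finset.mem_sdiff, Finset.mem_union]
  tauto

/-- For `S = W ∩ X` and `R` representing the outside of `W`, the set `W ∩ I` solves the disjoint
instance. The algorithm must then return a set that is no larger, and by `exists_rep` its part in
`I`, joined with `S`, completes `W`. -/
theorem DisjointSolver.suffices_answers (A : H.DisjointSolver f) (hered : H.Hereditary)
    (union : H.UnionClosed) (one : H.Mem (⊥ : SimpleGraph Unit)) {F : List (Σ t : ℕ, FinBGraph t)}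
    (hF : H.IsComplete k l F) {G : SimpleGraph (Fin n)} {L : Fin N → Finset (Fin n)}
    {X : Finset (Fin n)} (t : Fin N)
    (hN : ∀ u ∈ L t, ∀ v, G.Adj u v → v ∈ L t ∪ X) (hX : X.card ≤ k) (hIX : Disjoint (L t) X)
    (hL : H.Mem (G.induce (L t : Set (Fin n)))) :
    H.Suffices G k L (L t) X (A.answers k l G F (L t) X) := by
  intro W hW hk
  have hk := hk t
  set I := L t
  rw [Finset.inter_assoc, Finset.inter_self] at hk
  obtain ⟨R, hR, hRt, hRW⟩ := hF.exists_rep hered union one hN hX hIX hW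
  set S := W ∩ X with hS
  have hSX : S ⊆ X := Finset.inter_subset_right
  have hIXv : ∀ v, v ∈ I → v ∉ X := fun v h => Finset.disjoint_left.1 hIX h
  have hcor := A.correct (glueGraph G ((I ∪ X) \ S) (X \ S) R.2) k l (outsideSet (X \ S) R.2)
    (by rw [card_outsideSet hRt]; exact hF.size_le R hR)
    (isDeletionSet_outsideSet hered union one hL (sdiff_sdiff_eq_of_disjoint hIX hSX))
  have hZ0 : H.IsDeletionSet (glueGraph G ((I ∪ X) \ S) (X \ S) R.2)
      ((W ∩ I).map (Fin.castAddEmb R.2.n)) ∧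
      Disjoint ((W ∩ I).map (Fin.castAddEmb R.2.n)) (outsideSet (X \ S) R.2) := by
    have hd : Disjoint ((W ∩ I).map (Fin.castAddEmb R.2.n)) (outsideSet (X \ S) R.2) := by
      rw [Finset.disjoint_left]
      intro v hv hv'
      obtain ⟨a, ha, rfl⟩ := Finset.mem_map.1 hv
      have := castAdd_mem_outsideSet.1 hv'
      exact hIXv a (Finset.mem_inter.1 ha).2 (Finset.mem_sdiff.1 this).1
    refine ⟨?_, hd⟩
    rw [isDeletionSet_glueGraph hered union one hd]
    have hl : leftPart ((W ∩ I).map (Fin.castAddEmb R.2.n)) = W ∩ I := by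
      ext v
      rw [mem_leftPart]
      exact Finset.mem_map' (Fin.castAddEmb R.2.n)
    have he : ((I ∪ X) \ S) \ (W ∩ I) = (I ∪ X) \ (W ∩ (I ∪ X)) := by
      ext v
      simp only [hS, Finset.mem_sdiff, Finset.mem_union, Finset.mem_inter]
      tauto
    rw [hl, he, hRW _ Finset.inter_subset_right]
    · convert hW using 1
      ext v
      simp only [Finset.mem_sdiff, Finset.mem_union, Finset.mem_inter]
      tauto
    · ext v
      simp only [hS, Finset.mem_union, Finset.mem_inter]
      tauto
  cases hans : A.ans (glueGraph G ((I ∪ X) \ S) (X \ S) R.2) k l (outsideSet (X \ S) R.2) with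
  | none =>
    -- The set `W ∩ I` has size at most `k`, so the conclusion that no solution of size at most `k`
    -- exists would be false.
    rw [hans] at hcor
    have := hcor _ hZ0.2 hZ0.1
    rw [Finset.card_map] at this
    omega
  | some Z' =>
    rw [hans] at hcor
    obtain ⟨⟨hd, hdel⟩, hmin⟩ := hcor
    have hcard := hmin _ hZ0.2 hZ0.1
    rw [Finset.card_map] at hcard
    have hZ'Y : ∀ v ∈ X \ S, v ∉ leftPart Z' := fun v hv h =>
      Finset.disjoint_left.1 hd (mem_leftPart.1 h) (castAdd_mem_outsideSet.2 hv)
    have h1 : S ∪ I ∩ leftPart Z' ⊆ I ∪ X := by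
      intro v
      have := @hSX v
      simp only [Finset.mem_union, Finset.mem_inter]
      tauto
    have h2 : (S ∪ I ∩ leftPart Z') ∩ X = S := by
      ext v
      have := @hSX v
      have := hIXv v
      simp only [Finset.mem_union, Finset.mem_inter]
      tauto
    refine ⟨S ∪ I ∩ leftPart Z', ?_, h1, h2, ?_, ?_⟩
    · refine List.mem_flatMap.2 ⟨S, mem_subsets hSX, List.mem_flatMap.2 ⟨R, hR, ?_⟩⟩
      unfold answer
      rw [if_pos ⟨hRt, by rw [hans]; rfl⟩, hans]
      exact List.mem_singleton_self _
    · refine le_trans (Finset.card_le_card (t := leftPart Z') ?_) ((card_leftPart_le Z').trans hcard)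
      intro v
      have := @hSX v
      have := hIXv v
      simp only [Finset.mem_union, Finset.mem_inter]
      tauto
    -- A vertex of `leftPart Z'` outside `I` is not in `X \ S` either, hence not in `(I ∪ X) \ S`.
    -- Intersecting with `I` does not change the remaining graph.
    · rw [← hRW _ h1 h2]
      rw [isDeletionSet_glueGraph hered union one hd] at hdel
      convert hdel using 2
      ext v
      have := hZ'Y v
      have := hIXv v
      simp only [Finset.mem_union, Finset.mem_inter, Finset.mem_sdiff] at *
      tauto

end GraphClass

/-! ### Dynamic programming over the tree -/

/-! ### Removing a leaf from a connected set of nodes -/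

namespace SimpleGraph

/-- Retract `s'` onto `s` by sending `t` to its only possible neighbour `p` in `s`. Edges go to
edges or collapse, so walks are carried to walks. -/
theorem Preconnected.induce_of_insert {V : Type} {T : SimpleGraph V} {s s' : Set V} {t p : V}
    (h : (T.induce s').Preconnected) (hs : s ⊆ s') (hs' : ∀ v ∈ s', v ≠ t → v ∈ s)
    (hp : ∀ q ∈ s, T.Adj t q → q = p) : (T.induce s).Preconnected := by
  classical
  intro a b
  -- If `p` is not in `s`, then `t` has no neighbour in `s`, and any vertex of `s` can serve as its
  -- image.
  obtain ⟨p', hp'⟩ : ∃ p' : s, ∀ q ∈ s, T.Adj t q → q = p' := by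
    by_cases hps : p ∈ s
    · exact ⟨⟨p, hps⟩, hp⟩
    · exact ⟨a, fun q hq hadj => absurd (hp q hq hadj ▸ hq) hps⟩
  let r : s' → s := fun x => if hx : x.1 ∈ s then ⟨x.1, hx⟩ else p'
  have hr : ∀ x y : s', (T.induce s').Adj x y → (T.induce s).Reachable (r x) (r y) := by
    intro x y hxy
    have hxy' : T.Adj x.1 y.1 := hxy
    by_cases hx : x.1 ∈ s <;> by_cases hy : y.1 ∈ s
    · simp only [r, dif_pos hx, dif_pos hy]
      exact Adj.reachable hxy'
    · have hyt : y.1 = t := by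
        by_contra h
        exact hy (hs' _ y.2 h)
      rw [hyt] at hxy'
      simp only [r, dif_pos hx, dif_neg hy]
      rw [show (⟨x.1, hx⟩ : s) = p' from Subtype.ext (hp' _ hx hxy'.symm)]
    · have hxt : x.1 = t := by
        by_contra h
        exact hx (hs' _ x.2 h)
      rw [hxt] at hxy'
      simp only [r, dif_neg hx, dif_pos hy]
      rw [show (⟨y.1, hy⟩ : s) = p' from Subtype.ext (hp' _ hy hxy')]
    · simp only [r, dif_neg hx, dif_neg hy]
      exact Reachable.refl _
  have key : ∀ x y : s', (T.induce s').Reachable x y → (T.induce s).Reachable (r x) (r y) := by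
    rintro x y ⟨w⟩
    induction w with
    | nil => exact Reachable.refl _
    | cons hadj _ ih => exact (hr _ _ hadj).trans ih
  have := key ⟨a, hs a.2⟩ ⟨b, hs b.2⟩ (h _ _)
  simpa [r] using this

theorem Preconnected.exists_adj_of_ne {V : Type} {T : SimpleGraph V} {s : Set V} {t u : V}
    (h : (T.induce s).Preconnected) (ht : t ∈ s) (hu : u ∈ s) (hne : t ≠ u) :
    ∃ q ∈ s, T.Adj t q := by
  obtain ⟨w⟩ := h ⟨t, ht⟩ ⟨u, hu⟩
  cases w with
  | nil => exact absurd rfl hne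
  | cons hadj _ => exact ⟨_, Subtype.coe_prop _, hadj⟩

end SimpleGraph

/-- The state of the dynamic program: the nodes that have not been absorbed by a neighbour, and for
each of them the private vertices of the nodes that it has absorbed, and a list of partial solutions. -/
structure DPState (n N : ℕ) where
  alive : Finset (Fin N)
  priv : Fin N → Finset (Fin n)
  fam : Fin N → List (Finset (Fin n))

namespace DPState

variable {n N : ℕ}

/-- `p` is the only living neighbour of `t`. -/
def Removable (T : SimpleGraph (Fin N)) (s : DPState n N) (t p : Fin N) : Prop :=
  t ∈ s.alive ∧ p ∈ s.alive ∧ T.Adj t p ∧ ∀ q, q ∈ s.alive → T.Adj t q → q = p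

/-- The private vertices of `p` after `t` has been absorbed. -/
def merged (X : Fin N → Finset (Fin n)) (s : DPState n N) (t p : Fin N) : Finset (Fin n) :=
  s.priv p ∪ s.priv t ∪ X t \ X p

open scoped Classical in
/-- `p` absorbs `t`. -/
noncomputable def absorb (H : GraphClass) (G : SimpleGraph (Fin n)) (F : List (Σ t : ℕ, FinBGraph t))
    (X : Fin N → Finset (Fin n)) (s : DPState n N) (t p : Fin N) : DPState n N where
  alive := s.alive.erase t
  priv q := if q = p then s.merged X t p else s.priv q
  fam q := if q = p then H.trim G F (s.merged X t p) (X p)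
    (GraphClass.unions (s.fam p) (s.fam t)) else s.fam q

/-- A living node is absorbed by its only living neighbour, if possible. -/
noncomputable def step (H : GraphClass) (G : SimpleGraph (Fin n)) (F : List (Σ t : ℕ, FinBGraph t))
    (T : SimpleGraph (Fin N)) (X : Fin N → Finset (Fin n)) (s : DPState n N) : DPState n N :=
  ((List.finRange N).flatMap fun t => ((List.finRange N).filter fun p =>
    propBit (s.Removable T t p)).map fun p => s.absorb H G F X t p).headD s

variable {H : GraphClass} {G : SimpleGraph (Fin n)} {F : List (Σ t : ℕ, FinBGraph t)}
  {T : SimpleGraph (Fin N)} {X : Fin N → Finset (Fin n)} {s : DPState n N}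

theorem step_eq : (∃ t p, s.Removable T t p ∧ s.step H G F T X = s.absorb H G F X t p) ∨
    (∀ t p, ¬s.Removable T t p) ∧ s.step H G F T X = s := by
  unfold step
  cases h : (List.finRange N).flatMap fun t => ((List.finRange N).filter fun p =>
    propBit (s.Removable T t p)).map fun p => s.absorb H G F X t p with
  | nil =>
    refine Or.inr ⟨fun t p htp => ?_, rfl⟩
    rw [List.flatMap_eq_nil_iff] at h
    have := h t (List.mem_finRange t)
    rw [List.map_eq_nil_iff, List.filter_eq_nil_iff] at this
    exact this p (List.mem_finRange p) (propBit_pos htp)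
  | cons a l =>
    have ha : a ∈ (List.finRange N).flatMap fun t => ((List.finRange N).filter fun p =>
      propBit (s.Removable T t p)).map fun p => s.absorb H G F X t p := by rw [h]; simp
    obtain ⟨t, -, ha⟩ := List.mem_flatMap.1 ha
    obtain ⟨p, hp, rfl⟩ := List.mem_map.1 ha
    exact Or.inl ⟨t, p, propBit_eq_true.1 (List.mem_filter.1 hp).2, rfl⟩

/-- The bags of the living nodes form a tree decomposition, if private vertices are added to them;
the lists of partial solutions suffice. -/
structure Valid (H : GraphClass) (G : SimpleGraph (Fin n)) (T : SimpleGraph (Fin N))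
    (X L : Fin N → Finset (Fin n)) (k : ℕ) (s : DPState n N) : Prop where
  nonempty : s.alive.Nonempty
  connected : (T.induce (s.alive : Set (Fin N))).Preconnected
  disjoint : ∀ t ∈ s.alive, ∀ u ∈ s.alive, t ≠ u → Disjoint (s.priv t) (s.priv u)
  disjoint_bag : ∀ t ∈ s.alive, ∀ u ∈ s.alive, Disjoint (s.priv t) (X u)
  cover : ∀ v, ∃ t ∈ s.alive, v ∈ s.priv t ∪ X t
  edge : ∀ u v, G.Adj u v → ∃ t ∈ s.alive, u ∈ s.priv t ∪ X t ∧ v ∈ s.priv t ∪ X t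
  subtree : ∀ v, (T.induce {t | t ∈ s.alive ∧ v ∈ X t}).Preconnected
  suffices_fam : ∀ t ∈ s.alive, H.Suffices G k L (s.priv t) (X t) (s.fam t)

variable {L : Fin N → Finset (Fin n)} {k l : ℕ}

/-- The living nodes whose bags contain `v` are connected, so a path from `t` to `u` among them must
leave `t` through `p`. -/
theorem Valid.mem_bag_of_mem (h : s.Valid H G T X L k) {t p u : Fin N} (htp : s.Removable T t p)
    (hu : u ∈ s.alive) (hut : u ≠ t) {v : Fin n} (hvt : v ∈ X t) (hvu : v ∈ X u) : v ∈ X p := by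
  obtain ⟨q, hq, hadj⟩ := (h.subtree v).exists_adj_of_ne (t := t) (u := u) ⟨htp.1, hvt⟩ ⟨hu, hvu⟩ hut.symm
  rw [← htp.2.2.2 q hq.1 hadj]
  exact hq.2

/-- The vertices of `X t \ X p` occur in no other living bag by `mem_bag_of_mem`, so they may become
private to `p`. The bag of `t` is then contained in the enlarged bag of `p`, and the connectivity
conditions survive because `t` was a leaf. The new list suffices by `Suffices.unions` and
`Suffices.trim`. -/
theorem Valid.absorb (hered : H.Hereditary) (union : H.UnionClosed)
    (one : H.Mem (⊥ : SimpleGraph Unit)) (hF : H.IsComplete k l F) (hX : ∀ t, (X t).card ≤ k)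
    (h : s.Valid H G T X L k) {t p : Fin N} (htp : s.Removable T t p) :
    (s.absorb H G F X t p).Valid H G T X L k := by
  have hpt : p ≠ t := htp.2.2.1.ne'
  have hp : p ∈ s.alive.erase t := Finset.mem_erase.2 ⟨hpt, htp.2.1⟩
  have hdm : ∀ u ∈ s.alive.erase t, Disjoint (s.merged X t p) (X u) := by
    intro u hu
    have hu' := Finset.mem_erase.1 hu
    rw [merged, Finset.disjoint_union_left, Finset.disjoint_union_left]
    refine ⟨⟨h.disjoint_bag _ htp.2.1 _ hu'.2, h.disjoint_bag _ htp.1 _ hu'.2⟩, ?_⟩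
    rw [Finset.disjoint_left]
    intro v hv hvu
    exact (Finset.mem_sdiff.1 hv).2
      (h.mem_bag_of_mem htp hu'.2 hu'.1 (Finset.mem_sdiff.1 hv).1 hvu)
  have hdp : ∀ u ∈ s.alive.erase t, u ≠ p → Disjoint (s.merged X t p) (s.priv u) := by
    intro u hu hup
    have hu' := Finset.mem_erase.1 hu
    rw [merged, Finset.disjoint_union_left, Finset.disjoint_union_left]
    exact ⟨⟨h.disjoint _ htp.2.1 _ hu'.2 hup.symm, h.disjoint _ htp.1 _ hu'.2 hu'.1.symm⟩,
      Finset.disjoint_of_subset_left Finset.sdiff_subset (h.disjoint_bag _ hu'.2 _ htp.1).symm⟩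
  have hpriv : (s.absorb H G F X t p).priv p = s.merged X t p := if_pos rfl
  have hpriv' : ∀ u, u ≠ p → (s.absorb H G F X t p).priv u = s.priv u := fun u hu => if_neg hu
  have hcov : ∀ t' ∈ s.alive, ∃ u ∈ s.alive.erase t,
      s.priv t' ∪ X t' ⊆ (s.absorb H G F X t p).priv u ∪ X u := by
    intro t' ht'
    by_cases h1 : t' = t ∨ t' = p
    · refine ⟨p, hp, ?_⟩
      rw [hpriv, merged]
      intro v
      rcases h1 with rfl | rfl <;> simp only [Finset.mem_union, Finset.mem_sdiff] <;> tauto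
    · rw [not_or] at h1
      exact ⟨t', Finset.mem_erase.2 ⟨h1.1, ht'⟩, by rw [hpriv' _ h1.2]⟩
  have hed : ∀ u v, G.Adj u v → ∃ t' ∈ s.alive.erase t,
      u ∈ (s.absorb H G F X t p).priv t' ∪ X t' ∧ v ∈ (s.absorb H G F X t p).priv t' ∪ X t' := by
    intro u v huv
    obtain ⟨t', ht', hu, hv⟩ := h.edge u v huv
    obtain ⟨u', hu', hsub⟩ := hcov t' ht'
    exact ⟨u', hu', hsub hu, hsub hv⟩
  have hdis : ∀ u ∈ s.alive.erase t, ∀ w ∈ s.alive.erase t, u ≠ w →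
      Disjoint ((s.absorb H G F X t p).priv u) ((s.absorb H G F X t p).priv w) := by
    intro u hu w hw huw
    by_cases hup : u = p
    · subst hup
      rw [hpriv, hpriv' _ huw.symm]
      exact hdp w hw huw.symm
    · by_cases hwp : w = p
      · subst hwp
        rw [hpriv, hpriv' _ hup]
        exact (hdp u hu hup).symm
      · rw [hpriv' _ hup, hpriv' _ hwp]
        exact h.disjoint _ (Finset.mem_of_mem_erase hu) _ (Finset.mem_of_mem_erase hw) huw
  have hdisb : ∀ u ∈ s.alive.erase t, ∀ w ∈ s.alive.erase t,
      Disjoint ((s.absorb H G F X t p).priv u) (X w) := by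
    intro u hu w hw
    by_cases hup : u = p
    · subst hup
      rw [hpriv]
      exact hdm w hw
    · rw [hpriv' _ hup]
      exact h.disjoint_bag _ (Finset.mem_of_mem_erase hu) _ (Finset.mem_of_mem_erase hw)
  refine ⟨⟨p, hp⟩, ?_, hdis, hdisb, ?_, hed, ?_, ?_⟩
  · refine h.connected.induce_of_insert (t := t) (p := p) ?_ ?_ ?_
    · exact fun v hv => Finset.mem_of_mem_erase hv
    · exact fun v hv hne => Finset.mem_erase.2 ⟨hne, hv⟩
    · exact fun q hq hadj => htp.2.2.2 q (Finset.mem_of_mem_erase hq) hadj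
  · intro v
    obtain ⟨t', ht', hv⟩ := h.cover v
    obtain ⟨u, hu, hsub⟩ := hcov t' ht'
    exact ⟨u, hu, hsub hv⟩
  · intro v
    refine (h.subtree v).induce_of_insert (t := t) (p := p) ?_ ?_ ?_
    · exact fun u hu => ⟨Finset.mem_of_mem_erase hu.1, hu.2⟩
    · exact fun u hu hne => ⟨Finset.mem_erase.2 ⟨hne, hu.1⟩, hu.2⟩
    · exact fun q hq hadj => htp.2.2.2 q (Finset.mem_of_mem_erase hq.1) hadj
  · intro u hu
    by_cases hup : u = p
    · subst hup
      have hfam : (s.absorb H G F X t u).fam u = H.trim G F (s.merged X t u) (X u)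
        (GraphClass.unions (s.fam u) (s.fam t)) := if_pos rfl
      rw [hfam, hpriv]
      refine GraphClass.Suffices.trim hered union one hF ?_ (hX u) (hdm u hu) ?_
      -- The edge lies in the enlarged bag of some living node. As `a` is private to the absorbing
      -- node, it belongs to no other enlarged bag, so `b` lies in this one.
      · intro a ha b hab
        obtain ⟨t', ht', h1, h2⟩ := hed a b hab
        rcases eq_or_ne t' u with rfl | hne
        · rwa [hpriv] at h2
        · rw [hpriv' _ hne] at h1
          rcases Finset.mem_union.1 h1 with h1 | h1
          · exact absurd h1 (Finset.disjoint_left.1 (hdp t' ht' hne) ha)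
          · exact absurd h1 (Finset.disjoint_left.1 (hdm t' ht') ha)
      · exact GraphClass.Suffices.unions (h.disjoint _ htp.2.1 _ htp.1 hpt)
          (h.disjoint_bag _ htp.2.1 _ htp.2.1) (h.disjoint_bag _ htp.2.1 _ htp.1)
          (h.disjoint_bag _ htp.1 _ htp.2.1) (h.disjoint_bag _ htp.1 _ htp.1)
          (h.suffices_fam _ htp.2.1) (h.suffices_fam _ htp.1)
    · have hfam : (s.absorb H G F X t p).fam u = s.fam u := if_neg hup
      rw [hfam, hpriv' _ hup]
      exact h.suffices_fam u (Finset.mem_of_mem_erase hu)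

/-- The living nodes induce a tree, and a finite tree with at least two vertices has a vertex of
degree one. -/
theorem Valid.exists_removable (hT : T.IsAcyclic) (h : s.Valid H G T X L k) (hs : 1 < s.alive.card) :
    ∃ t p, s.Removable T t p := by
  classical
  have : Nonempty (s.alive : Set (Fin N)) := h.nonempty.to_subtype
  have htree : (T.induce (s.alive : Set (Fin N))).IsTree :=
    ⟨(SimpleGraph.connected_iff _).2 ⟨h.connected, this⟩, hT.induce _⟩
  have : Nontrivial (s.alive : Set (Fin N)) :=
    Set.nontrivial_coe_sort.2 (Finset.one_lt_card_iff_nontrivial.1 hs)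
  obtain ⟨t, ht⟩ := htree.exists_vert_degree_one_of_nontrivial
  obtain ⟨p, hp, hq⟩ := SimpleGraph.degree_eq_one_iff_existsUnique_adj.1 ht
  exact ⟨t, p, t.2, p.2, hp, fun q hq1 hq2 => congrArg Subtype.val (hq ⟨q, hq1⟩ hq2)⟩

theorem Valid.step (hered : H.Hereditary) (union : H.UnionClosed)
    (one : H.Mem (⊥ : SimpleGraph Unit)) (hF : H.IsComplete k l F) (hX : ∀ t, (X t).card ≤ k)
    (h : s.Valid H G T X L k) : (s.step H G F T X).Valid H G T X L k := by
  rcases step_eq (H := H) (G := G) (F := F) (T := T) (X := X) (s := s) with ⟨t, p, htp, he⟩ | ⟨-, he⟩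
  · rw [he]
    exact h.absorb hered union one hF hX htp
  · rw [he]
    exact h

theorem Valid.card_step (hT : T.IsAcyclic) (h : s.Valid H G T X L k) :
    (s.step H G F T X).alive.card ≤ max 1 (s.alive.card - 1) := by
  rcases step_eq (H := H) (G := G) (F := F) (T := T) (X := X) (s := s) with ⟨t, p, htp, he⟩ | ⟨hno, he⟩
  · rw [he]
    exact (Finset.card_erase_of_mem htp.1).le.trans (le_max_right _ _)
  · rw [he]
    by_contra hlt
    obtain ⟨t, p, htp⟩ := h.exists_removable hT (by omega)
    exact hno t p htp

theorem Valid.iterate (hered : H.Hereditary) (union : H.UnionClosed)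
    (one : H.Mem (⊥ : SimpleGraph Unit)) (hF : H.IsComplete k l F) (hX : ∀ t, (X t).card ≤ k)
    (hT : T.IsAcyclic) (h : s.Valid H G T X L k) (j : ℕ) :
    ((DPState.step H G F T X)^[j] s).Valid H G T X L k ∧
      ((DPState.step H G F T X)^[j] s).alive.card ≤ max 1 (N - j) := by
  induction j with
  | zero => exact ⟨h, (Finset.card_le_univ _).trans (by simp)⟩
  | succ j ih =>
    rw [Function.iterate_succ_apply']
    refine ⟨ih.1.step hered union one hF hX, (ih.1.card_step hT).trans ?_⟩
    have := ih.2
    omega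

/-- Every newly stored list has been trimmed, so the bound does not deteriorate with the number of
absorptions. -/
theorem length_fam_step {m : ℕ} (hm : ∀ t, 2 ^ (X t).card * F.length ≤ m)
    (h : ∀ t, (s.fam t).length ≤ m) (t : Fin N) : ((s.step H G F T X).fam t).length ≤ m := by
  rcases step_eq (H := H) (G := G) (F := F) (T := T) (X := X) (s := s) with ⟨t', p, -, he⟩ | ⟨-, he⟩
  · rw [he]
    simp only [DPState.absorb]
    split_ifs
    · exact GraphClass.length_trim_le.trans (hm p)
    · exact h t
  · rw [he]
    exact h t

theorem length_fam_iterate {m : ℕ} (hm : ∀ t, 2 ^ (X t).card * F.length ≤ m)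
    (h : ∀ t, (s.fam t).length ≤ m) (j : ℕ) (t : Fin N) :
    (((step H G F T X)^[j] s).fam t).length ≤ m := by
  induction j generalizing t with
  | zero => exact h t
  | succ j ih =>
    rw [Function.iterate_succ_apply']
    exact length_fam_step hm ih t

/-- All solutions listed at the living nodes. -/
noncomputable def solutions (H : GraphClass) (G : SimpleGraph (Fin n)) (s : DPState n N) :
    List (Finset (Fin n)) :=
  ((members s.alive).flatMap s.fam).filter fun Z => propBit (H.Mem (G.mask ((Z : Set (Fin n))ᶜ)))

end DPState

/-! ### Correctness -/

namespace DecompData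

variable {n N : ℕ} {D : DecompData n N} {H : GraphClass} {G : SimpleGraph (Fin n)} {k l : ℕ}
  {F : List (Σ t : ℕ, FinBGraph t)} {f : ℕ → ℕ → ℕ}

/-- The part of a bag outside the base. -/
def outer (D : DecompData n N) (t : Fin N) : Finset (Fin n) := D.bag t \ D.base

/-- The part of a bag in the base. -/
def inner (D : DecompData n N) (t : Fin N) : Finset (Fin n) := D.bag t ∩ D.base

theorem inner_union_outer (t : Fin N) : D.inner t ∪ D.outer t = D.bag t := by
  ext v
  simp only [inner, outer, Finset.mem_union, Finset.mem_inter, Finset.mem_sdiff]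
  tauto

theorem card_outer_le (hk : D.width + 1 = k) (t : Fin N) : (D.outer t).card ≤ k := by
  have : (D.bag t \ D.base).card - 1 ≤ D.width :=
    Finset.le_sup (f := fun t => (D.bag t \ D.base).card - 1) (Finset.mem_univ t)
  unfold outer
  omega

theorem disjoint_inner_outer (t u : Fin N) : Disjoint (D.inner t) (D.outer u) := by
  rw [Finset.disjoint_left]
  intro v h1 h2
  exact (Finset.mem_sdiff.1 h2).2 (Finset.mem_inter.1 h1).2

theorem IsTreeDecomp.disjoint_inner (h : D.IsTreeDecomp H G) {t u : Fin N} (hne : t ≠ u) :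
    Disjoint (D.inner t) (D.inner u) := by
  rw [Finset.disjoint_left]
  intro v h1 h2
  rw [inner, Finset.mem_inter] at h1 h2
  obtain ⟨w, -, hw⟩ := h.base_leaf v h1.2
  exact hne (((hw t).1 h1.1).trans ((hw u).1 h2.1).symm)

/-- A base vertex lies in a single bag, and that bag must contain all edges at the vertex. -/
theorem IsTreeDecomp.neighbor_inner (h : D.IsTreeDecomp H G) (t : Fin N) (u : Fin n)
    (hu : u ∈ D.inner t) (v : Fin n) (huv : G.Adj u v) : v ∈ D.inner t ∪ D.outer t := by
  rw [inner_union_outer]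
  obtain ⟨t', h1, h2⟩ := h.edge u v huv
  rw [inner, Finset.mem_inter] at hu
  obtain ⟨w, -, hw⟩ := h.base_leaf u hu.2
  rwa [(hw t).1 hu.1, ← (hw t').1 h1]

/-- The initial state of the dynamic program. -/
noncomputable def initState (D : DecompData n N) (A : H.DisjointSolver f) (G : SimpleGraph (Fin n))
    (F : List (Σ t : ℕ, FinBGraph t)) (k l : ℕ) : DPState n N where
  alive := Finset.univ
  priv := D.inner
  fam t := A.answers k l G F (D.inner t) (D.outer t)

theorem IsTreeDecomp.valid_initState (h : D.IsTreeDecomp H G) (A : H.DisjointSolver f)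
    (hered : H.Hereditary) (union : H.UnionClosed) (one : H.Mem (⊥ : SimpleGraph Unit))
    (hF : H.IsComplete k l F) (hk : D.width + 1 = k) :
    (D.initState A G F k l).Valid H G D.tree D.outer D.inner k where
  nonempty := ⟨D.root, Finset.mem_univ _⟩
  connected := by
    change (D.tree.induce ((Finset.univ : Finset (Fin N)) : Set (Fin N))).Preconnected
    rw [Finset.coe_univ]
    exact (SimpleGraph.induceUnivIso D.tree).symm.preconnected_iff.1 h.isTree.connected.preconnected
  disjoint t _ u _ hne := h.disjoint_inner hne
  disjoint_bag t _ u _ := disjoint_inner_outer t u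
  cover v := by
    obtain ⟨⟨t, ht⟩⟩ := (h.connected v).nonempty
    exact ⟨t, Finset.mem_univ t, by rw [initState, inner_union_outer]; exact ht⟩
  edge u v huv := by
    obtain ⟨t, h1, h2⟩ := h.edge u v huv
    exact ⟨t, Finset.mem_univ t, by rw [initState, inner_union_outer]; exact ⟨h1, h2⟩⟩
  subtree v := by
    -- A base vertex lies in no `outer` set; for any other vertex, `outer` and `bag` contain it at
    -- the same nodes.
    by_cases hv : v ∈ D.base
    · rintro ⟨t, ht⟩
      exact absurd hv (Finset.mem_sdiff.1 ht.2).2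
    · have : {t | t ∈ (D.initState A G F k l).alive ∧ v ∈ D.outer t} = {t | v ∈ D.bag t} := by
        ext t
        simp [initState, outer, hv]
      rw [this]
      exact (h.connected v).preconnected
  suffices_fam t _ := A.suffices_answers hered union one hF t (h.neighbor_inner t)
    (card_outer_le hk t) (disjoint_inner_outer t t) (h.base_mem t)

theorem _root_.GraphClass.Hereditary.induce_induce (hered : H.Hereditary) {s u : Set (Fin n)} {t : Set s}
    (hu : ∀ (v : Fin n) (hv : v ∈ s), ⟨v, hv⟩ ∈ t → v ∈ u) (h : H.Mem (G.induce u)) :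
    H.Mem ((G.induce s).induce t) :=
  hered.of_embedding (G' := G.induce u) ⟨⟨fun v => ⟨v.1.1, hu v.1.1 v.1.2 v.2⟩, fun _ _ hab =>
    Subtype.ext (Subtype.ext (congrArg (fun z : u => z.1) hab))⟩, Iff.rfl⟩ h

/-- If an optimal `W` had more than `k` vertices in `D.inner t`, exchanging them for `D.outer t`
would give a smaller set. It would still be a deletion set: the inner part is separated from the
rest and is in `H`, the rest is a subgraph of `G - W`, and `H` is closed under disjoint unions. -/
theorem IsTreeDecomp.card_inter_inner_le (h : D.IsTreeDecomp H G) (hered : H.Hereditary)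
    (union : H.UnionClosed) (hk : D.width + 1 = k) {W : Finset (Fin n)} (hW : H.IsMinDeletionSet G W)
    (t : Fin N) : (W ∩ D.inner t).card ≤ k := by
  by_contra hlt
  have hX := card_outer_le hk t
  have hdel : H.IsDeletionSet G (W \ D.inner t ∪ D.outer t) := by
    unfold GraphClass.IsDeletionSet
    refine union.of_split {v | v.1 ∈ D.inner t} ?_ ?_ ?_
    · exact hered.induce_induce (fun v _ hv => hv) (h.base_mem t)
    · refine hered.induce_induce (fun v hv hv' => ?_) hW.1
      intro hvW
      refine hv ?_
      rw [Finset.mem_coe]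
      exact Finset.mem_union_left _ (Finset.mem_sdiff.2 ⟨hvW, hv'⟩)
    · intro u hu v hv huv
      have h1 := h.neighbor_inner t u.1 hu v.1 huv
      rcases Finset.mem_union.1 h1 with h1 | h1
      · exact hv h1
      · exact v.2 (Finset.mem_coe.2 (Finset.mem_union_right _ h1))
  have h1 := hW.2 _ hdel
  have h2 := Finset.card_union_le (W \ D.inner t) (D.outer t)
  have h3 := Finset.card_inter_add_card_sdiff W (D.inner t)
  omega

theorem _root_.GraphClass.exists_isMinDeletionSet (h : ∃ S : Finset (Fin n), H.IsDeletionSet G S) :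
    ∃ S, H.IsMinDeletionSet G S := by
  classical
  obtain ⟨S, hS, hmin⟩ := (Finset.univ.filter fun S => H.IsDeletionSet G S).exists_min_image
    Finset.card (by obtain ⟨S, hS⟩ := h; exact ⟨S, by simpa using hS⟩)
  exact ⟨S, by simpa using hS, fun S' hS' => hmin S' (by simpa using hS')⟩

/-- The output of the dynamic program. -/
noncomputable def output (D : DecompData n N) (A : H.DisjointSolver f) (G : SimpleGraph (Fin n))
    (F : List (Σ t : ℕ, FinBGraph t)) (k l : ℕ) : Finset (Fin n) :=
  (smallest (((DPState.step H G F D.tree D.outer)^[N] (D.initState A G F k l)).solutions H G)).headD ∅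

/-- After `N` passes one node is alive, and its private vertices together with its bag exhaust the
graph. For an optimal `W`, which obeys the bounds `k` on the inner parts, sufficiency yields a
listed deletion set that is no larger than `W`. -/
theorem IsTreeDecomp.isMinDeletionSet_output (h : D.IsTreeDecomp H G) (A : H.DisjointSolver f)
    (hered : H.Hereditary) (union : H.UnionClosed) (one : H.Mem (⊥ : SimpleGraph Unit))
    (hF : H.IsComplete k l F) (hk : D.width + 1 = k) :
    H.IsMinDeletionSet G (D.output A G F k l) := by
  obtain ⟨hv, hcard⟩ := (h.valid_initState A hered union one hF hk).iterate hered union one hF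
    (card_outer_le hk) h.isTree.isAcyclic N
  unfold output
  set s := (DPState.step H G F D.tree D.outer)^[N] (D.initState A G F k l)
  have hcard1 : s.alive.card = 1 :=
    le_antisymm (by omega) (Finset.card_pos.2 hv.nonempty)
  obtain ⟨t, ht⟩ := Finset.card_eq_one.1 hcard1
  have htm : t ∈ s.alive := by rw [ht]; exact Finset.mem_singleton_self t
  have hall : s.priv t ∪ D.outer t = Finset.univ := by
    ext v
    obtain ⟨u, hu, hvu⟩ := hv.cover v
    rw [ht, Finset.mem_singleton] at hu
    simpa [hu] using hvu
  have huniv : H.IsDeletionSet G Finset.univ :=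
    hered.of_embedding (G' := G.induce ((D.bag t ∩ D.base : Finset (Fin n)) : Set (Fin n)))
      ⟨⟨fun v => absurd (Finset.mem_coe.2 (Finset.mem_univ v.1)) v.2,
        fun v => absurd (Finset.mem_coe.2 (Finset.mem_univ v.1)) v.2⟩,
        fun {v} => absurd (Finset.mem_coe.2 (Finset.mem_univ v.1)) v.2⟩ (h.base_mem t)
  obtain ⟨W, hW⟩ := GraphClass.exists_isMinDeletionSet ⟨_, huniv⟩
  obtain ⟨Z, hZ, hZ1, hZ2, hZ3, hZ4⟩ := hv.suffices_fam t htm W hW.1 fun u =>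
    (Finset.card_le_card (Finset.inter_subset_inter_right Finset.inter_subset_left)).trans
      (h.card_inter_inner_le hered union hk hW u)
  have hdel : ∀ Z : Finset (Fin n), H.Mem (G.mask ((Z : Set (Fin n))ᶜ)) ↔ H.IsDeletionSet G Z :=
    fun Z => GraphClass.mem_mask_iff hered union one _ _
  have hWZ : W \ Finset.univ ∪ Z = Z := by ext; simp
  rw [hall, hWZ] at hZ4
  have hZs : Z ∈ s.solutions H G :=
    List.mem_filter.2 ⟨List.mem_flatMap.2 ⟨t, mem_members.2 htm, hZ⟩, propBit_pos ((hdel Z).2 hZ4)⟩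
  obtain ⟨Z', hZ'⟩ := exists_mem_smallest hZs
  cases hl : smallest (s.solutions H G) with
  | nil => rw [hl] at hZ'; simp at hZ'
  | cons a l =>
    obtain ⟨ha1, ha2⟩ := mem_of_mem_smallest (l := s.solutions H G) (Z := a) (by rw [hl]; simp)
    refine ⟨(hdel a).1 (propBit_eq_true.1 (List.mem_filter.1 ha1).2), fun S' hS' => ?_⟩
    have h1 : a.card ≤ Z.card := ha2 Z hZs
    have h2 : Z.card ≤ W.card := by
      have hd := hv.disjoint_bag t htm t htm
      rw [GraphClass.card_eq_of_subset_union hd hZ1, GraphClass.card_eq_of_subset_union hd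
        (Z := W) (by rw [hall]; exact Finset.subset_univ _), hZ2]
      omega
    exact h1.trans (h2.trans (hW.2 S' hS'))

end DecompData

/-! ### Computing with lists of sets and glued graphs -/

namespace Comp

open Val (ofList ofBool ofNat ofSet ofGraph ofFinBGraph ofOptionSet)

variable {ι : Type} {B : ι → ℕ × ℕ} {e : ι → Val} {n : ι → ℕ}
  {α β : ι → Type} {l : ∀ i, List (α i)} {enc : ∀ i, α i → Val} {enc' : ∀ i, β i → Val}

theorem subApply {op : ∀ i, α i → β i → β i} {b : ∀ i, β i} (hn : PolyBdd B fun i => (l i).length)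
    (hn2 : PolyBdd B fun i => 2 ^ (l i).length)
    (hl : Comp B e fun i => ofList ((l i).map (enc i))) (hb : Comp B e fun i => enc' i (b i))
    (hop : Comp (fun p : Σ i, α i × β i => B p.1)
      (fun p => .pair (e p.1) (.pair (enc p.1 p.2.1) (enc' p.1 p.2.2)))
      fun p => enc' p.1 (op p.1 p.2.1 p.2.2)) :
    Comp B e fun i => ofList ((_root_.subApply (op i) (l i) (b i)).map (enc' i)) := by
  let st : ∀ i, ℕ → List (β i) := fun i j => _root_.subApply (op i) ((l i).take j) (b i)
  have hlen : ∀ i j, j ≤ (l i).length → (st i j).length ≤ 2 ^ (l i).length := fun i j hj => by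
    simp only [st, length_subApply, List.length_take]
    exact Nat.pow_le_pow_right (by omega) (by omega)
  refine fold_list (l := fun i => (l i).map (enc i)) (fun i j => ofList ((st i j).map (enc' i)))
    (hn.mono fun i => by simp) hl ((hb.pair nil).congr fun i => rfl) ?_ fun i => by
      simp only [st, List.length_map, List.take_length]
  have hlt : ∀ p : Σ i, Fin ((l i).map (enc i)).length, p.2.1 < (l p.1).length := fun p => by
    simpa using p.2.2
  have hbd : PolyBdd (fun p : Σ i, Fin ((l i).map (enc i)).length => B p.1)
      fun p => (st p.1 p.2).length := hn2.up.mono fun p => hlen _ _ (hlt p).le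
  have hmap := map (B := fun p : Σ i, Fin ((l i).map (enc i)).length => B p.1)
    (e := fun p => .pair (e p.1) (.pair (((l p.1).map (enc p.1)).get p.2)
      (ofList ((st p.1 p.2).map (enc' p.1)))))
    (L := fun p => st p.1 p.2) (enc := fun p => enc' p.1)
    (g := fun p x => enc' p.1 (op p.1 ((l p.1)[p.2.1]'(hlt p)) x)) hbd refl.snd.snd
    (Comp.trans (refl.fst.fst.pair ((refl.fst.snd.fst.congr fun p => by simp).pair refl.snd))
      (hop.comap fun p : Σ p : (Σ i, Fin ((l i).map (enc i)).length), {x // x ∈ st p.1 p.2} =>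
        ⟨p.1.1, (l p.1.1)[p.1.2.1]'(hlt p.1), p.2.1⟩))
  refine (append (by simpa using hbd) refl.snd.snd hmap).congr fun p => ?_
  simp only [st, _root_.subApply]
  rw [List.take_succ_eq_append_getElem (hlt p), List.foldl_append]
  simp [Function.comp_def]

section sets

variable {S T : ∀ i, Finset (Fin (n i))}

theorem union (hn : CompNum B e n) (hS : Comp B e fun i => ofSet (S i))
    (hT : Comp B e fun i => ofSet (T i)) : Comp B e fun i => ofSet (S i ∪ T i) :=
  set_of (fun i v => v ∈ S i ∨ v ∈ T i) hn ((mem_set hS.upF hn.var).or (mem_set hT.upF hn.var))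
    fun _ _ => Finset.mem_union

theorem inter (hn : CompNum B e n) (hS : Comp B e fun i => ofSet (S i))
    (hT : Comp B e fun i => ofSet (T i)) : Comp B e fun i => ofSet (S i ∩ T i) :=
  set_of (fun i v => v ∈ S i ∧ v ∈ T i) hn ((mem_set hS.upF hn.var).and (mem_set hT.upF hn.var))
    fun _ _ => Finset.mem_inter

theorem sdiff (hn : CompNum B e n) (hS : Comp B e fun i => ofSet (S i))
    (hT : Comp B e fun i => ofSet (T i)) : Comp B e fun i => ofSet (S i \ T i) :=
  set_of (fun i v => v ∈ S i ∧ v ∉ T i) hn ((mem_set hS.upF hn.var).and (mem_set hT.upF hn.var).not)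
    fun _ _ => Finset.mem_sdiff

theorem subset (hn : CompNum B e n) (hS : Comp B e fun i => ofSet (S i))
    (hT : Comp B e fun i => ofSet (T i)) : CompProp B e fun i => S i ⊆ T i :=
  CompNum.forall_fin (P := fun i v => v ∈ S i → v ∈ T i) hn
    ((mem_set hS.upF hn.var).imp (mem_set hT.upF hn.var))

theorem set_eq (hn : CompNum B e n) (hS : Comp B e fun i => ofSet (S i))
    (hT : Comp B e fun i => ofSet (T i)) : CompProp B e fun i => S i = T i :=
  ((subset hn hS hT).and (subset hn hT hS)).prop_congr fun _ => Finset.Subset.antisymm_iff.symm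

theorem mask {G : ∀ i, SimpleGraph (Fin (n i))} (hn : CompNum B e n)
    (hG : Comp B e fun i => ofGraph (G i)) (hS : Comp B e fun i => ofSet (S i)) :
    Comp B e fun i => ofGraph ((G i).mask ((S i : Set (Fin (n i)))ᶜ)) :=
  graph_of (fun i u v => (G i).Adj u v ∧ u ∉ S i ∧ v ∉ S i) hn (by
    refine Comp.and ?_ (Comp.and ?_ ?_)
    · exact adj hG.upF.upF hn.var.upF hn.upF.var
    · exact (mem_set hS.upF hn.var).upF.not
    · exact (mem_set hS.upF.upF hn.upF.var).not) fun _ _ _ => Iff.rfl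

theorem members (hn : CompNum B e n) (hS : Comp B e fun i => ofSet (S i)) :
    Comp B e fun i => ofList ((_root_.members (S i)).map fun v : Fin (n i) => ofNat (v : ℕ)) :=
  filter (P := fun i v => v ∈ S i) (hn.bdd.mono fun i => by simp) hn.finRange
    (mem_set (v := fun p : Σ i, {x : Fin (n i) // x ∈ List.finRange (n i)} => p.2.1) hS.up
      ⟨.var, hn.bdd.up.mono fun p => p.2.1.2.le⟩)

theorem subsets (hn : CompNum B e n) (hS : Comp B e fun i => ofSet (S i))
    (h2 : PolyBdd B fun i => 2 ^ (S i).card) :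
    Comp B e fun i => ofList ((_root_.subsets (S i)).map ofSet) := by
  refine subApply (op := fun i => insert) (b := fun i => (∅ : Finset (Fin (n i))))
    (enc' := fun i => ofSet) (hn.bdd.mono fun i => ?_) (h2.mono fun i => ?_) (members hn hS)
    (set_of (fun _ _ => False) hn false_ (by simp)) ?_
  · rw [length_members]
    simpa using Finset.card_le_univ (S i)
  · rw [length_members]
  · have hn' : CompNum (fun p : Σ i, Fin (n i) × Finset (Fin (n i)) => B p.1)
        (fun p => .pair (e p.1) (.pair (ofNat p.2.1) (ofSet p.2.2))) fun p => n p.1 := hn.up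
    have ha : CompNum (fun p : Σ i, Fin (n i) × Finset (Fin (n i)) => B p.1)
        (fun p => .pair (e p.1) (.pair (ofNat p.2.1) (ofSet p.2.2))) fun p => (p.2.1 : ℕ) :=
      ⟨refl.snd.fst, hn.bdd.up.mono fun p => p.2.1.2.le⟩
    have hb : Comp (fun p : Σ i, Fin (n i) × Finset (Fin (n i)) => B p.1)
        (fun p => .pair (e p.1) (.pair (ofNat p.2.1) (ofSet p.2.2))) fun p => ofSet p.2.2 :=
      refl.snd.snd
    exact set_of (n := fun p : Σ i, Fin (n i) × Finset (Fin (n i)) => n p.1)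
      (fun p v => v = p.2.1 ∨ v ∈ p.2.2) hn' ((hn'.var.fin_eq ha.upF).or (mem_set hb.upF hn'.var))
      (by simp)

end sets

section setLists

variable {Zs Zs' : ∀ i, List (Finset (Fin (n i)))}

theorem smallest (hn : CompNum B e n) (hZ : Comp B e fun i => ofList ((Zs i).map ofSet))
    (hb : PolyBdd B fun i => (Zs i).length) :
    Comp B e fun i => ofList ((_root_.smallest (Zs i)).map ofSet) := by
  refine take_one (enc := fun i => ofSet) (filter
    (P := fun i (Z : Finset (Fin (n i))) => ∀ Z' ∈ Zs i, Z.card ≤ Z'.card) hb hZ ?_)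
  refine forall_mem (P := fun (p : Σ i, {x // x ∈ Zs i}) Z' => p.2.1.card ≤ Z'.card) hb.up
    (hZ.upL fun i => ofSet) ?_
  have h1 := (hn.upL (L := Zs) fun i => ofSet)
  refine CompNum.le ((card_set h1 var).upL (L := fun p : Σ i, {x // x ∈ Zs i} => Zs p.1) fun p => ofSet)
    (card_set (h1.upL fun p => ofSet) refl.snd)

theorem unions (hn : CompNum B e n) (hZ : Comp B e fun i => ofList ((Zs i).map ofSet))
    (hb : PolyBdd B fun i => (Zs i).length) (hZ' : Comp B e fun i => ofList ((Zs' i).map ofSet))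
    (hb' : PolyBdd B fun i => (Zs' i).length) :
    Comp B e fun i => ofList ((GraphClass.unions (Zs i) (Zs' i)).map ofSet) := by
  refine flatMap (enc' := fun i => ofSet) (m := fun i => (Zs' i).length) hb hb'
    (fun i Z _ => by simp) hZ ?_
  have h1 := hn.upL (L := Zs) fun i => ofSet
  have h2 : Comp (fun p : Σ i, {x // x ∈ Zs i} => B p.1) (fun p => .pair (e p.1) (ofSet p.2.1))
      fun p => ofSet p.2.1 := var
  have h3 := map (L := fun p : Σ i, {x // x ∈ Zs i} => Zs' p.1) (g := fun p Z => ofSet (p.2.1 ∪ Z))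
    (B := fun p => B p.1) (enc := fun p => ofSet) hb'.up (hZ'.upL (L := Zs) fun i => ofSet)
    (union (h1.upL fun p => ofSet) (h2.upL fun p => ofSet) refl.snd)
  exact h3.congr fun p => by simp [Function.comp_def]

end setLists

/-! ### Programs for boundaried and glued graphs -/

section FinBGraph

variable {R : ι → Σ t : ℕ, FinBGraph t}

theorem finBGraph_graph (hR : Comp B e fun i => ofFinBGraph (R i).2) :
    Comp B e fun i => ofGraph (R i).2.graph := fst hR

theorem finBGraph_n (hR : Comp B e fun i => ofFinBGraph (R i).2) (hb : PolyBdd B fun i => (R i).2.n) :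
    CompNum B e fun i => (R i).2.n := (finBGraph_graph hR).order hb

theorem _root_.FinBGraph.le_n {t : ℕ} (R : FinBGraph t) : t ≤ R.n := by
  simpa using Fintype.card_le_of_embedding R.bd

theorem finBGraph_t (hR : Comp B e fun i => ofFinBGraph (R i).2) (hb : PolyBdd B fun i => (R i).2.n) :
    CompNum B e fun i => (R i).1 :=
  (CompNum.length (L := fun i => List.ofFn fun j => ofNat ((R i).2.bd j : ℕ)) (enc := fun _ x => x)
    ((snd hR).congr fun i => by rw [List.map_id']) (hb.mono fun i => by
      simpa using (R i).2.le_n)).congr fun i => by simp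

theorem finBGraph_bd {j : ∀ i, Fin (R i).1} (hR : Comp B e fun i => ofFinBGraph (R i).2)
    (hb : PolyBdd B fun i => (R i).2.n) (hj : CompNum B e fun i => (j i : ℕ)) :
    CompNum B e fun i => ((R i).2.bd (j i) : ℕ) :=
  ⟨lookup (g := fun i j => ofNat ((R i).2.bd j : ℕ)) (snd hR) hj,
    hb.mono fun i => ((R i).2.bd (j i)).2.le⟩

theorem isNth {Y : ∀ i, Finset (Fin (n i))} {u : ∀ i, Fin (n i)} {j : ι → ℕ} (hn : CompNum B e n)
    (hY : Comp B e fun i => ofSet (Y i)) (hu : CompNum B e fun i => (u i : ℕ)) (hj : CompNum B e j) :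
    CompProp B e fun i => IsNth (Y i) (u i) (j i) := by
  refine (mem_set hY hu).and (CompNum.eq (card_set (n := n) hn ?_) hj)
  refine set_of (fun i v => v ∈ Y i ∧ (v : ℕ) < u i) hn ?_ fun i v => by simp
  exact (mem_set hY.upF hn.var).and (hn.var.lt hu.upF)

theorem not_bd {w : ∀ i, Fin (R i).2.n} (hR : Comp B e fun i => ofFinBGraph (R i).2)
    (hb : PolyBdd B fun i => (R i).2.n) (hw : CompNum B e fun i => (w i : ℕ)) :
    CompProp B e fun i => ∀ j, (R i).2.bd j ≠ w i :=
  CompNum.forall_fin (P := fun i j => (R i).2.bd j ≠ w i) (finBGraph_t hR hb)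
    ((finBGraph_bd hR.upF hb.up (finBGraph_t hR hb).var).fin_eq hw.upF).not

variable {G : ∀ i, SimpleGraph (Fin (n i))} {S Y : ∀ i, Finset (Fin (n i))}

theorem exists_bd_adj {u : ∀ i, Fin (n i)} {w : ∀ i, Fin (R i).2.n} (hn : CompNum B e n)
    (hY : Comp B e fun i => ofSet (Y i)) (hR : Comp B e fun i => ofFinBGraph (R i).2)
    (hb : PolyBdd B fun i => (R i).2.n) (hu : CompNum B e fun i => (u i : ℕ))
    (hw : CompNum B e fun i => (w i : ℕ)) :
    CompProp B e fun i => (∀ j, (R i).2.bd j ≠ w i) ∧ ∃ j : Fin (R i).1, IsNth (Y i) (u i) j ∧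
      (R i).2.graph.Adj ((R i).2.bd j) (w i) := by
  refine (not_bd hR hb hw).and (CompNum.exists_fin (P := fun i j => IsNth (Y i) (u i) j ∧
    (R i).2.graph.Adj ((R i).2.bd j) (w i)) (finBGraph_t hR hb) ?_)
  have ht := (finBGraph_t hR hb).var
  exact (isNth hn.upF hY.upF hu.upF ht).and
    (adj (finBGraph_graph hR).upF (finBGraph_bd hR.upF hb.up ht) hw.upF)

theorem glueGraph (hn : CompNum B e n) (hG : Comp B e fun i => ofGraph (G i))
    (hS : Comp B e fun i => ofSet (S i)) (hY : Comp B e fun i => ofSet (Y i))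
    (hR : Comp B e fun i => ofFinBGraph (R i).2) (hb : PolyBdd B fun i => (R i).2.n) :
    Comp B e fun i => ofGraph (_root_.glueGraph (G i) (S i) (Y i) (R i).2) := by
  have hm := finBGraph_n hR hb
  have hN := hn.add hm
  have hu := hN.var.upF (n := fun p => n p.1 + (R p.1).2.n)
  have hv := (hN.upF (n := fun i => n i + (R i).2.n)).var
  have hn2 := (hn.upF (n := fun i => n i + (R i).2.n)).upF (n := fun p => n p.1 + (R p.1).2.n)
  have hm2 := (hm.upF (n := fun i => n i + (R i).2.n)).upF (n := fun p => n p.1 + (R p.1).2.n)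
  refine graph_of (fun i u v => (_root_.glueGraph (G i) (S i) (Y i) (R i).2).Adj u v) hN ?_
    fun _ _ _ => Iff.rfl
  refine Comp.or ?_ (Comp.or ?_ (Comp.or ?_ ?_))
  · refine CompNum.exists_fin (P := fun (p : Σ p : (Σ i, Fin (n i + (R i).2.n)), Fin (n p.1 + (R p.1).2.n))
      a => ∃ b, p.1.2 = Fin.castAdd (R p.1.1).2.n a ∧ p.2 = Fin.castAdd (R p.1.1).2.n b ∧
      a ∈ S p.1.1 ∧ b ∈ S p.1.1 ∧ (G p.1.1).Adj a b) hn2 ?_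
    refine CompNum.exists_fin hn2.upF ?_
    refine Comp.and ?_ (Comp.and ?_ (Comp.and ?_ (Comp.and ?_ ?_)))
    · exact hu.upF.upF.fin_eq hn2.var.upF
    · exact hv.upF.upF.fin_eq hn2.upF.var
    · exact mem_set hS.upF.upF.upF.upF hn2.var.upF
    · exact mem_set hS.upF.upF.upF.upF hn2.upF.var
    · exact adj hG.upF.upF.upF.upF hn2.var.upF hn2.upF.var
  · refine CompNum.exists_fin (P := fun (p : Σ p : (Σ i, Fin (n i + (R i).2.n)), Fin (n p.1 + (R p.1).2.n))
      w => ∃ w', p.1.2 = Fin.natAdd (n p.1.1) w ∧ p.2 = Fin.natAdd (n p.1.1) w' ∧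
      (∀ i, (R p.1.1).2.bd i ≠ w) ∧ (∀ i, (R p.1.1).2.bd i ≠ w') ∧ (R p.1.1).2.graph.Adj w w') hm2 ?_
    refine CompNum.exists_fin hm2.upF ?_
    refine Comp.and ?_ (Comp.and ?_ (Comp.and ?_ (Comp.and ?_ ?_)))
    · exact hu.upF.upF.fin_eq (hn2.upF.upF.add hm2.var.upF)
    · exact hv.upF.upF.fin_eq (hn2.upF.upF.add hm2.upF.var)
    · exact not_bd hR.upF.upF.upF.upF hb.up.up.up.up hm2.var.upF
    · exact not_bd hR.upF.upF.upF.upF hb.up.up.up.up hm2.upF.var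
    · exact adj (finBGraph_graph hR).upF.upF.upF.upF hm2.var.upF hm2.upF.var
  · refine CompNum.exists_fin (P := fun (p : Σ p : (Σ i, Fin (n i + (R i).2.n)), Fin (n p.1 + (R p.1).2.n))
      a => ∃ w, p.1.2 = Fin.castAdd (R p.1.1).2.n a ∧ p.2 = Fin.natAdd (n p.1.1) w ∧
      (∀ i, (R p.1.1).2.bd i ≠ w) ∧ ∃ i : Fin (R p.1.1).1, IsNth (Y p.1.1) a i ∧
      (R p.1.1).2.graph.Adj ((R p.1.1).2.bd i) w) hn2 ?_
    refine CompNum.exists_fin hm2.upF ?_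
    refine Comp.and ?_ (Comp.and ?_ ?_)
    · exact hu.upF.upF.fin_eq hn2.var.upF
    · exact hv.upF.upF.fin_eq (hn2.upF.upF.add hm2.upF.var)
    · exact exists_bd_adj hn2.upF.upF hY.upF.upF.upF.upF hR.upF.upF.upF.upF hb.up.up.up.up
        hn2.var.upF hm2.upF.var
  · refine CompNum.exists_fin (P := fun (p : Σ p : (Σ i, Fin (n i + (R i).2.n)), Fin (n p.1 + (R p.1).2.n))
      a => ∃ w, p.2 = Fin.castAdd (R p.1.1).2.n a ∧ p.1.2 = Fin.natAdd (n p.1.1) w ∧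
      (∀ i, (R p.1.1).2.bd i ≠ w) ∧ ∃ i : Fin (R p.1.1).1, IsNth (Y p.1.1) a i ∧
      (R p.1.1).2.graph.Adj ((R p.1.1).2.bd i) w) hn2 ?_
    refine CompNum.exists_fin hm2.upF ?_
    refine Comp.and ?_ (Comp.and ?_ ?_)
    · exact hv.upF.upF.fin_eq hn2.var.upF
    · exact hu.upF.upF.fin_eq (hn2.upF.upF.add hm2.upF.var)
    · exact exists_bd_adj hn2.upF.upF hY.upF.upF.upF.upF hR.upF.upF.upF.upF hb.up.up.up.up
        hn2.var.upF hm2.upF.var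

theorem outsideSet (hn : CompNum B e n) (hY : Comp B e fun i => ofSet (Y i))
    (hR : Comp B e fun i => ofFinBGraph (R i).2) (hb : PolyBdd B fun i => (R i).2.n) :
    Comp B e fun i => ofSet (GraphClass.outsideSet (Y i) (R i).2) := by
  have hm := finBGraph_n hR hb
  have hN := hn.add hm
  refine set_of (n := fun i => n i + (R i).2.n) (fun i u => (∃ a, u = Fin.castAdd (R i).2.n a ∧ a ∈ Y i) ∨
    ∃ w, u = Fin.natAdd (n i) w ∧ ∀ j, (R i).2.bd j ≠ w) hN (Comp.or ?_ ?_) ?_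
  · refine CompNum.exists_fin hn.upF (Comp.and ?_ ?_)
    · exact hN.var.upF.fin_eq hn.upF.var
    · exact mem_set hY.upF.upF hn.upF.var
  · refine CompNum.exists_fin hm.upF (Comp.and ?_ ?_)
    · exact hN.var.upF.fin_eq (hn.upF.upF.add hm.upF.var)
    · exact not_bd hR.upF.upF hb.up.up hm.upF.var
  · intro i u
    induction u using Fin.addCases with
    | left a =>
      rw [GraphClass.castAdd_mem_outsideSet]
      simp [castAdd_ne_natAdd]
    | right w =>
      rw [GraphClass.natAdd_mem_outsideSet]
      simp [(castAdd_ne_natAdd _ _).symm]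

end FinBGraph

end Comp

/-! ### Computing the dynamic program -/

namespace GraphClass.DisjointSolver

open Val (ofList ofBool ofNat ofSet ofGraph ofFinBGraph ofOptionSet ofFamily)

variable {H : GraphClass} {f : ℕ → ℕ → ℕ} {ι : Type} {B : ι → ℕ × ℕ} {e : ι → Val} {n : ι → ℕ}
  {G : ∀ i, SimpleGraph (Fin (n i))} {I X S : ∀ i, Finset (Fin (n i))}
  {Zs : ∀ i, List (Finset (Fin (n i)))} {R : ι → Σ t : ℕ, FinBGraph t}
  {F : ι → List (Σ t : ℕ, FinBGraph t)}

theorem comp_solving (A : H.DisjointSolver f) (hered : H.Hereditary) (union : H.UnionClosed)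
    (one : H.Mem (⊥ : SimpleGraph Unit)) (hn : CompNum B e n) (hG : Comp B e fun i => ofGraph (G i))
    (hI : Comp B e fun i => ofSet (I i)) (hX : Comp B e fun i => ofSet (X i))
    (hZ : Comp B e fun i => ofList ((Zs i).map ofSet)) (hZb : PolyBdd B fun i => (Zs i).length)
    (hS : Comp B e fun i => ofSet (S i)) (hR : Comp B e fun i => ofFinBGraph (R i).2)
    (hb : PolyBdd B fun i => (R i).2.n) :
    Comp B e fun i => ofList ((H.solving (G i) (I i) (X i) (Zs i) (S i) (R i)).map ofSet) := by
  refine Comp.filter (enc := fun i => ofSet) (P := fun i Z => Z ⊆ I i ∪ X i ∧ Z ∩ X i = S i ∧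
    (R i).1 = (X i \ S i).card ∧ H.Mem (_root_.glueGraph (G i) ((I i ∪ X i) \ Z) (X i \ S i) (R i).2))
    hZb hZ ?_
  have hn' := hn.upL (L := Zs) fun i => ofSet
  have hI' := hI.upL (L := Zs) fun i => ofSet
  have hX' := hX.upL (L := Zs) fun i => ofSet
  have hS' := hS.upL (L := Zs) fun i => ofSet
  have hR' := hR.upL (L := Zs) fun i => ofSet
  have hZ' : Comp (fun p : Σ i, {x // x ∈ Zs i} => B p.1) (fun p => .pair (e p.1) (ofSet p.2.1))
    fun p => ofSet p.2.1 := .var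
  have hY' := hX'.sdiff hn' hS'
  refine Comp.and ?_ (Comp.and ?_ (Comp.and ?_ ?_))
  · exact hZ'.subset hn' (hI'.union hn' hX')
  · exact (hZ'.inter hn' hX').set_eq hn' hS'
  · exact (Comp.finBGraph_t hR' hb.up).eq (Comp.card_set hn' hY')
  · exact A.comp_mem hered union one
      (Comp.glueGraph hn' (hG.upL (L := Zs) fun i => ofSet) ((hI'.union hn' hX').sdiff hn' hZ') hY' hR'
        hb.up) (hn.bdd.add hb).up

theorem comp_trim (A : H.DisjointSolver f) (hered : H.Hereditary) (union : H.UnionClosed)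
    (one : H.Mem (⊥ : SimpleGraph Unit)) (hn : CompNum B e n) (hG : Comp B e fun i => ofGraph (G i))
    (hF : Comp B e fun i => ofFamily (F i)) (hFb : PolyBdd B fun i => (F i).length) {m : ι → ℕ}
    (hm : PolyBdd B m) (hFm : ∀ i, ∀ R ∈ F i, R.2.n ≤ m i)
    (hI : Comp B e fun i => ofSet (I i)) (hX : Comp B e fun i => ofSet (X i))
    (hX2 : PolyBdd B fun i => 2 ^ (X i).card)
    (hZ : Comp B e fun i => ofList ((Zs i).map ofSet)) (hZb : PolyBdd B fun i => (Zs i).length) :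
    Comp B e fun i => ofList ((H.trim (G i) (F i) (I i) (X i) (Zs i)).map ofSet) := by
  refine Comp.flatMap (enc := fun i => ofSet) (enc' := fun i => ofSet) (L := fun i => subsets (X i))
    (F := fun i S => (F i).flatMap fun R => smallest (H.solving (G i) (I i) (X i) (Zs i) S R))
    (m := fun i => (F i).length) (hX2.mono fun i => (length_subsets _).le) hFb (fun i S _ => ?_)
    (Comp.subsets hn hX hX2) ?_
  · simpa using length_flatMap_le (l := F i) fun R _ =>
      length_smallest_le (H.solving (G i) (I i) (X i) (Zs i) S R)
  refine Comp.flatMap (B := fun p : Σ i, {x // x ∈ subsets (X i)} => B p.1) (L := fun p => F p.1)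
    (enc := fun p R => ofFinBGraph R.2) (enc' := fun p => ofSet) (m := fun _ => 1) hFb.up (.const 1)
    (F := fun p R => smallest (H.solving (G p.1) (I p.1) (X p.1) (Zs p.1) p.2.1 R))
    (fun p R _ => length_smallest_le _) (hF.upL (L := fun i => subsets (X i)) fun i => ofSet) ?_
  have up : ∀ {a : ι → Val}, Comp B e a → Comp
      (fun p : Σ p : (Σ i, {x // x ∈ subsets (X i)}), {x // x ∈ F p.1} => B p.1.1)
      (fun p => .pair (.pair (e p.1.1) (ofSet p.1.2.1)) (ofFinBGraph p.2.1.2)) fun p => a p.1.1 :=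
    fun h => (h.upL (L := fun i => subsets (X i)) fun i => ofSet).upL
      fun p (R : Σ t : ℕ, FinBGraph t) => ofFinBGraph R.2
  have hn' : CompNum _ _ _ := ⟨up hn.comp, hn.bdd.up.up⟩
  refine Comp.smallest hn' ?_ (hZb.up.up.mono fun p => List.length_filter_le _ _)
  exact A.comp_solving hered union one hn' (up hG) (up hI) (up hX) (up hZ) hZb.up.up Comp.refl.fst.snd
    Comp.refl.snd (hm.up.up.mono fun p => hFm _ _ p.2.2)

/-- The algorithm is specified only when `outsideSet` is a deletion set of size at most `l i`. The
size bound relies on equal boundary sizes, so the call is placed in the branch where these have been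
checked. -/
theorem comp_answer (A : H.DisjointSolver f) (hered : H.Hereditary) (union : H.UnionClosed)
    (one : H.Mem (⊥ : SimpleGraph Unit)) {k l : ι → ℕ} (hn : CompNum B e n)
    (hk : CompNum B e k) (hl : CompNum B e l)
    (hf : ∃ c : ℕ, ∀ i, f (k i) (l i) ≤ cost (B i) c) (hG : Comp B e fun i => ofGraph (G i))
    (hI : Comp B e fun i => ofSet (I i)) (hX : Comp B e fun i => ofSet (X i))
    (hS : Comp B e fun i => ofSet (S i)) (hR : Comp B e fun i => ofFinBGraph (R i).2)
    (hb : PolyBdd B fun i => (R i).2.n) (hRl : ∀ i, (R i).2.n ≤ l i)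
    (hIX : ∀ i, Disjoint (I i) (X i)) (hSX : ∀ i, S i ⊆ X i)
    (hmem : ∀ i, H.Mem ((G i).induce (I i : Set (Fin (n i))))) :
    Comp B e fun i => ofList ((A.answer (k i) (l i) (G i) (I i) (X i) (S i) (R i)).map ofSet) := by
  have hY := hX.sdiff hn hS
  refine Comp.ite (P := fun i => (R i).1 = (X i \ S i).card)
    ((Comp.finBGraph_t hR hb).eq (Comp.card_set hn hY)) ?_ ?_
  swap
  · refine Comp.nil.congr fun i => ?_
    rw [answer, if_neg (fun h => i.2 h.1)]
    rfl
  set κ := {i // (R i).1 = (X i \ S i).card}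
  have hY' := hY.sub fun i => (R i).1 = (X i \ S i).card
  have hR' := hR.sub fun i => (R i).1 = (X i \ S i).card
  have hb' : PolyBdd (fun i : κ => B i.1) _ := hb.comap fun i : κ => i.1
  have hn' := hn.sub fun i => (R i).1 = (X i \ S i).card
  have hans := A.comp_ans (B := fun i : κ => B i.1)
    ((Comp.glueGraph hn hG ((hI.union hn hX).sdiff hn hS) hY hR hb).sub _)
    ((hn.bdd.add hb).comap fun i : κ => i.1) (hk.sub _) (hl.sub _) (Comp.outsideSet hn' hY' hR' hb')
    (fun i => by rw [card_outsideSet i.2]; exact hRl i.1)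
    (fun i => isDeletionSet_outsideSet hered union one (hmem i.1)
      (sdiff_sdiff_eq_of_disjoint (hIX i.1) (hSX i.1)))
    (by obtain ⟨c, hc⟩ := hf; exact ⟨c, fun i => hc i.1⟩)
  refine Comp.ite (comp_isSome hans) ?_ ?_
  swap
  · refine Comp.nil.congr fun i => ?_
    rw [answer, if_neg (fun h => i.2 h.2)]
    rfl
  set κ' := {i : κ // (A.ans (_root_.glueGraph (G i.1) ((I i.1 ∪ X i.1) \ S i.1) (X i.1 \ S i.1)
    (R i.1).2) (k i.1) (l i.1) (outsideSet (X i.1 \ S i.1) (R i.1).2)).isSome = true}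
  have hget := comp_getD (hans.sub fun i : κ => (A.ans (_root_.glueGraph (G i.1) ((I i.1 ∪ X i.1) \ S i.1)
    (X i.1 \ S i.1) (R i.1).2) (k i.1) (l i.1) (outsideSet (X i.1 \ S i.1) (R i.1).2)).isSome = true)
    fun i => i.2
  have hn2 : CompNum (fun i : κ' => B i.1.1) (fun i => e i.1.1) fun i => n i.1.1 := hn'.sub _
  have hleft : Comp (fun i : κ' => B i.1.1) (fun i => e i.1.1) fun i => ofSet
      (leftPart ((A.ans (_root_.glueGraph (G i.1.1) ((I i.1.1 ∪ X i.1.1) \ S i.1.1) (X i.1.1 \ S i.1.1)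
        (R i.1.1).2) (k i.1.1) (l i.1.1) (outsideSet (X i.1.1 \ S i.1.1) (R i.1.1).2)).getD ∅)) := by
    refine Comp.set_of (n := fun i : κ' => n i.1.1) (fun i v => Fin.castAdd (R i.1.1).2.n v ∈
      (A.ans (_root_.glueGraph (G i.1.1) ((I i.1.1 ∪ X i.1.1) \ S i.1.1) (X i.1.1 \ S i.1.1)
        (R i.1.1).2) (k i.1.1) (l i.1.1) (outsideSet (X i.1.1 \ S i.1.1) (R i.1.1).2)).getD ∅) hn2 ?_
      fun i v => mem_leftPart
    exact Comp.mem_set hget.upF hn2.var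
  refine ((Comp.union hn2 ((hS.sub _).sub _) (Comp.inter hn2 ((hI.sub _).sub _) hleft)).pair
    Comp.nil).congr fun i => ?_
  rw [answer, if_pos ⟨i.1.2, i.2⟩]
  rfl

theorem comp_answers (A : H.DisjointSolver f) (hered : H.Hereditary) (union : H.UnionClosed)
    (one : H.Mem (⊥ : SimpleGraph Unit)) {k l : ι → ℕ} (hn : CompNum B e n)
    (hk : CompNum B e k) (hl : CompNum B e l)
    (hf : ∃ c : ℕ, ∀ i, f (k i) (l i) ≤ cost (B i) c) (hG : Comp B e fun i => ofGraph (G i))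
    (hF : Comp B e fun i => ofFamily (F i)) (hFb : PolyBdd B fun i => (F i).length)
    (hFl : ∀ i, ∀ R ∈ F i, R.2.n ≤ l i)
    (hI : Comp B e fun i => ofSet (I i)) (hX : Comp B e fun i => ofSet (X i))
    (hX2 : PolyBdd B fun i => 2 ^ (X i).card)
    (hIX : ∀ i, Disjoint (I i) (X i)) (hmem : ∀ i, H.Mem ((G i).induce (I i : Set (Fin (n i))))) :
    Comp B e fun i => ofList ((A.answers (k i) (l i) (G i) (F i) (I i) (X i)).map ofSet) := by
  have hsub : ∀ i, ∀ S ∈ subsets (X i), S ⊆ X i := fun i S hS => subset_of_mem_subsets hS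
  refine Comp.flatMap (enc := fun i => ofSet) (enc' := fun i => ofSet) (L := fun i => subsets (X i))
    (F := fun i S => (F i).flatMap fun R => A.answer (k i) (l i) (G i) (I i) (X i) S R)
    (m := fun i => (F i).length) (hX2.mono fun i => (length_subsets _).le) hFb (fun i S _ => ?_)
    (Comp.subsets hn hX hX2) ?_
  · simpa using length_flatMap_le (l := F i) fun R _ =>
      A.length_answer_le (k := k i) (l := l i) (G := G i) (I := I i) (X := X i) (S := S) (R := R)
  refine Comp.flatMap (B := fun p : Σ i, {x // x ∈ subsets (X i)} => B p.1) (L := fun p => F p.1)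
    (enc := fun p R => ofFinBGraph R.2) (enc' := fun p => ofSet) (m := fun _ => 1) hFb.up (.const 1)
    (F := fun p R => A.answer (k p.1) (l p.1) (G p.1) (I p.1) (X p.1) p.2.1 R)
    (fun p R _ => A.length_answer_le) (hF.upL (L := fun i => subsets (X i)) fun i => ofSet) ?_
  have up : ∀ {a : ι → Val}, Comp B e a → Comp
      (fun p : Σ p : (Σ i, {x // x ∈ subsets (X i)}), {x // x ∈ F p.1} => B p.1.1)
      (fun p => .pair (.pair (e p.1.1) (ofSet p.1.2.1)) (ofFinBGraph p.2.1.2)) fun p => a p.1.1 :=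
    fun h => (h.upL (L := fun i => subsets (X i)) fun i => ofSet).upL
      fun p (R : Σ t : ℕ, FinBGraph t) => ofFinBGraph R.2
  have upN : ∀ {a : ι → ℕ}, CompNum B e a → CompNum
      (fun p : Σ p : (Σ i, {x // x ∈ subsets (X i)}), {x // x ∈ F p.1} => B p.1.1)
      (fun p => .pair (.pair (e p.1.1) (ofSet p.1.2.1)) (ofFinBGraph p.2.1.2)) fun p => a p.1.1 :=
    fun h => ⟨up h.comp, h.bdd.up.up⟩
  exact A.comp_answer hered union one (upN hn) (upN hk) (upN hl)
    (by obtain ⟨c, hc⟩ := hf; exact ⟨c, fun p => hc p.1.1⟩) (up hG) (up hI) (up hX) Comp.refl.fst.snd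
    Comp.refl.snd (hl.bdd.up.up.mono fun p => hFl _ _ p.2.2) (fun p => hFl _ _ p.2.2)
    (fun p => hIX p.1.1) (fun p => hsub _ _ p.1.2.2) fun p => hmem p.1.1

end GraphClass.DisjointSolver

namespace Comp

open Val (ofList ofBool ofNat)

variable {ι : Type} {B : ι → ℕ × ℕ} {e a : ι → Val} {n : ι → ℕ}

open scoped Classical in
theorem update {g : ∀ i, Fin (n i) → Val} {p : ∀ i, Fin (n i)} (hn : CompNum B e n)
    (hg : Comp B e fun i => ofList (List.ofFn (g i))) (hp : CompNum B e fun i => (p i : ℕ))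
    (ha : Comp B e a) :
    Comp B e fun i => ofList (List.ofFn fun q => if q = p i then a i else g i q) := by
  refine CompNum.tabulate (g := fun i q => if q = p i then a i else g i q) hn ?_
  refine ite (P := fun x : Σ i, Fin (n i) => x.2 = p x.1) (hn.var.fin_eq hp.upF) ?_ ?_
  · exact (ha.upF.sub _).congr fun x => (if_pos x.2).symm
  · exact ((lookup hg.upF hn.var).sub _).congr fun x => (if_neg x.2).symm

end Comp

namespace DPState

open Val (ofList ofBool ofNat ofSet ofGraph ofFamily)

/-- The encoding of a state. -/
noncomputable def encode {n N : ℕ} (s : DPState n N) : Val :=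
  .pair (ofSet s.alive) (.pair (ofList (List.ofFn fun t => ofSet (s.priv t)))
    (ofList (List.ofFn fun t => ofList ((s.fam t).map ofSet))))

variable {H : GraphClass} {f : ℕ → ℕ → ℕ} {ι : Type} {B : ι → ℕ × ℕ} {e : ι → Val} {n N : ι → ℕ}
  {G : ∀ i, SimpleGraph (Fin (n i))} {F : ι → List (Σ t : ℕ, FinBGraph t)}
  {T : ∀ i, SimpleGraph (Fin (N i))} {X : ∀ i, Fin (N i) → Finset (Fin (n i))}
  {s : ∀ i, DPState (n i) (N i)} {m m' : ι → ℕ}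

/-- The data of the dynamic program are computable and polynomially bounded. -/
structure CompData (B : ι → ℕ × ℕ) (e : ι → Val) (G : ∀ i, SimpleGraph (Fin (n i)))
    (F : ι → List (Σ t : ℕ, FinBGraph t)) (T : ∀ i, SimpleGraph (Fin (N i)))
    (X : ∀ i, Fin (N i) → Finset (Fin (n i))) (m : ι → ℕ) : Prop where
  comp_n : CompNum B e n
  comp_N : CompNum B e N
  comp_G : Comp B e fun i => ofGraph (G i)
  comp_F : Comp B e fun i => ofFamily (F i)
  comp_T : Comp B e fun i => ofGraph (T i)
  comp_X : Comp B e fun i => ofList (List.ofFn fun t => ofSet (X i t))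
  bdd : PolyBdd B m
  length_le : ∀ i, (F i).length ≤ m i
  size_le : ∀ i, ∀ R ∈ F i, R.2.n ≤ m i
  two_pow_le : ∀ i t, 2 ^ (X i t).card ≤ m i

theorem CompData.comap (h : CompData B e G F T X m) {κ : Type} (g : κ → ι) {e' : κ → Val}
    (he : Comp (fun k => B (g k)) e' fun k => e (g k)) :
    CompData (fun k => B (g k)) e' (fun k => G (g k)) (fun k => F (g k)) (fun k => T (g k))
      (fun k => X (g k)) fun k => m (g k) where
  comp_n := .trans he (h.comp_n.comap g)
  comp_N := .trans he (h.comp_N.comap g)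
  comp_G := .trans he (h.comp_G.comap g)
  comp_F := .trans he (h.comp_F.comap g)
  comp_T := .trans he (h.comp_T.comap g)
  comp_X := .trans he (h.comp_X.comap g)
  bdd := h.bdd.comap g
  length_le k := h.length_le (g k)
  size_le k := h.size_le (g k)
  two_pow_le k := h.two_pow_le (g k)

theorem comp_alive (hs : Comp B e fun i => (s i).encode) : Comp B e fun i => ofSet (s i).alive := .fst hs

theorem comp_priv {t : ∀ i, Fin (N i)} (hs : Comp B e fun i => (s i).encode)
    (ht : CompNum B e fun i => (t i : ℕ)) : Comp B e fun i => ofSet ((s i).priv (t i)) :=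
  Comp.lookup (g := fun i t => ofSet ((s i).priv t)) (.fst (.snd hs)) ht

theorem comp_fam {t : ∀ i, Fin (N i)} (hs : Comp B e fun i => (s i).encode)
    (ht : CompNum B e fun i => (t i : ℕ)) :
    Comp B e fun i => ofList (((s i).fam (t i)).map ofSet) :=
  Comp.lookup (g := fun i t => ofList (((s i).fam t).map ofSet)) (.snd (.snd hs)) ht

theorem comp_removable {t p : ∀ i, Fin (N i)} (hN : CompNum B e N) (hT : Comp B e fun i => ofGraph (T i))
    (hs : Comp B e fun i => (s i).encode) (ht : CompNum B e fun i => (t i : ℕ))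
    (hp : CompNum B e fun i => (p i : ℕ)) :
    CompProp B e fun i => (s i).Removable (T i) (t i) (p i) := by
  have ha := comp_alive hs
  refine (ha.mem_set ht).and ((ha.mem_set hp).and ((Comp.adj hT ht hp).and
    (CompNum.forall_fin (P := fun i q => q ∈ (s i).alive → (T i).Adj (t i) q → q = p i) hN ?_)))
  exact (Comp.mem_set ha.upF hN.var).imp ((Comp.adj hT.upF ht.upF hN.var).imp (hN.var.fin_eq hp.upF))

theorem comp_absorb (A : H.DisjointSolver f) (hered : H.Hereditary) (union : H.UnionClosed)
    (one : H.Mem (⊥ : SimpleGraph Unit)) {t p : ∀ i, Fin (N i)} (h : CompData B e G F T X m)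
    (hs : Comp B e fun i => (s i).encode) (hm' : PolyBdd B m') (hsm : ∀ i t, ((s i).fam t).length ≤ m' i)
    (ht : CompNum B e fun i => (t i : ℕ)) (hp : CompNum B e fun i => (p i : ℕ)) :
    Comp B e fun i => ((s i).absorb H (G i) (F i) (X i) (t i) (p i)).encode := by
  have hXt : Comp B e fun i => ofSet (X i (t i)) := Comp.lookup (g := fun i t => ofSet (X i t)) h.comp_X ht
  have hXp : Comp B e fun i => ofSet (X i (p i)) := Comp.lookup (g := fun i t => ofSet (X i t)) h.comp_X hp
  have hmerged : Comp B e fun i => ofSet ((s i).merged (X i) (t i) (p i)) :=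
    ((comp_priv hs hp).union h.comp_n (comp_priv hs ht)).union h.comp_n (hXt.sdiff h.comp_n hXp)
  have hbd : ∀ t : ∀ i, Fin (N i), PolyBdd B fun i => ((s i).fam (t i)).length :=
    fun t => hm'.mono fun i => hsm i (t i)
  have htrim := A.comp_trim hered union one h.comp_n h.comp_G h.comp_F (h.bdd.mono h.length_le) h.bdd h.size_le
    hmerged hXp (h.bdd.mono fun i => h.two_pow_le i _)
    (Comp.unions h.comp_n (comp_fam hs hp) (hbd p) (comp_fam hs ht) (hbd t))
    (((hbd p).mul (hbd t)).mono fun i => GraphClass.length_flatMap_le fun Z _ => by simp)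
  refine Comp.pair ?_ (Comp.pair ?_ ?_)
  · exact Comp.set_of (n := N) (fun i q => q ≠ t i ∧ q ∈ (s i).alive) h.comp_N
      ((h.comp_N.var.fin_eq ht.upF).not.and (Comp.mem_set (comp_alive hs).upF h.comp_N.var))
      fun i q => Finset.mem_erase
  · refine (Comp.update (g := fun i q => ofSet ((s i).priv q)) h.comp_N (.fst (.snd hs)) hp
      hmerged).congr fun i => ?_
    congr 2
    funext q
    simp only [absorb]
    split_ifs <;> rfl
  · refine (Comp.update (g := fun i q => ofList (((s i).fam q).map ofSet)) h.comp_N (.snd (.snd hs)) hp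
      htrim).congr fun i => ?_
    congr 2
    funext q
    simp only [absorb]
    split_ifs <;> rfl

theorem comp_step (A : H.DisjointSolver f) (hered : H.Hereditary) (union : H.UnionClosed)
    (one : H.Mem (⊥ : SimpleGraph Unit)) (h : CompData B e G F T X m)
    (hs : Comp B e fun i => (s i).encode) (hm' : PolyBdd B m')
    (hsm : ∀ i t, ((s i).fam t).length ≤ m' i) :
    Comp B e fun i => ((s i).step H (G i) (F i) (T i) (X i)).encode := by
  refine Comp.list_head (enc := fun i => encode) ?_ hs
  refine Comp.flatMap (enc := fun i (t : Fin (N i)) => ofNat (t : ℕ)) (enc' := fun i => encode) (m := N)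
    (h.comp_N.bdd.mono fun i => by simp) h.comp_N.bdd (fun i t _ => ?_) h.comp_N.finRange ?_
  · rw [List.length_map]
    exact (List.length_filter_le _ _).trans (by simp)
  let e1 : (Σ i, {x : Fin (N i) // x ∈ List.finRange (N i)}) → Val :=
    fun p => .pair (e p.1) (ofNat p.2.1)
  have hN1 : CompNum _ e1 _ := h.comp_N.upL (L := fun i => List.finRange (N i)) fun i t => ofNat t
  have hs1 : Comp _ e1 _ := hs.upL (L := fun i => List.finRange (N i)) fun i t => ofNat t
  have ht1 : CompNum (fun p : Σ i, {x : Fin (N i) // x ∈ List.finRange (N i)} => B p.1) e1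
      fun p => (p.2.1 : ℕ) := ⟨.var, h.comp_N.bdd.up.mono fun p => p.2.1.2.le⟩
  have hfil : Comp (fun p : Σ i, {x : Fin (N i) // x ∈ List.finRange (N i)} => B p.1) e1
      fun p => ofList (((List.finRange (N p.1)).filter fun q =>
        propBit ((s p.1).Removable (T p.1) p.2.1 q)).map fun q : Fin (N p.1) => ofNat (q : ℕ)) := by
    refine Comp.filter (P := fun p q => (s p.1).Removable (T p.1) p.2.1 q)
      (hN1.bdd.mono fun i => by simp) hN1.finRange ?_
    exact comp_removable
      (hN1.upL (L := fun p => List.finRange (N p.1)) fun i t => ofNat t)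
      ((h.comp_T.upL (L := fun i => List.finRange (N i)) fun i t => ofNat t).upL
        (L := fun p => List.finRange (N p.1)) fun i t => ofNat t)
      (hs1.upL (L := fun p => List.finRange (N p.1)) fun i t => ofNat t)
      (ht1.upL (L := fun p => List.finRange (N p.1)) fun i t => ofNat t)
      ⟨Comp.refl.snd, hN1.bdd.up.mono fun p => p.2.1.2.le⟩
  have hlen : ∀ p : Σ i, {x : Fin (N i) // x ∈ List.finRange (N i)},
      ((List.finRange (N p.1)).filter fun q =>
        propBit ((s p.1).Removable (T p.1) p.2.1 q)).length ≤ N p.1 := fun p =>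
    (List.length_filter_le _ _).trans (by simp)
  have hmap : Comp (fun p : Σ i, {x : Fin (N i) // x ∈ List.finRange (N i)} => B p.1) e1
      fun p => ofList (((List.finRange (N p.1)).filter fun q =>
        propBit ((s p.1).Removable (T p.1) p.2.1 q)).map fun q =>
          ((s p.1).absorb H (G p.1) (F p.1) (X p.1) p.2.1 q).encode) := by
    refine Comp.map (hN1.bdd.mono hlen) hfil ?_
    exact comp_absorb A hered union one (m' := fun p => m' p.1.1) (m := fun p => m p.1.1)
      (T := fun p => T p.1.1)
      (h.comap (fun p : Σ p : (Σ i, {x : Fin (N i) // x ∈ List.finRange (N i)}), {x // x ∈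
        (List.finRange (N p.1)).filter fun q => propBit ((s p.1).Removable (T p.1) p.2.1 q)} => p.1.1)
        Comp.refl.fst.fst) (hs1.upL (L := fun p => (List.finRange (N p.1)).filter fun q =>
          propBit ((s p.1).Removable (T p.1) p.2.1 q)) fun p q => ofNat q) hm'.up.up
      (fun p t => hsm p.1.1 t)
      (ht1.upL (L := fun p => (List.finRange (N p.1)).filter fun q =>
        propBit ((s p.1).Removable (T p.1) p.2.1 q)) fun p q => ofNat q)
      ⟨Comp.refl.snd, hN1.bdd.up.mono fun p => p.2.1.2.le⟩
  exact hmap.congr fun p => by simp [Function.comp_def]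

/-- By `length_fam_iterate` the lists have length at most `m i * m i` at every pass, so all passes
can be charged at the same scale. -/
theorem comp_iterate (A : H.DisjointSolver f) (hered : H.Hereditary) (union : H.UnionClosed)
    (one : H.Mem (⊥ : SimpleGraph Unit)) (h : CompData B e G F T X m)
    (hs : Comp B e fun i => (s i).encode) (hsm : ∀ i t, ((s i).fam t).length ≤ m i * m i) :
    Comp B e fun i => ((step H (G i) (F i) (T i) (X i))^[N i] (s i)).encode := by
  refine Comp.iterate (st := fun i j => ((step H (G i) (F i) (T i) (X i))^[j] (s i)).encode)
    h.comp_N.bdd h.comp_N.comp (hs.congr fun i => rfl) ?_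
  have hstep := comp_step A hered union one (m' := fun p : Σ i, Fin (N i) => m p.1 * m p.1)
    (s := fun p => (step H (G p.1) (F p.1) (T p.1) (X p.1))^[p.2] (s p.1))
    (h.comap (fun p : Σ i, Fin (N i) => p.1) (e' := fun p => .pair (e p.1)
      ((step H (G p.1) (F p.1) (T p.1) (X p.1))^[p.2] (s p.1)).encode) Comp.refl.fst) Comp.refl.snd
    (h.bdd.mul h.bdd).up fun p t => length_fam_iterate
      (fun t => Nat.mul_le_mul (h.two_pow_le _ t) (h.length_le _)) (hsm p.1) _ t
  exact hstep.congr fun p => by rw [Function.iterate_succ_apply']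

theorem comp_solutions (A : H.DisjointSolver f) (hered : H.Hereditary) (union : H.UnionClosed)
    (one : H.Mem (⊥ : SimpleGraph Unit)) (h : CompData B e G F T X m)
    (hs : Comp B e fun i => (s i).encode) (hm' : PolyBdd B m')
    (hsm : ∀ i t, ((s i).fam t).length ≤ m' i) :
    Comp B e fun i => ofList (((s i).solutions H (G i)).map ofSet) := by
  have hb : PolyBdd B fun i => (members (s i).alive).length := h.comp_N.bdd.mono fun i => by
    rw [length_members]
    simpa using Finset.card_le_univ (s i).alive
  have hfam := Comp.flatMap (enc' := fun i => ofSet) (F := fun i => (s i).fam) hb hm'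
    (fun i t _ => hsm i t) (Comp.members h.comp_N (comp_alive hs))
    (comp_fam (t := fun p : Σ i, {x // x ∈ members (s i).alive} => p.2.1)
      (hs.upL (L := fun i => members (s i).alive) fun i t => ofNat t)
      ⟨.var, h.comp_N.bdd.up.mono fun p => p.2.1.2.le⟩)
  refine Comp.filter (P := fun i (Z : Finset (Fin (n i))) => H.Mem ((G i).mask ((Z : Set (Fin (n i)))ᶜ)))
    ((hb.mul hm').mono fun i => GraphClass.length_flatMap_le fun t _ => hsm i t) hfam ?_
  exact A.comp_mem hered union one (Comp.mask (h.comp_n.upL fun i => ofSet) (h.comp_G.upL fun i => ofSet) .var)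
    h.comp_n.bdd.up

end DPState

/-! ### Representative families -/

/-- The empty boundaried graph. -/
def FinBGraph.empty : FinBGraph 0 := ⟨0, ⊥, ⟨Fin.elim0, fun i => i.elim0⟩⟩

open scoped Classical in
/-- The largest boundaried graph of a family. -/
noncomputable def FinBGraph.largest (F : List (Σ t : ℕ, FinBGraph t)) : Σ t : ℕ, FinBGraph t :=
  (F.filter fun R => propBit (∀ R' ∈ F, R'.2.n ≤ R.2.n)).headD ⟨0, .empty⟩

theorem FinBGraph.largest_spec {F : List (Σ t : ℕ, FinBGraph t)} (h : F ≠ []) :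
    largest F ∈ F ∧ ∀ R ∈ F, R.2.n ≤ (largest F).2.n := by
  classical
  obtain ⟨M, hM, hmax⟩ := F.toFinset.exists_max_image (fun R => R.2.n)
    (by simpa [Finset.nonempty_iff_ne_empty] using h)
  have hM' : M ∈ F.filter fun R => propBit (∀ R' ∈ F, R'.2.n ≤ R.2.n) :=
    List.mem_filter.2 ⟨List.mem_toFinset.1 hM, by
      simpa only [propBit_eq_true] using fun R hR => hmax R (List.mem_toFinset.2 hR)⟩
  unfold largest
  cases h : F.filter fun R => propBit (∀ R' ∈ F, R'.2.n ≤ R.2.n) with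
  | nil => simp [h] at hM'
  | cons R l =>
    have hR : R ∈ F.filter fun R => propBit (∀ R' ∈ F, R'.2.n ≤ R.2.n) := by simp [h]
    exact (List.mem_filter.1 hR).imp id propBit_eq_true.1

/-! ### Boundary size zero, and the size of minimal representatives -/

namespace GraphClass

variable {H : GraphClass} {k : ℕ} {F : List (Σ t : ℕ, FinBGraph t)}

/-- Without labels, gluing is the disjoint union. Hence all graphs of `H` with empty boundary are
equivalent, and the empty graph represents them. -/
theorem mem_glue_zero (hered : H.Hereditary) (union : H.UnionClosed) (A C : BGraph 0) :
    H.Mem (A.glue C) ↔ H.Mem A.graph ∧ H.Mem C.graph := by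
  have hC : ∀ v : C.V, v ∉ Set.range C.bd := fun v ⟨i, _⟩ => i.elim0
  refine ⟨fun h => ⟨hered.of_embedding ⟨⟨Sum.inl, Sum.inl_injective⟩, ?_⟩ h,
    hered.of_embedding ⟨⟨fun v => Sum.inr ⟨v, hC v⟩, fun u v h => by simpa using h⟩, ?_⟩ h⟩,
    fun h => hered.of_embedding (G' := SimpleGraph.sum A.graph C.graph)
      ⟨⟨Sum.map id Subtype.val, Sum.map_injective.2 ⟨Function.injective_id, Subtype.val_injective⟩⟩, ?_⟩
      (union _ _ _ _ h.1 h.2)⟩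
  · intro a b
    simp [BGraph.glue, BGraph.GlueRep]
  · intro a b
    change (A.glue C).Adj (Sum.inr ⟨a, hC a⟩) (Sum.inr ⟨b, hC b⟩) ↔ _
    simp [BGraph.glue, BGraph.GlueRep]
  · rintro (a | a) (b | b) <;> simp [BGraph.glue, BGraph.GlueRep]

theorem IsMinRep.card_eq {t : ℕ} {A B : BGraph t} (hA : H.IsMinRep A) (hB : H.IsMinRep B)
    (h : H.Equivalent A B) : Nat.card A.V = Nat.card B.V :=
  le_antisymm (hA.2 B h) (hB.2 A ((H.equivSetoid t).symm h))

theorem IsRepFamily.exists_card_eq (hF : H.IsRepFamily k F) {t : ℕ} (h1 : 1 ≤ t) (hk : t ≤ k)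
    {A : BGraph t} (hA : H.IsMinRep A) : ∃ R ∈ F, R.2.n = Nat.card A.V := by
  obtain ⟨R, hR, he⟩ := hF.2 t h1 hk A hA.1
  refine ⟨_, hR, ?_⟩
  have := (hF.1 _ hR).2.2.card_eq hA he
  simpa [FinBGraph.toBGraph] using this

/-- Equivalent minimal representatives have equally many vertices, so the family realises every size
that a minimal representative can have. This lets the program read off the parameter `r_H(k)`, which
is not given. For an empty family both sides take the default value `0`. -/
theorem IsRepFamily.largest_n (hF : H.IsRepFamily k F) : (FinBGraph.largest F).2.n = H.repSize k := by
  rcases eq_or_ne F [] with rfl | hne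
  · have : {m : ℕ | ∃ t : ℕ, 1 ≤ t ∧ t ≤ k ∧ ∃ A : BGraph t, H.IsMinRep A ∧ Nat.card A.V = m} = ∅ := by
      refine Set.eq_empty_of_forall_notMem fun m ⟨t, h1, hk, A, hA, _⟩ => ?_
      obtain ⟨R, hR, -⟩ := hF.exists_card_eq h1 hk hA
      simp at hR
    rw [repSize, this]
    simp [FinBGraph.largest, FinBGraph.empty]
  · obtain ⟨hR, hmax⟩ := FinBGraph.largest_spec hne
    symm
    refine IsGreatest.csSup_eq ⟨⟨_, (hF.1 _ hR).1, (hF.1 _ hR).2.1, _, (hF.1 _ hR).2.2, ?_⟩, ?_⟩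
    · simp [FinBGraph.toBGraph]
    · rintro m ⟨t, h1, hk, A, hA, rfl⟩
      obtain ⟨R', hR', he⟩ := hF.exists_card_eq h1 hk hA
      exact he ▸ hmax R' hR'

theorem IsRepFamily.n_le (hF : H.IsRepFamily k F) {R : Σ t : ℕ, FinBGraph t} (hR : R ∈ F) :
    R.2.n ≤ H.repSize k := by
  rw [← hF.largest_n]
  exact (FinBGraph.largest_spec (List.ne_nil_of_mem hR)).2 R hR

/-- Boundary size `0`, which arises when all of `X` is deleted, is not covered by a representative
family; the empty graph is added for it and does not increase the maximum size. -/
theorem IsRepFamily.isComplete (hF : H.IsRepFamily k F) (hered : H.Hereditary) (union : H.UnionClosed) :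
    H.IsComplete k (H.repSize k) (⟨0, .empty⟩ :: F) where
  size_le R hR := by
    rcases List.mem_cons.1 hR with rfl | hR
    · exact Nat.zero_le _
    · exact hF.n_le hR
  exists_equivalent t ht A hA := by
    rcases Nat.eq_zero_or_pos t with rfl | h1
    · refine ⟨.empty, by simp, fun i => i.elim0, fun C _ => ?_⟩
      have : H.Mem FinBGraph.empty.toBGraph.graph :=
        hered.of_embedding ⟨⟨fun v : Fin 0 => v.elim0, fun v => v.elim0⟩, fun {v} => v.elim0⟩ hA
      rw [mem_glue_zero hered union, mem_glue_zero hered union]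
      exact and_congr_left fun _ => iff_of_true this hA
    · obtain ⟨R, hR, he⟩ := hF.2 t h1 ht A hA
      exact ⟨R, List.mem_cons_of_mem _ hR, he⟩

end GraphClass

namespace Val

/-- The height of a value. -/
def height : Val → ℕ
  | nil => 0
  | pair a b => max a.height b.height + 1

theorem height_ofNat (k : ℕ) : (ofNat k).height = k := by
  induction k with
  | zero => rfl
  | succ k ih => simp [ofNat, height, ih]

theorem length_le_height (l : List Val) : l.length ≤ (ofList l).height := by
  induction l with
  | nil => simp
  | cons a l ih =>
    simp only [ofList, height, List.length_cons]
    omega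

theorem height_le_of_mem {l : List Val} {a : Val} (h : a ∈ l) : a.height ≤ (ofList l).height := by
  induction l with
  | nil => simp at h
  | cons b l ih =>
    simp only [ofList, height]
    rcases List.mem_cons.1 h with rfl | h
    · omega
    · have := ih h
      omega

theorem length_le_height_ofFamily (F : List (Σ t : ℕ, FinBGraph t)) : F.length ≤ (ofFamily F).height := by
  simpa [ofFamily] using length_le_height (F.map fun R => ofFinBGraph R.2)

theorem n_le_height_ofFamily {F : List (Σ t : ℕ, FinBGraph t)} {R : Σ t : ℕ, FinBGraph t} (hR : R ∈ F) :
    R.2.n ≤ (ofFamily F).height := by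
  refine le_trans ?_ (height_le_of_mem (List.mem_map.2 ⟨R, hR, rfl⟩))
  have := length_le_height (List.ofFn fun i => ofList (List.ofFn fun j => ofBool (propBit (R.2.graph.Adj i j))))
  rw [List.length_ofFn] at this
  simp only [ofFinBGraph, height, ofGraph]
  omega

end Val

/-- An output cannot outgrow the running time. Applied to the program for the family, this bounds
the number of its members and their orders by `k + v k`. -/
theorem Prog.Runs.height_le {p : Prog} {x y : Val} {t : ℕ} (h : p.Runs x y t) :
    y.height ≤ x.height + t := by
  induction h <;> (try simp only [Val.height] at *) <;> omega

/-! ### The program -/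

namespace Comp

open Val (ofList ofBool ofNat ofSet ofGraph ofFinBGraph ofFamily)

variable {ι : Type} {B : ι → ℕ × ℕ} {e : ι → Val} {F : ι → List (Σ t : ℕ, FinBGraph t)} {m : ι → ℕ}

theorem empty : Comp B e fun _ => ofFinBGraph FinBGraph.empty :=
  (Comp.nil.pair Comp.nil).congr fun _ => rfl

theorem largest (hF : Comp B e fun i => ofFamily (F i)) (hFb : PolyBdd B fun i => (F i).length)
    (hm : PolyBdd B m) (hFm : ∀ i, ∀ R ∈ F i, R.2.n ≤ m i) :
    CompNum B e fun i => (FinBGraph.largest (F i)).2.n := by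
  have hbd : ∀ i, (FinBGraph.largest (F i)).2.n ≤ m i := fun i => by
    rcases eq_or_ne (F i) [] with h | h
    · rw [h]
      exact Nat.zero_le _
    · exact hFm i _ (FinBGraph.largest_spec h).1
  refine finBGraph_n (R := fun i => FinBGraph.largest (F i)) ?_ (hm.mono hbd)
  refine list_head (enc := fun _ (R : Σ t : ℕ, FinBGraph t) => ofFinBGraph R.2) ?_ empty
  refine filter (enc := fun _ (R : Σ t : ℕ, FinBGraph t) => ofFinBGraph R.2)
    (P := fun i R => ∀ R' ∈ F i, R'.2.n ≤ R.2.n) hFb hF ?_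
  refine forall_mem (B := fun p : Σ i, {x // x ∈ F i} => B p.1) (L := fun p => F p.1)
    (enc := fun _ (R : Σ t : ℕ, FinBGraph t) => ofFinBGraph R.2)
    (P := fun p R' => R'.2.n ≤ p.2.1.2.n) hFb.up
    (hF.upL fun _ (R : Σ t : ℕ, FinBGraph t) => ofFinBGraph R.2) ?_
  refine CompNum.le (m := fun p : Σ p : (Σ i, {x // x ∈ F i}), {x // x ∈ F p.1} => p.2.1.2.n)
    (n := fun p => p.1.2.1.2.n) ?_ ?_
  · exact finBGraph_n (R := fun p : Σ p : (Σ i, {x // x ∈ F i}), {x // x ∈ F p.1} => p.2.1)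
      Comp.refl.snd (hm.up.up.mono fun p => hFm _ _ p.2.2)
  · exact finBGraph_n (R := fun p : Σ p : (Σ i, {x // x ∈ F i}), {x // x ∈ F p.1} => p.1.2.1)
      Comp.refl.fst.snd (hm.up.up.mono fun p => hFm _ _ p.1.2.2)

end Comp

namespace DecompData

open Val (ofList ofBool ofNat ofSet ofGraph ofFinBGraph ofFamily ofDecomp)

variable {ι : Type} {B : ι → ℕ × ℕ} {e : ι → Val} {n N : ι → ℕ} {D : ∀ i, DecompData (n i) (N i)}

theorem comp_tree (hD : Comp B e fun i => ofDecomp (D i)) : Comp B e fun i => ofGraph (D i).tree :=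
  .fst hD

theorem comp_bag {t : ∀ i, Fin (N i)} (hD : Comp B e fun i => ofDecomp (D i))
    (ht : CompNum B e fun i => (t i : ℕ)) : Comp B e fun i => ofSet ((D i).bag (t i)) :=
  Comp.lookup (g := fun i t => ofSet ((D i).bag t)) (.fst (.snd (.snd hD))) ht

theorem comp_base (hD : Comp B e fun i => ofDecomp (D i)) : Comp B e fun i => ofSet (D i).base :=
  .fst (.snd (.snd (.snd hD)))

theorem comp_outer {t : ∀ i, Fin (N i)} (hD : Comp B e fun i => ofDecomp (D i)) (hn : CompNum B e n)
    (ht : CompNum B e fun i => (t i : ℕ)) : Comp B e fun i => ofSet ((D i).outer (t i)) :=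
  (comp_bag hD ht).sdiff hn (comp_base hD)

theorem comp_inner {t : ∀ i, Fin (N i)} (hD : Comp B e fun i => ofDecomp (D i)) (hn : CompNum B e n)
    (ht : CompNum B e fun i => (t i : ℕ)) : Comp B e fun i => ofSet ((D i).inner (t i)) :=
  (comp_bag hD ht).inter hn (comp_base hD)

theorem width_le {n N : ℕ} (D : DecompData n N) : D.width ≤ n :=
  Finset.sup_le fun t _ => (Nat.sub_le _ _).trans ((Finset.card_le_univ _).trans (by simp))

theorem lt_width {n N : ℕ} (D : DecompData n N) {j : ℕ} : j < D.width ↔ ∃ t, j + 1 < (D.outer t).card := by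
  simp only [width, Finset.lt_sup_iff, Finset.mem_univ, true_and]
  exact exists_congr fun t => by unfold outer; omega

/-- The maximum is computed by counting the numbers below it; since the width is at most `n`, the
range `Fin n` suffices. -/
theorem comp_width (hD : Comp B e fun i => ofDecomp (D i)) (hn : CompNum B e n) (hN : CompNum B e N) :
    CompNum B e fun i => (D i).width := by
  refine (Comp.card_set (S := fun i => Finset.univ.filter fun j : Fin (n i) => (j : ℕ) < (D i).width)
    hn ?_).congr fun i => by
      rw [Fin.card_filter_val_lt, min_eq_right (D i).width_le]
  refine Comp.set_of (fun i j => ∃ t, (j : ℕ) + 1 < ((D i).outer t).card) hn ?_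
    fun i v => by simp [lt_width]
  refine CompNum.exists_fin hN.upF ?_
  exact (hn.var.upF.add (.const 1)).lt (Comp.card_set hn.upF.upF
    (comp_outer (D := fun p : Σ p : (Σ i, Fin (n i)), Fin (N p.1) => D p.1.1) (t := fun p => p.2)
      hD.upF.upF hn.upF.upF hN.upF.var))

theorem comp_output {H : GraphClass} {f : ℕ → ℕ → ℕ} (A : H.DisjointSolver f) (hered : H.Hereditary)
    (union : H.UnionClosed) (one : H.Mem (⊥ : SimpleGraph Unit)) {G : ∀ i, SimpleGraph (Fin (n i))}
    {F : ι → List (Σ t : ℕ, FinBGraph t)} {k l m : ι → ℕ}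
    (hD : Comp B e fun i => ofDecomp (D i)) (hn : CompNum B e n) (hN : CompNum B e N)
    (hG : Comp B e fun i => ofGraph (G i)) (hF : Comp B e fun i => ofFamily (F i))
    (hk : CompNum B e k) (hl : CompNum B e l) (hf : ∃ c : ℕ, ∀ i, f (k i) (l i) ≤ cost (B i) c)
    (hm : PolyBdd B m) (hFm : ∀ i, (F i).length ≤ m i) (hFn : ∀ i, ∀ R ∈ F i, R.2.n ≤ m i)
    (hFl : ∀ i, ∀ R ∈ F i, R.2.n ≤ l i)
    (h2 : ∀ i t, 2 ^ ((D i).outer t).card ≤ m i)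
    (hmem : ∀ i t, H.Mem ((G i).induce ((D i).inner t : Set (Fin (n i))))) :
    Comp B e fun i => ofSet ((D i).output A (G i) (F i) (k i) (l i)) := by
  have hFb : PolyBdd B fun i => (F i).length := hm.mono hFm
  have data : DPState.CompData B e G F (fun i => (D i).tree) (fun i => (D i).outer) m :=
    { comp_n := hn
      comp_N := hN
      comp_G := hG
      comp_F := hF
      comp_T := comp_tree hD
      comp_X := hN.tabulate (comp_outer (t := fun p : Σ i, Fin (N i) => p.2) hD.upF hn.upF hN.var)
      bdd := hm
      length_le := hFm
      size_le := hFn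
      two_pow_le := h2 }
  have hlen : ∀ i t, (((D i).initState A (G i) (F i) (k i) (l i)).fam t).length ≤ m i * m i :=
    fun i t => A.length_answers_le.trans (Nat.mul_le_mul (h2 i t) (hFm i))
  have hinit : Comp B e fun i => ((D i).initState A (G i) (F i) (k i) (l i)).encode := by
    refine Comp.pair ?_ (Comp.pair ?_ ?_)
    · exact Comp.set_of (fun _ _ => True) hN .true_ fun i v => by simp [initState]
    · exact hN.tabulate (comp_inner (t := fun p : Σ i, Fin (N i) => p.2) hD.upF hn.upF hN.var)
    · refine hN.tabulate (g := fun i t => ofList ((A.answers (k i) (l i) (G i) (F i) ((D i).inner t)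
        ((D i).outer t)).map ofSet)) ?_
      exact A.comp_answers hered union one (n := fun p : Σ i, Fin (N i) => n p.1) (F := fun p => F p.1)
        (k := fun p => k p.1) (l := fun p => l p.1) (G := fun p => G p.1)
        (I := fun p => (D p.1).inner p.2) (X := fun p => (D p.1).outer p.2) hn.upF hk.upF hl.upF
        (by obtain ⟨c, hc⟩ := hf; exact ⟨c, fun p => hc p.1⟩) hG.upF hF.upF hFb.up (fun p => hFl p.1)
        (comp_inner (t := fun p : Σ i, Fin (N i) => p.2) hD.upF hn.upF hN.var)
        (comp_outer (t := fun p : Σ i, Fin (N i) => p.2) hD.upF hn.upF hN.var)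
        (hm.up.mono fun p => h2 p.1 p.2) (fun p => disjoint_inner_outer _ _) fun p => hmem p.1 p.2
  have hiter := DPState.comp_iterate A hered union one data hinit hlen
  have hlen' : ∀ i t, (((DPState.step H (G i) (F i) (D i).tree (D i).outer)^[N i]
      ((D i).initState A (G i) (F i) (k i) (l i))).fam t).length ≤ m i * m i := fun i t =>
    DPState.length_fam_iterate (fun t => Nat.mul_le_mul (h2 i t) (hFm i)) (hlen i) _ t
  have hsol := DPState.comp_solutions A hered union one data hiter (hm.mul hm) hlen'
  refine Comp.list_head (enc := fun i => ofSet) (Comp.smallest hn hsol ?_) ?_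
  · refine ((hN.bdd.mul (hm.mul hm)).mono fun i => (List.length_filter_le _ _).trans
      ((GraphClass.length_flatMap_le fun t _ => hlen' i t).trans (Nat.mul_le_mul_right _ ?_)))
    rw [length_members]
    exact (Finset.card_le_univ _).trans (by simp)
  · exact Comp.set_of (fun _ _ => False) hn .false_ fun i v => by simp

end DecompData

/-! ### The algorithm with a given representative family -/

namespace GraphClass

open Val (ofList ofBool ofNat ofSet ofGraph ofFinBGraph ofFamily ofDecomp)

/-- An input of `H`-deletion with a tree `H`-decomposition. -/
structure DecompInput (H : GraphClass) where
  n : ℕ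
  N : ℕ
  graph : SimpleGraph (Fin n)
  decomp : DecompData n N
  isTreeDecomp : decomp.IsTreeDecomp H graph

namespace DecompInput

variable {H : GraphClass} {f : ℕ → ℕ → ℕ} {v : ℕ → ℕ}

/-- The encoding of an input. -/
noncomputable def encode (I : H.DecompInput) : Val := .pair (ofGraph I.graph) (ofDecomp I.decomp)

/-- The width, plus one. -/
def k (I : H.DecompInput) : ℕ := I.decomp.width + 1

/-- The parameters in the running time. -/
noncomputable def scale (f : ℕ → ℕ → ℕ) (v : ℕ → ℕ) (I : H.DecompInput) : ℕ × ℕ :=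
  (f I.k (H.repSize I.k), I.n + I.N + 2 ^ I.k + v I.k)

theorem le_scale (I : H.DecompInput) : I.n + I.N + 2 ^ I.k + v I.k ≤ (scale f v I).2 := le_rfl

end DecompInput

variable {H : GraphClass} {f : ℕ → ℕ → ℕ} {v : ℕ → ℕ}

/-- A run takes at least one step, already on the graph without vertices. Positivity is needed to
absorb `f + 1` into a multiple of `f`. -/
theorem DisjointDeletionInTime.one_le (h : H.DisjointDeletionInTime f) (hered : H.Hereditary) {V : Type}
    [Finite V] {G : SimpleGraph V} (hG : H.Mem G) (s l : ℕ) : 1 ≤ f s l := by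
  obtain ⟨p, c, hp⟩ := h
  obtain ⟨ans, -, hr⟩ := hp 0 ⊥ s l ∅ (Nat.zero_le _)
    (hered.of_embedding ⟨⟨fun v => v.1.elim0, fun v => v.1.elim0⟩, fun {v} => v.1.elim0⟩ hG)
  exact Nat.pos_of_mul_pos_right hr.one_le

theorem DeletionInTime.of_comp (disj : H.DisjointDeletionInTime f) (hered : H.Hereditary)
    (hv : ∀ k, 1 ≤ v k) (out : ∀ I : H.DecompInput, Finset (Fin I.n))
    (hout : ∀ I : H.DecompInput, H.IsMinDeletionSet I.graph (out I))
    (h : Comp (DecompInput.scale (H := H) f v) DecompInput.encode fun I => ofSet (out I)) :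
    ∃ c : ℕ, H.DeletionInTime fun k n N =>
      2 ^ (c * k) * f k (H.repSize k) * v k ^ c * (n + N + 2) ^ c := by
  obtain ⟨p, c, hp⟩ := h
  refine ⟨3 * c + 1, p, fun n N G D k hD hk => ?_⟩
  let I : H.DecompInput := ⟨n, N, G, D, hD⟩
  refine ⟨out I, hout I, (hp I).mono ?_⟩
  have hf := disj.one_le hered (hD.base_mem D.root) k (H.repSize k)
  have hIk : I.k = k := hk
  have h1k : 1 ≤ k := by omega
  have hvk := hv k
  simp only [cost, DecompInput.scale, hIk]
  have h2 : 2 ≤ 2 ^ k := by simpa using Nat.pow_le_pow_right (n := 2) (by norm_num) h1k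
  -- Each of `n + N + 2`, `2 ^ k` and `v k` is at most `2 ^ k * v k * (n + N + 2)`, and the
  -- remaining factor `2 ^ (2 * k)` is at least `4` because `k ≥ 1`.
  have hM : n + N + 2 ^ k + v k + 2 ≤ 2 ^ (3 * k) * v k * (n + N + 2) := by
    have e1 : 2 ^ (3 * k) = 2 ^ k * 2 ^ k * 2 ^ k := by rw [← pow_add, ← pow_add]; congr 1; ring
    have e2 : n + N + 2 ≤ 2 ^ k * v k * (n + N + 2) := Nat.le_mul_of_pos_left _ (by positivity)
    have e3 : 2 ^ k ≤ 2 ^ k * v k * (n + N + 2) := by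
      rw [mul_assoc]; exact Nat.le_mul_of_pos_right _ (by positivity)
    have e4 : v k ≤ 2 ^ k * v k * (n + N + 2) := by
      rw [mul_comm (2 ^ k), mul_assoc]; exact Nat.le_mul_of_pos_right _ (by positivity)
    have e5 : 4 * (2 ^ k * v k * (n + N + 2)) ≤ 2 ^ (3 * k) * v k * (n + N + 2) := by
      rw [e1, ← mul_assoc, ← mul_assoc]
      gcongr
      nlinarith
    omega
  calc (f k (H.repSize k) + 1) * (n + N + 2 ^ k + v k + 2) ^ c
      ≤ (2 ^ k * f k (H.repSize k)) * (2 ^ (3 * k) * v k * (n + N + 2)) ^ c := by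
        refine Nat.mul_le_mul ?_ (Nat.pow_le_pow_left hM c)
        nlinarith
    _ = 2 ^ ((3 * c + 1) * k) * f k (H.repSize k) * v k ^ c * (n + N + 2) ^ c := by
        rw [mul_pow, mul_pow, ← pow_mul, show (3 * c + 1) * k = 3 * k * c + k by ring, pow_add]
        ring
    _ ≤ _ := by
        gcongr <;> omega

namespace DecompInput

theorem comp_graph : Comp (scale (H := H) f v) encode fun I => ofGraph I.graph := .fst .refl

theorem comp_decomp : Comp (scale (H := H) f v) encode fun I => ofDecomp I.decomp :=
  .snd (a := fun I : H.DecompInput => ofGraph I.graph) .refl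

theorem comp_n : CompNum (scale (H := H) f v) encode n :=
  comp_graph.order (PolyBdd.scale.mono fun I => by
    have := I.le_scale (f := f) (v := v)
    have := Nat.two_pow_pos I.k
    omega)

theorem comp_N : CompNum (scale (H := H) f v) encode N :=
  (DecompData.comp_tree comp_decomp).order (PolyBdd.scale.mono fun I => by
    have := I.le_scale (f := f) (v := v)
    have := Nat.two_pow_pos I.k
    omega)

theorem comp_k : CompNum (scale (H := H) f v) encode k :=
  (DecompData.comp_width comp_decomp comp_n comp_N).add (.const 1)

end DecompInput

/-- By heredity no graph with a vertex is in `H`, so the whole vertex set is the only possible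
deletion set. It is one, because the decomposition exhibits some member of `H` and thus the graph
without vertices is in `H`. -/
theorem deletionInTime_of_not_mem (hered : H.Hereditary) (disj : H.DisjointDeletionInTime f)
    (hv : ∀ k, 1 ≤ v k) (one : ¬H.Mem (⊥ : SimpleGraph Unit)) :
    ∃ c : ℕ, H.DeletionInTime fun k n N =>
      2 ^ (c * k) * f k (H.repSize k) * v k ^ c * (n + N + 2) ^ c := by
  refine DeletionInTime.of_comp disj hered hv (fun I => Finset.univ) (fun I => ⟨?_, fun S hS => ?_⟩)
    (Comp.set_of (fun _ _ => True) DecompInput.comp_n .true_ fun i v => by simp)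
  · exact hered.of_embedding ⟨⟨fun v => absurd (Finset.mem_univ v.1) v.2,
      fun v => absurd (Finset.mem_univ v.1) v.2⟩, fun {v} => absurd (Finset.mem_univ v.1) v.2⟩
      (I.isTreeDecomp.base_mem I.decomp.root)
  · refine Finset.card_le_card fun v _ => ?_
    by_contra hv
    exact one (hered.of_embedding (G' := I.graph.induce ((S : Set (Fin I.n))ᶜ))
      ⟨⟨fun _ => ⟨v, hv⟩, fun _ _ _ => rfl⟩, by simp⟩ hS)

theorem RepFamilyInTime.deletionInTime (hered : H.Hereditary) (union : H.UnionClosed)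
    (disj : H.DisjointDeletionInTime f) (h : H.RepFamilyInTime v) :
    ∃ c : ℕ, H.DeletionInTime fun k n N =>
      2 ^ (c * k) * f k (H.repSize k) * v k ^ c * (n + N + 2) ^ c := by
  obtain ⟨q, hq⟩ := h
  choose F hF hrun using hq
  have hv : ∀ k, 1 ≤ v k := fun k => (hrun k).one_le
  by_cases one : H.Mem (⊥ : SimpleGraph Unit)
  swap
  · exact deletionInTime_of_not_mem hered disj hv one
  obtain ⟨A⟩ := disj.solver
  have hFam : Comp (DecompInput.scale (H := H) f v) DecompInput.encode fun I => ofFamily (F I.k) :=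
    DecompInput.comp_k.comp.trans ⟨q, 1, fun I => (hrun I.k).mono (by
      have := I.le_scale (f := f) (v := v)
      refine le_trans ?_ (Nat.le_mul_of_pos_left _ (Nat.succ_pos _))
      have := Nat.two_pow_pos I.k
      rw [pow_one]
      omega)⟩
  have hheight : ∀ k, (ofFamily (F k)).height ≤ k + v k := fun k => by
    obtain ⟨t, ht, hr⟩ := hrun k
    have := hr.height_le
    rw [Val.height_ofNat] at this
    omega
  -- The `+ 1` makes room for the empty boundaried graph that is put in front of the family.
  have hb : PolyBdd (DecompInput.scale (H := H) f v) fun I => 2 ^ I.k + v I.k + 1 :=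
    (PolyBdd.scale.add (.const 1)).mono fun I => by
      have := I.le_scale (f := f) (v := v)
      omega
  have hlt : ∀ k : ℕ, k ≤ 2 ^ k := fun k => Nat.lt_two_pow_self.le
  have hlen : ∀ k, (F k).length ≤ 2 ^ k + v k := fun k => by
    have := (Val.length_le_height_ofFamily (F k)).trans (hheight k)
    have := hlt k
    omega
  have hsize : ∀ k, ∀ R ∈ F k, R.2.n ≤ 2 ^ k + v k := fun k R hR => by
    have := (Val.n_le_height_ofFamily hR).trans (hheight k)
    have := hlt k
    omega
  have hl : CompNum (DecompInput.scale (H := H) f v) DecompInput.encode fun I => H.repSize I.k :=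
    (Comp.largest hFam (hb.mono fun I => (hlen I.k).trans (Nat.le_succ _)) hb
      fun I R hR => (hsize I.k R hR).trans (Nat.le_succ _)).congr fun I => (hF I.k).largest_n
  have hcomp : ∀ I : H.DecompInput, H.IsComplete I.k (H.repSize I.k) (⟨0, .empty⟩ :: F I.k) :=
    fun I => (hF I.k).isComplete hered union
  refine DeletionInTime.of_comp disj hered hv
    (fun I => I.decomp.output A I.graph (⟨0, .empty⟩ :: F I.k) I.k (H.repSize I.k))
    (fun I => I.isTreeDecomp.isMinDeletionSet_output A hered union one (hcomp I) rfl) ?_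
  refine DecompData.comp_output A hered union one (F := fun I : H.DecompInput => ⟨0, .empty⟩ :: F I.k)
    DecompInput.comp_decomp DecompInput.comp_n DecompInput.comp_N DecompInput.comp_graph
    (Comp.empty.cons hFam) DecompInput.comp_k hl ⟨0, fun I => ?_⟩ hb (fun I => ?_) (fun I R hR => ?_)
    (fun I => (hcomp I).size_le) (fun I t => ?_) fun I t => I.isTreeDecomp.base_mem t
  · simp [cost, DecompInput.scale]
  · exact Nat.succ_le_succ (hlen I.k)
  · rcases List.mem_cons.1 hR with rfl | hR
    · exact Nat.zero_le _
    · exact (hsize I.k R hR).trans (Nat.le_succ _)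
  · have : 2 ^ (I.decomp.outer t).card ≤ 2 ^ I.k :=
      Nat.pow_le_pow_right (by norm_num) (DecompData.card_outer_le rfl t)
    omega

end GraphClass

/-! ### Isomorphic boundaried graphs and minimal representatives -/

namespace BGraph

variable {t : ℕ}

/-- An isomorphism of the first summand that fixes the labels extends to the gluing. -/
def glueCongr {A A' : BGraph t} (φ : A.graph ≃g A'.graph) (hφ : ∀ i, φ (A.bd i) = A'.bd i)
    (B : BGraph t) : A.glue B ≃g A'.glue B where
  toEquiv := Equiv.sumCongr φ.toEquiv (Equiv.refl _)
  map_rel_iff' := by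
    have hrep : ∀ x b, GlueRep A' B (Equiv.sumCongr φ.toEquiv (Equiv.refl _) x) b ↔ GlueRep A B x b := by
      rintro (a | v) b
      · simp only [Equiv.sumCongr_apply, Sum.map_inl, GlueRep, ← hφ]
        exact exists_congr fun i => and_congr_left fun _ => φ.injective.eq_iff
      · exact Iff.rfl
    rintro x y
    simp only [glue, hrep]
    refine or_congr_left ⟨?_, ?_⟩
    · rintro ⟨a, a', hx, hy, h⟩
      rcases x with x | x <;> rcases y with y | y <;> simp at hx hy
      subst hx hy
      exact ⟨x, y, rfl, rfl, φ.map_rel_iff.1 h⟩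
    · rintro ⟨a, a', rfl, rfl, h⟩
      exact ⟨φ a, φ a', rfl, rfl, φ.map_rel_iff.2 h⟩

/-- The first summand of a gluing is an induced subgraph. -/
def Compatible.glueInl {A B : BGraph t} (h : A.Compatible B) : A.graph ↪g A.glue B where
  toFun := Sum.inl
  inj' := Sum.inl_injective
  map_rel_iff' := by
    intro a a'
    refine ⟨?_, fun h => Or.inl ⟨a, a', rfl, rfl, h⟩⟩
    rintro (⟨b, b', hb, hb', hadj⟩ | ⟨b, b', ⟨i, rfl, rfl⟩, ⟨j, rfl, rfl⟩, hadj⟩)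
    · rw [Function.Embedding.coeFn_mk, Sum.inl.injEq] at hb hb'
      rwa [hb, hb']
    · exact (h i j).2 hadj

theorem Compatible.symm {A B : BGraph t} (h : A.Compatible B) : B.Compatible A := fun i j => (h i j).symm

theorem Compatible.trans {A B C : BGraph t} (h : A.Compatible B) (h' : B.Compatible C) : A.Compatible C :=
  fun i j => (h i j).trans (h' i j)

/-- The subgraph induced by the boundary. -/
def boundary (A : BGraph t) : BGraph t where
  V := Fin t
  graph := A.graph.comap A.bd
  bd := .refl _

theorem compatible_boundary (A : BGraph t) : A.Compatible A.boundary := fun _ _ => Iff.rfl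

end BGraph

namespace GraphClass

variable {H : GraphClass} {t k : ℕ}

theorem Equivalent.of_iso {A A' : BGraph t} (φ : A.graph ≃g A'.graph) (hφ : ∀ i, φ (A.bd i) = A'.bd i) :
    H.Equivalent A A' :=
  ⟨fun i j => by rw [← hφ, ← hφ, φ.map_adj_iff], fun C _ =>
    ⟨H.mem_of_iso (BGraph.glueCongr φ hφ C), H.mem_of_iso (BGraph.glueCongr φ hφ C).symm⟩⟩

/-- The bare boundary is neutral for gluing. Membership of the graph itself thus becomes one of the
tests in the definition of equivalence, and is preserved by it. -/
theorem mem_glue_boundary (hered : H.Hereditary) {A B : BGraph t} (h : A.Compatible B) :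
    H.Mem (A.glue B.boundary) ↔ H.Mem A.graph := by
  have hc := h.trans B.compatible_boundary
  refine ⟨hered.of_embedding hc.glueInl, H.mem_of_iso (RelIso.ofSurjective hc.glueInl ?_)⟩
  rintro (a | v)
  · exact ⟨a, rfl⟩
  · exact absurd ⟨v.1, rfl⟩ v.2

theorem Equivalent.mem_iff (hered : H.Hereditary) {A B : BGraph t} (h : H.Equivalent A B) :
    H.Mem A.graph ↔ H.Mem B.graph := by
  rw [← mem_glue_boundary hered (A := A) (B := A) fun _ _ => Iff.rfl, h.2 _ A.compatible_boundary,
    mem_glue_boundary hered h.1.symm]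

theorem Equivalent.mem_glue_right {A B C : BGraph t} (h : H.Equivalent B C) (hA : A.Compatible B) :
    H.Mem (A.glue B) ↔ H.Mem (A.glue C) := by
  rw [mem_glue_comm, h.2 A hA.symm, mem_glue_comm]

/-- The order of a minimal representative is the least order in its class, so each of the finitely
many classes contributes at most one value. Hence `repSize` really bounds all these orders. -/
theorem FiniteState.bddAbove (fin : H.FiniteState) (k : ℕ) :
    BddAbove {m : ℕ | ∃ t : ℕ, 1 ≤ t ∧ t ≤ k ∧ ∃ A : BGraph t, H.IsMinRep A ∧ Nat.card A.V = m} := by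
  have : ∀ t, Finite (Quotient (H.equivSetoid t)) := fin
  let g : ∀ t, Quotient (H.equivSetoid t) → ℕ := fun t q =>
    sInf {m | ∃ B : BGraph t, Quotient.mk (H.equivSetoid t) B = q ∧ Nat.card B.V = m}
  refine ((Set.finite_Icc 1 k).biUnion fun t _ => Set.finite_range (g t)).bddAbove.mono ?_
  rintro m ⟨t, h1, hk, A, hA, rfl⟩
  refine Set.mem_biUnion (Set.mem_Icc.2 ⟨h1, hk⟩) ⟨Quotient.mk _ A, ?_⟩
  refine le_antisymm (Nat.sInf_le ⟨A, rfl, rfl⟩) (le_csInf ⟨_, A, rfl, rfl⟩ ?_)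
  rintro m ⟨B, hB, rfl⟩
  exact hA.2 B (Quotient.exact hB.symm)

theorem FiniteState.exists_isMinRep (fin : H.FiniteState) (hered : H.Hereditary) (h1 : 1 ≤ t) (hk : t ≤ k)
    {A : BGraph t} (hA : H.Mem A.graph) :
    ∃ B : BGraph t, H.IsMinRep B ∧ H.Equivalent A B ∧ Nat.card B.V ≤ H.repSize k := by
  classical
  have hex : ∃ m, ∃ B : BGraph t, H.Equivalent A B ∧ Nat.card B.V = m := ⟨_, A, (H.equivSetoid t).refl A, rfl⟩
  obtain ⟨B, hAB, hB⟩ := Nat.find_spec hex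
  have hmin : H.IsMinRep B := ⟨(hAB.mem_iff hered).1 hA, fun C hC => by
    rw [hB]
    exact Nat.find_min' hex ⟨C, (H.equivSetoid t).trans hAB hC, rfl⟩⟩
  exact ⟨B, hmin, hAB, le_csSup (fin.bddAbove k) ⟨t, h1, hk, B, hmin, rfl⟩⟩

end GraphClass

/-! ### All small boundaried graphs -/

/-- All ordered pairs. -/
def allPairs (m : ℕ) : List (Fin m × Fin m) :=
  (List.finRange m).flatMap fun u => (List.finRange m).map fun v => (u, v)

theorem length_allPairs (m : ℕ) : (allPairs m).length = m ^ 2 := by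
  simp [allPairs, List.length_flatMap, sq]

/-- All graphs on `m` vertices. -/
def allGraphs (m : ℕ) : List (SimpleGraph (Fin m)) :=
  subApply (fun (p : Fin m × Fin m) G => G ⊔ SimpleGraph.edge p.1 p.2) (allPairs m) ⊥

theorem length_allGraphs (m : ℕ) : (allGraphs m).length = 2 ^ m ^ 2 := by
  rw [allGraphs, length_subApply, length_allPairs]

theorem mem_allGraphs {m : ℕ} (G : SimpleGraph (Fin m)) : G ∈ allGraphs m := by
  classical
  have key : ∀ (l : List (Fin m × Fin m)) (G₀ : SimpleGraph (Fin m)) (u v : Fin m),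
      (l.foldl (fun G p => G ⊔ SimpleGraph.edge p.1 p.2) G₀).Adj u v ↔
        G₀.Adj u v ∨ u ≠ v ∧ ((u, v) ∈ l ∨ (v, u) ∈ l) := by
    intro l
    induction l with
    | nil => simp
    | cons p l ih =>
      intro G₀ u v
      rw [List.foldl_cons, ih, SimpleGraph.sup_adj, SimpleGraph.edge_adj]
      simp only [List.mem_cons, Prod.ext_iff]
      grind
  have h := mem_subApply (op := fun (p : Fin m × Fin m) G => G ⊔ SimpleGraph.edge p.1 p.2)
    (l := allPairs m) (b := ⊥) fun p => decide (G.Adj p.1 p.2)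
  have hmem : ∀ p, p ∈ allPairs m := fun p => by simp [allPairs]
  refine Eq.subst (motive := (· ∈ allGraphs m)) ?_ h
  ext u v
  rw [key]
  simp only [SimpleGraph.bot_adj, false_or, List.mem_filter, hmem, true_and, decide_eq_true_eq]
  exact ⟨fun h => h.2.elim id .symm, fun h => ⟨h.ne, .inl h⟩⟩

/-- The boundaried graphs with `t` boundary vertices, which come first, and at most `l` vertices. -/
def smallBGraphs (l t : ℕ) : List (FinBGraph t) :=
  (List.finRange (l + 1 - t)).flatMap fun d : Fin (l + 1 - t) =>
    (allGraphs (t + d)).map fun G => ⟨t + d, G, Fin.castAddEmb (d : ℕ)⟩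

theorem mem_smallBGraphs {l t : ℕ} {R : FinBGraph t} :
    R ∈ smallBGraphs l t ↔ ∃ (d : ℕ) (G : SimpleGraph (Fin (t + d))), t + d ≤ l ∧
      R = ⟨t + d, G, Fin.castAddEmb d⟩ := by
  simp only [smallBGraphs, List.mem_flatMap, List.mem_finRange, true_and, List.mem_map, mem_allGraphs]
  constructor
  · rintro ⟨d, G, rfl⟩
    exact ⟨d, G, by omega, rfl⟩
  · rintro ⟨d, G, hd, rfl⟩
    exact ⟨⟨d, by omega⟩, G, rfl⟩

theorem n_le_of_mem_smallBGraphs {l t : ℕ} {R : FinBGraph t} (h : R ∈ smallBGraphs l t) : R.n ≤ l := by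
  obtain ⟨d, G, hd, rfl⟩ := mem_smallBGraphs.1 h
  exact hd

theorem length_smallBGraphs_le (l t : ℕ) : (smallBGraphs l t).length ≤ (l + 1) * 2 ^ l ^ 2 := by
  refine (GraphClass.length_flatMap_le (m := 2 ^ l ^ 2) fun d _ => ?_).trans
    (Nat.mul_le_mul_right _ (by simp))
  rw [List.length_map, length_allGraphs]
  gcongr
  · norm_num
  · omega

/-- Number the vertices with the boundary first, in the order of the labels. The labelling is then
fixed and need not be enumerated along with the graphs. -/
theorem BGraph.exists_smallBGraph {t l : ℕ} (A : BGraph t) (h : Nat.card A.V ≤ l) :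
    ∃ R ∈ smallBGraphs l t, ∃ φ : A.graph ≃g R.toBGraph.graph, ∀ i, φ (A.bd i) = R.toBGraph.bd i := by
  classical
  have := Fintype.ofFinite A.V
  obtain ⟨d, hd⟩ := Nat.exists_eq_add_of_le (Nat.card_le_card_of_injective A.bd A.bd.injective)
  rw [Nat.card_eq_fintype_card (α := Fin t), Fintype.card_fin] at hd
  have hcompl : Nat.card ((Set.range A.bd)ᶜ : Set A.V) = d := by
    have h1 := Nat.card_congr (Equiv.Set.sumCompl (Set.range A.bd))
    rw [Nat.card_sum, ← Nat.card_congr (Equiv.ofInjective _ A.bd.injective), hd,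
      Nat.card_eq_fintype_card (α := Fin t), Fintype.card_fin] at h1
    omega
  let e : Fin (t + d) ≃ A.V := finSumFinEquiv.symm.trans
    ((Equiv.sumCongr (Equiv.ofInjective _ A.bd.injective) (Finite.equivFinOfCardEq hcompl).symm).trans
      (Equiv.Set.sumCompl (Set.range A.bd)))
  have he : ∀ i, e (Fin.castAdd d i) = A.bd i := fun i => by simp [e]
  refine ⟨⟨t + d, A.graph.comap e, Fin.castAddEmb d⟩,
    mem_smallBGraphs.2 ⟨d, _, hd ▸ h, rfl⟩, (SimpleGraph.Iso.comap e A.graph).symm, fun i => ?_⟩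
  change e.symm (A.bd i) = Fin.castAdd d i
  rw [← he, Equiv.symm_apply_apply]

/-! ### The brute-force representative family -/

namespace GraphClass

variable {H : GraphClass} {t k l : ℕ}

theorem FiniteState.exists_small (fin : H.FiniteState) (hered : H.Hereditary) (h1 : 1 ≤ t) (hk : t ≤ k)
    (hl : H.repSize k ≤ l) {A : BGraph t} (hA : H.Mem A.graph) :
    ∃ R ∈ smallBGraphs l t, H.IsMinRep R.toBGraph ∧ H.Equivalent A R.toBGraph := by
  obtain ⟨B, hB, hAB, hcard⟩ := fin.exists_isMinRep hered h1 hk hA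
  obtain ⟨R, hR, φ, hφ⟩ := B.exists_smallBGraph (hcard.trans hl)
  have hBR : H.Equivalent B R.toBGraph := .of_iso φ hφ
  refine ⟨R, hR, ⟨(hBR.mem_iff hered).1 hB.1, fun C hC => ?_⟩, (H.equivSetoid t).trans hAB hBR⟩
  rw [← Nat.card_congr φ.toEquiv]
  exact hB.2 C ((H.equivSetoid t).trans hBR hC)

open scoped Classical in
/-- All small minimal representatives, with boundaries of size at most `k`. -/
noncomputable def smallMinReps (H : GraphClass) (k l : ℕ) : List (Σ t : ℕ, FinBGraph t) :=
  (List.finRange k).flatMap fun j : Fin k => ((smallBGraphs l ((j : ℕ) + 1)).filter fun R =>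
    propBit (H.IsMinRep R.toBGraph)).map fun R => ⟨(j : ℕ) + 1, R⟩

theorem mem_smallMinReps {R : FinBGraph t} : ⟨t, R⟩ ∈ H.smallMinReps k l ↔
    1 ≤ t ∧ t ≤ k ∧ R ∈ smallBGraphs l t ∧ H.IsMinRep R.toBGraph := by
  simp only [smallMinReps, List.mem_flatMap, List.mem_finRange, true_and, List.mem_map, List.mem_filter,
    propBit_eq_true]
  constructor
  · rintro ⟨j, R', ⟨hR, hmin⟩, h⟩
    cases h
    exact ⟨by omega, by omega, hR, hmin⟩
  · rintro ⟨h1, hk, hR, hmin⟩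
    obtain ⟨j, rfl⟩ := Nat.exists_eq_add_of_le' h1
    exact ⟨⟨j, by omega⟩, R, ⟨hR, hmin⟩, rfl⟩

theorem FiniteState.isRepFamily_smallMinReps (fin : H.FiniteState) (hered : H.Hereditary)
    (hl : H.repSize k ≤ l) : H.IsRepFamily k (H.smallMinReps k l) := by
  refine ⟨fun ⟨t, R⟩ hR => ?_, fun t h1 hk A hA => ?_⟩
  · obtain ⟨h1, hk, -, hmin⟩ := mem_smallMinReps.1 hR
    exact ⟨h1, hk, hmin⟩
  · obtain ⟨R, hR, hmin, he⟩ := fin.exists_small hered h1 hk hl hA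
    exact ⟨R, mem_smallMinReps.2 ⟨h1, hk, hR, hmin⟩, (H.equivSetoid t).symm he⟩

/-- If `C` is in `H`, it may be replaced by a small equivalent graph, since by commutativity
equivalence can be applied to the second summand too. If `C` is not in `H`, it separates nothing:
both gluings contain it as an induced subgraph. -/
theorem FiniteState.equivalent_iff (fin : H.FiniteState) (hered : H.Hereditary) (h1 : 1 ≤ t) (hk : t ≤ k)
    (hl : H.repSize k ≤ l) {A B : BGraph t} : H.Equivalent A B ↔ A.Compatible B ∧
      ∀ C ∈ smallBGraphs l t, A.Compatible C.toBGraph →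
        (H.Mem (A.glue C.toBGraph) ↔ H.Mem (B.glue C.toBGraph)) := by
  refine and_congr_right fun hAB => ⟨fun h C _ => h C.toBGraph, fun h C hC => ?_⟩
  by_cases hCm : H.Mem C.graph
  · obtain ⟨R, hR, -, he⟩ := fin.exists_small hered h1 hk hl hCm
    rw [he.mem_glue_right hC, he.mem_glue_right (hAB.symm.trans hC)]
    exact h R hR (hC.trans he.1)
  · have hno : ∀ {D : BGraph t}, D.Compatible C → ¬H.Mem (D.glue C) := fun hD hm =>
      hCm (hered.of_embedding hD.symm.glueInl ((mem_glue_comm _ _).1 hm))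
    exact iff_of_false (hno hC) (hno (hAB.symm.trans hC))

/-- A competitor `B` of arbitrary size is beaten or matched by a listed minimal representative of
its class, so comparison with listed graphs is enough. -/
theorem FiniteState.isMinRep_iff (fin : H.FiniteState) (hered : H.Hereditary) (h1 : 1 ≤ t) (hk : t ≤ k)
    (hl : H.repSize k ≤ l) {A : FinBGraph t} : H.IsMinRep A.toBGraph ↔ H.Mem A.graph ∧
      ∀ B ∈ smallBGraphs l t, H.Equivalent A.toBGraph B.toBGraph → A.n ≤ B.n := by
  have hcard : ∀ R : FinBGraph t, Nat.card R.toBGraph.V = R.n := fun R => by simp [FinBGraph.toBGraph]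
  refine and_congr_right fun hA => ⟨fun h B _ hB => ?_, fun h B hB => ?_⟩
  · rw [← hcard, ← hcard]
    exact h _ hB
  · obtain ⟨R, hR, hmin, he⟩ := fin.exists_small hered h1 hk hl ((hB.mem_iff hered).1 hA)
    rw [hcard]
    refine (h R hR ((H.equivSetoid t).trans hB he)).trans ?_
    rw [← hcard]
    exact hmin.2 B ((H.equivSetoid t).symm he)

/-- The boundary of `C` consists of its first `t` vertices in order, so being the `i`-th boundary
vertex means having index `i`. This reduces the equivalence test to `glueGraph`, for which
membership is computable. -/
theorem mem_glue_iff_glueGraph (hered : H.Hereditary) (union : H.UnionClosed)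
    (one : H.Mem (⊥ : SimpleGraph Unit)) {A C : FinBGraph t} (hC : C ∈ smallBGraphs l t)
    (h : A.toBGraph.Compatible C.toBGraph) : H.Mem (A.toBGraph.glue C.toBGraph) ↔
      H.Mem (glueGraph C.graph Finset.univ (Finset.univ.filter fun u : Fin C.n => (u : ℕ) < t) A) := by
  obtain ⟨d, G, hd, rfl⟩ := mem_smallBGraphs.1 hC
  change _ ↔ H.Mem (glueGraph G Finset.univ (Finset.univ.filter fun u : Fin (t + d) => (u : ℕ) < t) A)
  rw [← mem_glueGraph (G := G) (S := Finset.univ) hered union one (x := Fin.castAddEmb d)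
    (fun i => by simp) (fun u i => ?_) fun i j => h i j]
  · refine Equivalent.mem_glue_right (.of_iso ⟨(Equiv.Set.univ _).symm.trans (Equiv.setCongr (Finset.coe_univ (α := Fin (t + d))).symm), ?_⟩
      fun i => ?_) h
    · exact Iff.rfl
    · rfl
  · unfold IsNth
    have hfil : ((Finset.univ.filter fun u : Fin (t + d) => (u : ℕ) < t).filter (· < u)).card =
        min t u := by
      rw [Finset.filter_filter]
      trans (Finset.univ.filter fun v : Fin (t + d) => (v : ℕ) < min t u).card
      · congr 1
        ext v
        simp
      · rw [Fin.card_filter_val_lt]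
        omega
    rw [hfil]
    simp only [Finset.mem_filter, Finset.mem_univ, true_and, Fin.ext_iff, Fin.castAddEmb_apply,
      Fin.val_castAdd]
    omega

end GraphClass

/-! ### Computing the brute-force family -/

namespace Comp

open Val (ofList ofBool ofNat ofSet ofGraph ofFinBGraph ofFamily)

variable {ι : Type} {B : ι → ℕ × ℕ} {e : ι → Val} {m t l : ι → ℕ}

theorem allPairs (hm : CompNum B e m) : Comp B e fun i =>
    ofList ((_root_.allPairs (m i)).map fun p => .pair (ofNat p.1) (ofNat p.2)) := by
  refine flatMap (enc := fun i (u : Fin (m i)) => ofNat (u : ℕ)) (m := m)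
    (enc' := fun i (p : Fin (m i) × Fin (m i)) => .pair (ofNat p.1) (ofNat p.2))
    (hm.bdd.mono fun i => by simp) hm.bdd (fun i u _ => by simp) hm.finRange ?_
  have hm' : CompNum (fun p : Σ i, {u : Fin (m i) // u ∈ List.finRange (m i)} => B p.1)
    (fun p => .pair (e p.1) (ofNat p.2.1)) fun p => m p.1 := hm.up
  refine (map (L := fun p => List.finRange (m p.1))
    (g := fun (p : Σ i, {u : Fin (m i) // u ∈ List.finRange (m i)}) (v : Fin (m p.1)) =>
      .pair (ofNat p.2.1) (ofNat v))
    (hm'.bdd.mono fun p => by simp) hm'.finRange (.pair refl.fst.snd refl.snd)).congr fun p => ?_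
  rw [List.map_map]
  rfl

theorem edge {u v : ∀ i, Fin (m i)} {G : ∀ i, SimpleGraph (Fin (m i))} (hm : CompNum B e m)
    (hu : CompNum B e fun i => (u i : ℕ)) (hv : CompNum B e fun i => (v i : ℕ))
    (hG : Comp B e fun i => ofGraph (G i)) :
    Comp B e fun i => ofGraph (G i ⊔ SimpleGraph.edge (u i) (v i)) := by
  refine graph_of (fun i a b => (G i).Adj a b ∨ ((a = u i ∧ b = v i ∨ a = v i ∧ b = u i) ∧ ¬a = b)) hm ?_
    fun i a b => by rw [SimpleGraph.sup_adj, SimpleGraph.edge_adj]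
  have ha := hm.var.upF (n := fun p : Σ i, Fin (m i) => m p.1)
  have hb := hm.upF.var (n := fun p : Σ i, Fin (m i) => m p.1)
  refine Comp.or ?_ (Comp.and (Comp.or (Comp.and ?_ ?_) (Comp.and ?_ ?_)) (Comp.not ?_))
  · exact adj hG.upF.upF ha hb
  · exact ha.fin_eq hu.upF.upF
  · exact hb.fin_eq hv.upF.upF
  · exact ha.fin_eq hv.upF.upF
  · exact hb.fin_eq hu.upF.upF
  · exact ha.fin_eq hb

theorem allGraphs (hm : CompNum B e m) (h2 : PolyBdd B fun i => 2 ^ m i ^ 2) :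
    Comp B e fun i => ofList ((_root_.allGraphs (m i)).map ofGraph) := by
  refine subApply (op := fun i (p : Fin (m i) × Fin (m i)) G => G ⊔ SimpleGraph.edge p.1 p.2)
    (b := fun i => (⊥ : SimpleGraph (Fin (m i)))) (enc' := fun i => ofGraph)
    ((hm.bdd.pow 2).mono fun i => (length_allPairs _).le) (h2.mono fun i => by rw [length_allPairs])
    (allPairs hm) (graph_of (fun _ _ _ => False) hm .false_ fun i u v => by simp) ?_
  have hm' : CompNum (fun p : Σ i, (Fin (m i) × Fin (m i)) × SimpleGraph (Fin (m i)) => B p.1)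
    (fun p => .pair (e p.1) (.pair (.pair (ofNat p.2.1.1) (ofNat p.2.1.2)) (ofGraph p.2.2)))
    fun p => m p.1 := hm.up
  exact edge hm' ⟨refl.snd.fst.fst, hm'.bdd.mono fun p => p.2.1.1.2.le⟩
    ⟨refl.snd.fst.snd, hm'.bdd.mono fun p => p.2.1.2.2.le⟩ refl.snd.snd

theorem smallBGraphs (ht : CompNum B e t) (hl : CompNum B e l) (h2 : PolyBdd B fun i => 2 ^ l i ^ 2) :
    Comp B e fun i => ofList ((_root_.smallBGraphs (l i) (t i)).map ofFinBGraph) := by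
  have hd := (hl.add (.const 1)).tsub ht
  refine flatMap (enc := fun i (d : Fin (l i + 1 - t i)) => ofNat (d : ℕ)) (m := fun i => 2 ^ l i ^ 2)
    (enc' := fun i => ofFinBGraph) (hd.bdd.mono fun i => by simp) h2 (fun i d _ => ?_) hd.finRange ?_
  · rw [List.length_map, length_allGraphs]
    gcongr
    · norm_num
    · omega
  have ht' : CompNum (fun p : Σ i, {d : Fin (l i + 1 - t i) // d ∈ List.finRange (l i + 1 - t i)} => B p.1)
    (fun p => .pair (e p.1) (ofNat p.2.1)) fun p => t p.1 := ht.up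
  have hm : CompNum (fun p : Σ i, {d : Fin (l i + 1 - t i) // d ∈ List.finRange (l i + 1 - t i)} => B p.1)
      (fun p => .pair (e p.1) (ofNat p.2.1)) fun p => t p.1 + p.2.1 :=
    ht'.add ⟨refl.snd, hd.bdd.up.mono fun p => p.2.1.2.le⟩
  have h2' : PolyBdd (fun p : Σ i, {d : Fin (l i + 1 - t i) // d ∈ List.finRange (l i + 1 - t i)} => B p.1)
      fun p => 2 ^ (t p.1 + p.2.1) ^ 2 := h2.up.mono fun p => by
    gcongr
    · norm_num
    · omega
  refine (map (L := fun p => _root_.allGraphs (t p.1 + p.2.1)) (enc := fun _ => ofGraph)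
    (g := fun p G => ofFinBGraph ⟨t p.1 + p.2.1, G, Fin.castAddEmb p.2.1⟩)
    (h2'.mono fun p => (length_allGraphs _).le) (allGraphs hm h2') ?_).congr fun p => ?_
  · refine refl.snd.pair ((ht'.upL (L := fun p => _root_.allGraphs (t p.1 + p.2.1))
      fun _ => ofGraph).tabulate (g := fun p i => ofNat i) refl.snd)
  · rw [List.map_map]
    rfl

end Comp

namespace GraphClass

open Val (ofList ofBool ofNat ofSet ofGraph ofFinBGraph ofFamily)

variable {H : GraphClass} {f : ℕ → ℕ → ℕ} {ι : Type} {B : ι → ℕ × ℕ} {e : ι → Val} {k l t : ι → ℕ}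
  {R R' C : ∀ i, FinBGraph (t i)}

theorem comp_compatible (ht : CompNum B e t) (hR : Comp B e fun i => ofFinBGraph (R i))
    (hR' : Comp B e fun i => ofFinBGraph (R' i)) (hb : PolyBdd B fun i => (R i).n)
    (hb' : PolyBdd B fun i => (R' i).n) :
    CompProp B e fun i => (R i).toBGraph.Compatible (R' i).toBGraph := by
  have key : ∀ {R : ∀ i, FinBGraph (t i)}, (Comp B e fun i => ofFinBGraph (R i)) →
      (PolyBdd B fun i => (R i).n) → CompProp (fun p : Σ p : (Σ i, Fin (t i)), Fin (t p.1) => B p.1.1)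
      (fun p => .pair (.pair (e p.1.1) (ofNat p.1.2)) (ofNat p.2))
      fun p => (R p.1.1).graph.Adj ((R p.1.1).bd p.1.2) ((R p.1.1).bd p.2) := by
    intro R hR hb
    have hR2 := hR.upF (n := t) |>.upF (n := fun p => t p.1)
    let R2 : (Σ p : (Σ i, Fin (t i)), Fin (t p.1)) → Σ t : ℕ, FinBGraph t := fun p => ⟨t p.1.1, R p.1.1⟩
    exact Comp.adj (Comp.finBGraph_graph (R := R2) hR2)
      (Comp.finBGraph_bd (R := R2) (j := fun p => p.1.2) hR2 hb.up.up ht.var.upF)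
      (Comp.finBGraph_bd (R := R2) (j := fun p => p.2) hR2 hb.up.up ht.upF.var)
  exact ht.forall_fin (ht.upF.forall_fin (P := fun (p : Σ i, Fin (t i)) j =>
    ((R p.1).graph.Adj ((R p.1).bd p.2) ((R p.1).bd j) ↔
      (R' p.1).graph.Adj ((R' p.1).bd p.2) ((R' p.1).bd j))) ((key hR hb).iff (key hR' hb')))

theorem DisjointSolver.comp_mem_glue (A : H.DisjointSolver f) (hered : H.Hereditary)
    (union : H.UnionClosed) (one : H.Mem (⊥ : SimpleGraph Unit)) (ht : CompNum B e t)
    (hR : Comp B e fun i => ofFinBGraph (R i)) (hC : Comp B e fun i => ofFinBGraph (C i))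
    (hb : PolyBdd B fun i => (R i).n) (hbC : PolyBdd B fun i => (C i).n) :
    CompProp B e fun i => H.Mem (glueGraph (C i).graph Finset.univ
      (Finset.univ.filter fun u : Fin (C i).n => (u : ℕ) < t i) (R i)) := by
  have hn : CompNum B e fun i => (C i).n := Comp.finBGraph_n (R := fun i => ⟨t i, C i⟩) hC hbC
  exact A.comp_mem hered union one (Comp.glueGraph (R := fun i => ⟨t i, R i⟩) hn
    (Comp.finBGraph_graph (R := fun i => ⟨t i, C i⟩) hC)
    (Comp.set_of (fun _ _ => True) hn .true_ fun i u => by simp)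
    (Comp.set_of (fun i u => (u : ℕ) < t i) hn (hn.var.lt ht.upF) fun i u => by simp) hR hb)
    (hbC.add hb)

theorem DisjointSolver.comp_equivalent (A : H.DisjointSolver f) (hered : H.Hereditary)
    (union : H.UnionClosed) (one : H.Mem (⊥ : SimpleGraph Unit)) (fin : H.FiniteState)
    (h1 : ∀ i, 1 ≤ t i) (htk : ∀ i, t i ≤ k i) (hkl : ∀ i, H.repSize (k i) ≤ l i)
    (ht : CompNum B e t) (hl : CompNum B e l) (h2 : PolyBdd B fun i => 2 ^ l i ^ 2)
    (hR : Comp B e fun i => ofFinBGraph (R i)) (hR' : Comp B e fun i => ofFinBGraph (R' i))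
    (hb : PolyBdd B fun i => (R i).n) (hb' : PolyBdd B fun i => (R' i).n) :
    CompProp B e fun i => H.Equivalent (R i).toBGraph (R' i).toBGraph := by
  refine Comp.prop_congr (P := fun i => (R i).toBGraph.Compatible (R' i).toBGraph ∧
    ∀ C ∈ smallBGraphs (l i) (t i), (R i).toBGraph.Compatible C.toBGraph →
      (R' i).toBGraph.Compatible C.toBGraph →
      (H.Mem (glueGraph C.graph Finset.univ
        (Finset.univ.filter fun u : Fin C.n => (u : ℕ) < t i) (R i)) ↔
      H.Mem (glueGraph C.graph Finset.univ
        (Finset.univ.filter fun u : Fin C.n => (u : ℕ) < t i) (R' i)))) ?_ fun i => ?_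
  swap
  · rw [fin.equivalent_iff hered (h1 i) (htk i) (hkl i)]
    refine and_congr_right fun hc => forall₂_congr fun C hC => forall_congr' fun hRC => ?_
    have hRC' := hc.symm.trans hRC
    rw [mem_glue_iff_glueGraph hered union one hC hRC, mem_glue_iff_glueGraph hered union one hC hRC']
    exact forall_prop_of_true hRC'
  have hsb : PolyBdd B fun i => (smallBGraphs (l i) (t i)).length :=
    ((hl.add (.const 1)).bdd.mul h2).mono fun i => length_smallBGraphs_le _ _
  refine (comp_compatible ht hR hR' hb hb').and (Comp.forall_mem (enc := fun _ => ofFinBGraph) hsb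
    (Comp.smallBGraphs ht hl h2) ?_)
  let κ := Σ i, {C // C ∈ smallBGraphs (l i) (t i)}
  have ht' := ht.upL (L := fun i => smallBGraphs (l i) (t i)) fun _ => ofFinBGraph
  have hR1 := hR.upL (L := fun i => smallBGraphs (l i) (t i)) fun _ => ofFinBGraph
  have hR1' := hR'.upL (L := fun i => smallBGraphs (l i) (t i)) fun _ => ofFinBGraph
  have hC : Comp (fun p : κ => B p.1) (fun p => .pair (e p.1) (ofFinBGraph p.2.1))
    fun p => ofFinBGraph p.2.1 := .snd .refl
  have hbC : PolyBdd (fun p : κ => B p.1) fun p => p.2.1.n :=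
    hl.bdd.up.mono fun p => n_le_of_mem_smallBGraphs p.2.2
  exact (comp_compatible (R := fun p : κ => R p.1) (R' := fun p => p.2.1) ht' hR1 hC hb.up hbC).imp
    ((comp_compatible (R := fun p : κ => R' p.1) (R' := fun p => p.2.1) ht' hR1' hC hb'.up hbC).imp
      ((A.comp_mem_glue hered union one (R := fun p : κ => R p.1) (C := fun p => p.2.1) ht' hR1 hC
        hb.up hbC).iff
      (A.comp_mem_glue hered union one (R := fun p : κ => R' p.1) (C := fun p => p.2.1) ht' hR1' hC
        hb'.up hbC)))

theorem DisjointSolver.comp_isMinRep (A : H.DisjointSolver f) (hered : H.Hereditary)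
    (union : H.UnionClosed) (one : H.Mem (⊥ : SimpleGraph Unit)) (fin : H.FiniteState)
    (h1 : ∀ i, 1 ≤ t i) (htk : ∀ i, t i ≤ k i) (hkl : ∀ i, H.repSize (k i) ≤ l i)
    (ht : CompNum B e t) (hl : CompNum B e l) (h2 : PolyBdd B fun i => 2 ^ l i ^ 2)
    (hR : Comp B e fun i => ofFinBGraph (R i)) (hb : PolyBdd B fun i => (R i).n) :
    CompProp B e fun i => H.IsMinRep (R i).toBGraph := by
  refine Comp.prop_congr (P := fun i => H.Mem (R i).graph ∧ ∀ R' ∈ smallBGraphs (l i) (t i),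
    H.Equivalent (R i).toBGraph R'.toBGraph → (R i).n ≤ R'.n) ?_ fun i =>
    (fin.isMinRep_iff hered (h1 i) (htk i) (hkl i)).symm
  have hsb : PolyBdd B fun i => (smallBGraphs (l i) (t i)).length :=
    ((hl.add (.const 1)).bdd.mul h2).mono fun i => length_smallBGraphs_le _ _
  refine (A.comp_mem hered union one (Comp.finBGraph_graph (R := fun i => ⟨t i, R i⟩) hR) hb).and
    (Comp.forall_mem (enc := fun _ => ofFinBGraph) hsb (Comp.smallBGraphs ht hl h2) ?_)
  let κ := Σ i, {C // C ∈ smallBGraphs (l i) (t i)}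
  have hR1 := hR.upL (L := fun i => smallBGraphs (l i) (t i)) fun _ => ofFinBGraph
  have hC : Comp (fun p : κ => B p.1) (fun p => .pair (e p.1) (ofFinBGraph p.2.1))
    fun p => ofFinBGraph p.2.1 := .snd .refl
  have hbC : PolyBdd (fun p : κ => B p.1) fun p => p.2.1.n :=
    hl.bdd.up.mono fun p => n_le_of_mem_smallBGraphs p.2.2
  exact (A.comp_equivalent hered union one fin (R := fun p : κ => R p.1) (R' := fun p => p.2.1)
    (k := fun p => k p.1) (l := fun p => l p.1) (fun p => h1 p.1) (fun p => htk p.1) (fun p => hkl p.1)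
    (ht.upL fun _ => ofFinBGraph) (hl.upL fun _ => ofFinBGraph) h2.up hR1 hC hb.up hbC).imp
    ((Comp.finBGraph_n (R := fun p : κ => ⟨t p.1, R p.1⟩) hR1 hb.up).le
      (Comp.finBGraph_n (R := fun p : κ => ⟨t p.1, p.2.1⟩) hC hbC))

theorem DisjointSolver.comp_smallMinReps (A : H.DisjointSolver f) (hered : H.Hereditary)
    (union : H.UnionClosed) (one : H.Mem (⊥ : SimpleGraph Unit)) (fin : H.FiniteState)
    (hkl : ∀ i, H.repSize (k i) ≤ l i)
    (hk : CompNum B e k) (hl : CompNum B e l) (h2 : PolyBdd B fun i => 2 ^ l i ^ 2) :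
    Comp B e fun i => ofFamily (H.smallMinReps (k i) (l i)) := by
  have hsb : PolyBdd B fun i => (l i + 1) * 2 ^ l i ^ 2 := (hl.add (.const 1)).bdd.mul h2
  refine Comp.flatMap (enc := fun i (j : Fin (k i)) => ofNat (j : ℕ))
    (enc' := fun _ (R : Σ t : ℕ, FinBGraph t) => ofFinBGraph R.2)
    (hk.bdd.mono fun i => by simp) hsb (fun i j _ => ?_) hk.finRange ?_
  · rw [List.length_map]
    exact (List.length_filter_le _ _).trans (length_smallBGraphs_le _ _)
  let κ := Σ i, {j : Fin (k i) // j ∈ List.finRange (k i)}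
  have hl' : CompNum (fun p : κ => B p.1) (fun p => .pair (e p.1) (ofNat p.2.1)) fun p => l p.1 := hl.up
  have ht : CompNum (fun p : κ => B p.1) (fun p => .pair (e p.1) (ofNat p.2.1)) fun p => (p.2.1 : ℕ) + 1 :=
    .add ⟨.snd .refl, hk.bdd.up.mono fun p => p.2.1.2.le⟩ (.const 1)
  refine (Comp.filter (enc := fun _ => ofFinBGraph) (L := fun p : κ => smallBGraphs (l p.1) (p.2.1 + 1))
    (P := fun p R => H.IsMinRep R.toBGraph) (hsb.up.mono fun p => length_smallBGraphs_le _ _)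
    (Comp.smallBGraphs ht hl' h2.up) ?_).congr fun p => ?_
  · exact A.comp_isMinRep hered union one fin (l := fun p => l p.1.1)
      (k := fun p : Σ p : κ, {x // x ∈ smallBGraphs (l p.1) (p.2.1 + 1)} => k p.1.1)
      (t := fun p => p.1.2.1 + 1) (R := fun p => p.2.1) (fun p => Nat.le_add_left _ _)
      (fun p => p.1.2.1.2) (fun p => hkl _) (ht.upL fun _ => ofFinBGraph) (hl'.upL fun _ => ofFinBGraph)
      h2.up.up (.snd .refl) (hl'.bdd.up.mono fun p => n_le_of_mem_smallBGraphs p.2.2)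
  · rw [List.map_map]
    rfl

theorem FiniteState.repFamilyInTime (fin : H.FiniteState) (hered : H.Hereditary) (union : H.UnionClosed)
    (one : H.Mem (⊥ : SimpleGraph Unit)) (A : H.DisjointSolver f) {r : ℕ → ℕ}
    (hr : PolyTimeConstructible r) (hle : ∀ k, H.repSize k ≤ r k) :
    ∃ c : ℕ, H.RepFamilyInTime fun k => (2 ^ (r k ^ 2 + k) + 2) ^ c := by
  -- The first component is `0`: the deletion algorithm is used here only for membership tests, with
  -- the constant parameters `0` and `1`.
  let B : ℕ → ℕ × ℕ := fun k => (0, 2 ^ (r k ^ 2 + k))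
  have hlt : ∀ k, r k ^ 2 + k ≤ 2 ^ (r k ^ 2 + k) := fun k => Nat.lt_two_pow_self.le
  have hsq : ∀ k, r k ≤ r k ^ 2 := fun k => Nat.le_self_pow (by norm_num) _
  have hk : CompNum B ofNat id := ⟨.refl, PolyBdd.scale.mono fun k => (Nat.le_add_left _ _).trans (hlt k)⟩
  have hl : CompNum B ofNat r := by
    refine ⟨?_, PolyBdd.scale.mono fun k => (hsq k).trans ((Nat.le_add_right _ _).trans (hlt k))⟩
    obtain ⟨p, c, hp⟩ := hr
    refine ⟨p, c, fun k => (hp k).mono ?_⟩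
    simp only [cost, B, zero_add, one_mul]
    gcongr
    have := hlt k
    have := hsq k
    omega
  obtain ⟨p, c, hp⟩ := A.comp_smallMinReps hered union one fin (k := id) hle hk hl
    (PolyBdd.scale.mono fun k => Nat.pow_le_pow_right (by norm_num) (Nat.le_add_right _ _))
  refine ⟨c, p, fun k => ⟨_, fin.isRepFamily_smallMinReps hered (hle k), (hp k).mono ?_⟩⟩
  simp [cost, B]

theorem DeletionInTime.mono {T T' : ℕ → ℕ → ℕ → ℕ} (h : H.DeletionInTime T)
    (hT : ∀ k n N, 1 ≤ k → T k n N ≤ T' k n N) : H.DeletionInTime T' := by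
  obtain ⟨p, hp⟩ := h
  refine ⟨p, fun n N G D k hD hk => ?_⟩
  obtain ⟨S, hS, hr⟩ := hp n N G D k hD hk
  exact ⟨S, hS, hr.mono (hT k n N (by omega))⟩

theorem FiniteState.deletionInTime (fin : H.FiniteState) (hered : H.Hereditary) (union : H.UnionClosed)
    (disj : H.DisjointDeletionInTime f) {r : ℕ → ℕ} (hr : PolyTimeConstructible r)
    (hle : ∀ k, H.repSize k ≤ r k) :
    ∃ c : ℕ, H.DeletionInTime fun k n N =>
      f k (H.repSize k) * 2 ^ (c * (r k ^ 2 + k)) * (n + N + 2) ^ c := by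
  have key : ∃ c d : ℕ, H.DeletionInTime fun k n N => 2 ^ (c * k) * f k (H.repSize k) *
      ((2 ^ (r k ^ 2 + k) + 2) ^ d) ^ c * (n + N + 2) ^ c := by
    by_cases one : H.Mem (⊥ : SimpleGraph Unit)
    · obtain ⟨A⟩ := disj.solver
      obtain ⟨d, hd⟩ := fin.repFamilyInTime hered union one A hr hle
      obtain ⟨c, hc⟩ := hd.deletionInTime hered union disj
      exact ⟨c, d, hc⟩
    -- No family has to be computed in this case; `v = 1` and exponent `0` fit it into the common
    -- form.
    · obtain ⟨c, hc⟩ := deletionInTime_of_not_mem (v := fun _ => 1) hered disj (fun _ => le_rfl) one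
      exact ⟨c, 0, by simpa using hc⟩
  obtain ⟨c, d, h⟩ := key
  refine ⟨c + 3 * d * c, h.mono fun k n N hk => ?_⟩
  -- With `x = r k ^ 2 + k`, the left side is at most `2 ^ (x + 2)`, and `x + 2 ≤ 3 * x` because `x
  -- ≥ k ≥ 1`.
  have hbase : 2 ^ (r k ^ 2 + k) + 2 ≤ 2 ^ (3 * (r k ^ 2 + k)) := by
    have h1 : 2 ^ (r k ^ 2 + k) + 2 ≤ 2 ^ (r k ^ 2 + k) * 2 ^ 2 := by
      have := Nat.one_le_two_pow (n := r k ^ 2 + k)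
      omega
    rw [← pow_add] at h1
    exact h1.trans (Nat.pow_le_pow_right (by norm_num) (by omega))
  calc _ ≤ 2 ^ (c * (r k ^ 2 + k)) * f k (H.repSize k) * ((2 ^ (3 * (r k ^ 2 + k))) ^ d) ^ c *
        (n + N + 2) ^ c := by
        gcongr
        · norm_num
        · omega
    _ = f k (H.repSize k) * 2 ^ ((c + 3 * d * c) * (r k ^ 2 + k)) * (n + N + 2) ^ c := by
        rw [← pow_mul, ← pow_mul, show (c + 3 * d * c) * (r k ^ 2 + k) =
          c * (r k ^ 2 + k) + 3 * (r k ^ 2 + k) * d * c by ring, pow_add]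
        ring
    _ ≤ _ := by
        gcongr <;> omega

end GraphClass

theorem theorem3 (H : GraphClass) (hered : H.Hereditary) (union : H.UnionClosed)
    (finState : H.FiniteState) (f : ℕ → ℕ → ℕ) (disj : H.DisjointDeletionInTime f) :
    (∀ v : ℕ → ℕ, H.RepFamilyInTime v →
      ∃ c : ℕ, H.DeletionInTime fun k n N =>
        2 ^ (c * k) * f k (H.repSize k) * v k ^ c * (n + N + 2) ^ c) ∧
    (∀ r : ℕ → ℕ, PolyTimeConstructible r → (∀ k : ℕ, H.repSize k ≤ r k) →
      ∃ c : ℕ, H.DeletionInTime fun k n N =>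
        f k (H.repSize k) * 2 ^ (c * (r k ^ 2 + k)) * (n + N + 2) ^ c) :=
  ⟨fun _ hv => hv.deletionInTime hered union disj,
    fun _ hr hle => finState.deletionInTime hered union disj hr hle⟩
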